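/- **Setting.** Let $N$ be a closed Riemannian manifold and $E_N\to N$ a Hermitian vector bundle. Let $p_1\colon M_1\to N$ and $p_2\colon M_2\to N$ be Galois (connected, regular) Riemannian coverings with deck transformation groups $\Gamma_1$ and $\Gamma_2\cong\Gamma_1/H$, where $H\trianglelefteq\Gamma_1$, and $M_2\cong M_1/H$; let $\pi\colon M_1\to M_2$ be the projection, so that $p_2\circ\pi=p_1$ and $\pi(gy)=[g]\,\pi(y)$. Let $E_j=p_j^*E_N$, with the natural $\Gamma_j$-action on sections $(g\cdot s)(x)=g(s(g^{-1}x))$. For $T\in\mathcal B(L^2(E_j))$, the support of $T$ is the complement of the set of $(x,y)\in M_j\times M_j$ for which there are $f_1,f_2\in C_0(M_j)$ with $f_1(x)\ne0$, $f_2(y)\neq 0$ and $f_1Tf_2=0$; the propagation of $T$ is $\sup\{d(x,y):(x,y)\in\operatorname{supp}T\}$; $T$ is locally compact if $fT$ and $Tf$ are compact for all $f\in C_0(M_j)$. Let $\mathcal B_{\rm fp}(L^2(E_j))^{\Gamma_j}$ be the $*$-algebra of bounded $\Gamma_j$-equivariant operators on $L^2(E_j)$ with finite propagation, and $\mathbb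 C[M_j]^{\Gamma_j}$ its $*$-subalgebra of locally compact operators. Let $\{U_i\}_{i\in I}$ be a finite open cover of $N$ with lifts $U_i^e\subseteq M_1$ (open sets that $p_1$ maps bijectively onto $U_i$), let $\{\phi_i\}$ be a partition of unity subordinate to it, let $\phi_i^e$ be the lift of $\phi_i$ to $U_i^e$, extended by zero, and let $U_i^g=gU_i^e$, $\phi_i^g=g\cdot\phi_i^e$ for $g\in\Gamma_1$. For $v\in L^2(E_1)$ let $\phi_i^{[g]}v=\pi_*(\phi_i^gv)\in L^2(E_2)$ be the section over $\pi(U_i^g)$ corresponding to $\phi_i^gv$ under $\pi|_{U_i^g}$, extended by zero; for $u\in L^2(E_2)$ let $\phi_i^gu\in L^2(E_1)$ be the section supported in $U_i^g$ given there by $\phi_i^g(y)\,u(\pi(y))$, where $(E_1)_y$ is identified with $(E_2)_{\pi(y)}$. Let $S\subseteq\Gamma_1$ be a set of representatives of the cosets of $H$. **Proposition.** There is a $*$-homomorphism (the folding map) $\Psi\colon\mathcal B_{\rm fp}(L^2(E_1))^{\Gamma_1}\to\mathcal B_{\rm fp}(L^2(E_2))^{\Gamma_2}$ given by $$\Psi(T)u=\sum_{g\in\Gamma_1,\,s\in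 S}\ \sum_{i,j\in I}\phi_i^{[g]}\,T(\phi_j^su),\qquad u\in L^2(E_2),$$ the sum converging unconditionally in $L^2(E_2)$, and: 1. $\Psi$ is surjective. 2. If $T$ is locally compact, then so is $\Psi(T)$. 3. $\Psi$ restricts to a surjective $*$-homomorphism $\mathbb C[M_1]^{\Gamma_1}\to\mathbb C[M_2]^{\Gamma_2}$. 4. For every $T_2\in\mathcal B_{\rm fp}(L^2(E_2))^{\Gamma_2}$ the formula $$T_1v=\sum_{g\in\Gamma_1,\,i\in I}\ \sum_{s\in S,\,j\in I}\phi_j^{gs}\,T_2(\phi_i^{[g]}v),\qquad v\in L^2(E_1),$$ converges unconditionally in $L^2(E_1)$ and defines an operator $T_1\in\mathcal B_{\rm fp}(L^2(E_1))^{\Gamma_1}$ with $\Psi(T_1)=T_2$; if $T_2$ is locally compact, then so is $T_1$. -/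

import Mathlib

open scoped Manifold ContDiff ENNReal Topology Bundle ZeroAtInfty
open MeasureTheory Bundle

set_option linter.unusedSectionVars false

noncomputable section

namespace Folding

section Modules

variable {X G H : Type*} [MetricSpace X] [Group G] [MulAction G X]
  [NormedAddCommGroup H] [InnerProductSpace ℂ H] [CompleteSpace H]

variable (X G H) in
/-- An `X`-`G`-module structure on the Hilbert space `H`: a non-degenerate `*`-representation of
`C₀(X)` and a unitary representation of `G` that are covariant, `U_g ρ(f) U_g* = ρ(g · f)` with
`(g · f)(x) = f (g⁻¹ x)`. -/
structure EquivariantModule where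
  rep : C₀(X, ℂ) →⋆ₙₐ[ℂ] (H →L[ℂ] H)
  nondegenerate : Dense (Submodule.span ℂ {v : H | ∃ f w, v = rep f w} : Set H)
  unitary : G →* (H ≃ₗᵢ[ℂ] H)
  covariant : ∀ (g : G) (f f' : C₀(X, ℂ)), (∀ x, f' x = f (g⁻¹ • x)) →
    ∀ v, unitary g (rep f ((unitary g).symm v)) = rep f' v

section Helpers

/-- An ideal of `C₀(Y)` without common zeros on the compact set `K` contains all functions that
vanish off `K`. -/
theorem idealMem {Y : Type*} [TopologicalSpace Y] (I : C₀(Y, ℂ) → Prop) (h0 : I 0)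
    (hadd : ∀ f g, I f → I g → I (f + g)) (hmul : ∀ f g, I f → I (g * f))
    {K : Set Y} (hK : IsCompact K) (hpt : ∀ x ∈ K, ∃ f, I f ∧ f x ≠ 0)
    (f : C₀(Y, ℂ)) (hf : ∀ x ∉ K, f x = 0) : I f := by
  obtain ⟨F, hIF, hF, hFK⟩ : ∃ F : C₀(Y, ℂ), I F ∧ (∀ x, 0 ≤ (F x).re ∧ (F x).im = 0) ∧
      ∀ x ∈ K, 0 < (F x).re := by
    refine hK.induction_on (p := fun s => ∃ F : C₀(Y, ℂ), I F ∧
      (∀ x, 0 ≤ (F x).re ∧ (F x).im = 0) ∧ ∀ x ∈ s, 0 < (F x).re) ?_ ?_ ?_ ?_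
    · exact ⟨0, h0, by simp, by simp⟩
    · rintro s t hst ⟨F, h1, h2, h3⟩
      exact ⟨F, h1, h2, fun x hx => h3 x (hst hx)⟩
    · rintro s t ⟨F, h1, h2, h3⟩ ⟨F', h1', h2', h3'⟩
      refine ⟨F + F', hadd _ _ h1 h1', fun x => ?_, fun x hx => ?_⟩
      · have := h2 x; have := h2' x
        simp only [ZeroAtInftyContinuousMap.add_apply, Complex.add_re, Complex.add_im]
        constructor <;> linarith
      · simp only [ZeroAtInftyContinuousMap.add_apply, Complex.add_re]
        rcases hx with hx | hx
        · linarith [h3 x hx, (h2' x).1]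
        · linarith [h3' x hx, (h2 x).1]
    · intro x hx
      obtain ⟨g, hg, hgx⟩ := hpt x hx
      have hval : ∀ y, (star g * g) y = ((Complex.normSq (g y) : ℝ) : ℂ) := fun y => by
        rw [ZeroAtInftyContinuousMap.mul_apply, ZeroAtInftyContinuousMap.star_apply,
          Complex.normSq_eq_conj_mul_self]
        rfl
      refine ⟨{y | g y ≠ 0}, mem_nhdsWithin_of_mem_nhds
        ((isOpen_ne_fun g.continuous continuous_const).mem_nhds hgx), star g * g,
        hmul _ _ hg, fun y => ?_, fun y hy => ?_⟩
      · rw [hval]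
        exact ⟨by simpa using Complex.normSq_nonneg _, by simp⟩
      · rw [hval]
        simpa using hy
  rcases K.eq_empty_or_nonempty with rfl | hne
  · have : f = 0 := by ext x; simpa using hf x (by simp)
    rwa [this]
  obtain ⟨x₀, hx₀, hmin⟩ := hK.exists_isMinOn hne
    (Complex.continuous_re.comp F.continuous).continuousOn
  set c := (F x₀).re with hc
  have hcpos : 0 < c := hFK x₀ hx₀
  have hmaxpos : ∀ x, 0 < max (F x).re c := fun x => lt_max_of_lt_right hcpos
  let g : C₀(Y, ℂ) :=
    { toFun := fun x => f x * (((max (F x).re c)⁻¹ : ℝ) : ℂ)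
      continuous_toFun := by
        refine f.continuous.mul (Complex.continuous_ofReal.comp ?_)
        exact Continuous.inv₀ ((Complex.continuous_re.comp F.continuous).max continuous_const)
          fun x => (hmaxpos x).ne'
      zero_at_infty' := by
        have h1 := (zero_at_infty f).norm.mul_const c⁻¹
        simp only [norm_zero, zero_mul] at h1
        refine squeeze_zero_norm (fun x => ?_) h1
        rw [norm_mul, Complex.norm_real, Real.norm_of_nonneg (inv_nonneg.2 (hmaxpos x).le)]
        gcongr
        exact le_max_right _ _ }
  have hgF : g * F = f := by
    ext x
    rw [ZeroAtInftyContinuousMap.mul_apply]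
    change f x * (((max (F x).re c)⁻¹ : ℝ) : ℂ) * F x = f x
    by_cases hx : x ∈ K
    · have h1 : max (F x).re c = (F x).re := max_eq_left (hmin hx)
      have h2 : F x = (((F x).re : ℝ) : ℂ) := by
        apply Complex.ext <;> simp [(hF x).2]
      have h3 : (((F x).re : ℝ) : ℂ) ≠ 0 := by exact_mod_cast (hFK x hx).ne'
      rw [h1]
      nth_rewrite 2 [h2]
      rw [Complex.ofReal_inv, mul_assoc, inv_mul_cancel₀ h3, mul_one]
    · simp [hf x hx]
  rw [← hgF]
  exact hmul _ _ hIF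

theorem exists_bump {Y : Type*} [MetricSpace Y] [LocallyCompactSpace Y] {K U : Set Y}
    (hK : IsCompact K) (hU : IsOpen U) (hKU : K ⊆ U) :
    ∃ f : C₀(Y, ℂ), (∀ x ∈ K, f x = 1) ∧ (∀ x ∉ U, f x = 0) ∧ HasCompactSupport f ∧
      ∀ x, ‖f x‖ ≤ 1 := by
  obtain ⟨f, h1, h0, hc, hI⟩ := exists_continuous_one_zero_of_isCompact hK hU.isClosed_compl
    (Set.disjoint_left.2 fun x hx hx' => hx' (hKU hx))
  have hc' : HasCompactSupport fun x => ((f x : ℝ) : ℂ) :=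
    hc.comp_left (g := fun t : ℝ => (t : ℂ)) (by simp)
  refine ⟨⟨⟨fun x => ((f x : ℝ) : ℂ), by fun_prop⟩, ?_⟩, fun x hx => ?_, fun x hx => ?_, hc',
    fun x => ?_⟩
  · exact hc'.is_zero_at_infty
  · change ((f x : ℝ) : ℂ) = 1
    simp [h1 hx]
  · change ((f x : ℝ) : ℂ) = 0
    simp [h0 hx]
  · change ‖((f x : ℝ) : ℂ)‖ ≤ 1
    rw [Complex.norm_real, Real.norm_of_nonneg (hI x).1]
    exact (hI x).2

theorem exists_bump_at {Y : Type*} [MetricSpace Y] [LocallyCompactSpace Y] (x : Y) {r : ℝ}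
    (hr : 0 < r) : ∃ (f : C₀(Y, ℂ)) (K : Set Y), IsCompact K ∧ f x = 1 ∧ (∀ y ∉ K, f y = 0) ∧
      ∀ y ∈ K, dist y x < r := by
  obtain ⟨f, h1, h0, hc, -⟩ := exists_bump (isCompact_singleton (x := x))
    (Metric.isOpen_ball (x := x) (ε := r / 2)) (by simpa using hr)
  refine ⟨f, tsupport f, hc, h1 x rfl, fun y hy => image_eq_zero_of_notMem_tsupport hy,
    fun y hy => ?_⟩
  have : tsupport f ⊆ Metric.closedBall x (r / 2) := by
    refine closure_minimal (fun z hz => ?_) Metric.isClosed_closedBall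
    by_contra h
    exact hz (h0 z fun h' => h (Metric.ball_subset_closedBall h'))
  have := this hy
  rw [Metric.mem_closedBall] at this
  linarith

/-- The adjoint of a compact operator is compact. -/
theorem isCompactOperator_star {H : Type*} [NormedAddCommGroup H] [InnerProductSpace ℂ H]
    [CompleteSpace H] {T : H →L[ℂ] H} (hT : IsCompactOperator T) :
    IsCompactOperator (star T : H →L[ℂ] H) := by
  have hTT : IsCompactOperator (T * star T : H →L[ℂ] H) := hT.comp_clm (star T)
  have htb : TotallyBounded ((T * star T : H →L[ℂ] H) '' Metric.closedBall 0 1) :=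
    (hTT.isCompact_closure_image_closedBall (f := ((T * star T : H →L[ℂ] H) : H →ₗ[ℂ] H))
      1).totallyBounded.subset subset_closure
  refine (isCompactOperator_iff_isCompact_closure_image_closedBall
    ((star T : H →L[ℂ] H) : H →ₗ[ℂ] H) one_pos).2 ?_
  refine (TotallyBounded.closure ?_).isCompact_of_isClosed isClosed_closure
  rw [Metric.totallyBounded_iff]
  intro ε hε
  obtain ⟨t, hts, htf, hcov⟩ := Metric.finite_approx_of_totallyBounded htb (ε ^ 2 / 4) (by positivity)
  have hts' : ∀ y, ∃ b, y ∈ t → b ∈ Metric.closedBall (0 : H) 1 ∧ (T * star T : H →L[ℂ] H) b = y :=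
    fun y => by
      by_cases hy : y ∈ t
      · obtain ⟨b, h1, h2⟩ := hts hy
        exact ⟨b, fun _ => ⟨h1, h2⟩⟩
      · exact ⟨0, fun h => absurd h hy⟩
  choose b hb using hts'
  refine ⟨(fun y => (star T : H →L[ℂ] H) (b y)) '' t, htf.image _, ?_⟩
  rintro _ ⟨x, hx, rfl⟩
  obtain ⟨y, hy, hxy⟩ := Set.mem_iUnion₂.1 (hcov ⟨x, hx, rfl⟩)
  refine Set.mem_iUnion₂.2 ⟨_, ⟨y, hy, rfl⟩, ?_⟩
  rw [Metric.mem_ball, dist_eq_norm] at hxy ⊢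
  change ‖(star T : H →L[ℂ] H) x - (star T : H →L[ℂ] H) (b y)‖ < ε
  rw [← (hb y hy).2, ← map_sub] at hxy
  rw [← map_sub]
  set z := x - b y with hz
  have hz2 : ‖z‖ ≤ 2 := by
    have h1 := mem_closedBall_zero_iff.1 hx
    have h2 := mem_closedBall_zero_iff.1 (hb y hy).1
    linarith [norm_sub_le x (b y)]
  have h1 : ‖(star T : H →L[ℂ] H) z‖ ^ 2 ≤ ‖(T * star T : H →L[ℂ] H) z‖ * ‖z‖ := by
    rw [← inner_self_eq_norm_sq (𝕜 := ℂ), ContinuousLinearMap.star_eq_adjoint,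
      ContinuousLinearMap.adjoint_inner_left, ← inner_conj_symm, RCLike.conj_re]
    exact re_inner_le_norm _ _
  have h2 : ‖(star T : H →L[ℂ] H) z‖ ^ 2 < ε ^ 2 := by
    have h3 : ‖(T * star T : H →L[ℂ] H) z‖ * ‖z‖ ≤ ε ^ 2 / 4 * 2 := by gcongr
    have h4 : 0 < ε ^ 2 := by positivity
    linarith
  exact lt_of_pow_lt_pow_left₀ 2 hε.le h2

end Helpers

namespace EquivariantModule

variable (A : EquivariantModule X G H)

/-- The support of `T`: the complement of the set of `(x, y)` for which there are `f₁, f₂ ∈ C₀(X)`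
with `f₁ x ≠ 0`, `f₂ y ≠ 0` and `f₁ T f₂ = 0`. -/
def support (T : H →L[ℂ] H) : Set (X × X) :=
  {p | ∃ f₁ f₂ : C₀(X, ℂ), f₁ p.1 ≠ 0 ∧ f₂ p.2 ≠ 0 ∧ A.rep f₁ * T * A.rep f₂ = 0}ᶜ

/-- The propagation of `T`: the supremum of `d(x, y)` over the support of `T`. -/
def propagation (T : H →L[ℂ] H) : ℝ≥0∞ :=
  ⨆ p ∈ A.support T, edist p.1 p.2

/-- `T` is locally compact if `f T` and `T f` are compact for all `f ∈ C₀(X)`. -/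
def IsLocallyCompact (T : H →L[ℂ] H) : Prop :=
  ∀ f : C₀(X, ℂ), IsCompactOperator (A.rep f * T) ∧ IsCompactOperator (T * A.rep f)

/-- `T` is `G`-equivariant if `U_g T U_g* = T` for all `g` (note `U_g* = U_g⁻¹`). -/
def IsEquivariant (T : H →L[ℂ] H) : Prop :=
  ∀ (g : G) (v : H), A.unitary g (T ((A.unitary g).symm v)) = T v

theorem rep_mul_rep (f g : C₀(X, ℂ)) : A.rep f * A.rep g = A.rep g * A.rep f := by
  rw [← map_mul, ← map_mul, mul_comm]

theorem notMem_support {T : H →L[ℂ] H} {p : X × X} :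
    p ∉ A.support T ↔
      ∃ f₁ f₂ : C₀(X, ℂ), f₁ p.1 ≠ 0 ∧ f₂ p.2 ≠ 0 ∧ A.rep f₁ * T * A.rep f₂ = 0 := by
  simp [support]

theorem propagation_le_iff {T : H →L[ℂ] H} {R : ℝ≥0∞} :
    A.propagation T ≤ R ↔ ∀ p ∈ A.support T, edist p.1 p.2 ≤ R := by
  simp [propagation]

/-- `f₁ T f₂ = 0` when the product of the supports of `f₁` and `f₂` avoids the support of `T`. -/
theorem rep_mul_rep_eq_zero [LocallyCompactSpace X] {T : H →L[ℂ] H} {K₁ K₂ : Set X} (hK₁ : IsCompact K₁)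
    (hK₂ : IsCompact K₂) (hT : ∀ x ∈ K₁, ∀ y ∈ K₂, (x, y) ∉ A.support T) {f₁ f₂ : C₀(X, ℂ)}
    (hf₁ : ∀ x ∉ K₁, f₁ x = 0) (hf₂ : ∀ x ∉ K₂, f₂ x = 0) : A.rep f₁ * T * A.rep f₂ = 0 := by
  refine idealMem (fun f => A.rep f₁ * T * A.rep f = 0) (by simp) ?_ ?_ hK₂ ?_ f₂ hf₂
  · intro f g hf hg
    rw [map_add, mul_add, hf, hg, add_zero]
  · intro f g hf
    rw [mul_comm, map_mul, ← mul_assoc, hf, zero_mul]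
  intro y hy
  have hbump : ∀ y : X, ∃ h : C₀(X, ℂ), h y ≠ 0 := fun y => by
    obtain ⟨h, -, -, hh, -⟩ := exists_bump_at y one_pos
    exact ⟨h, by simp [hh]⟩
  have := idealMem (fun f => ∃ h : C₀(X, ℂ), A.rep f * T * A.rep h = 0 ∧ h y ≠ 0) ?_ ?_ ?_ hK₁ ?_
    f₁ hf₁
  · obtain ⟨h, h1, h2⟩ := this
    exact ⟨h, h1, h2⟩
  · obtain ⟨h, hh⟩ := hbump y
    exact ⟨h, by simp, hh⟩
  · rintro f g ⟨h, h1, h2⟩ ⟨h', h1', h2'⟩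
    refine ⟨h * h', ?_, by simp [h2, h2']⟩
    rw [map_add, add_mul, add_mul, map_mul]
    nth_rewrite 2 [rep_mul_rep]
    rw [← mul_assoc, h1, ← mul_assoc, h1', zero_mul, zero_mul, add_zero]
  · rintro f g ⟨h, h1, h2⟩
    refine ⟨h, ?_, h2⟩
    rw [map_mul, mul_assoc, mul_assoc, ← mul_assoc (A.rep f), h1, mul_zero]
  · intro x hx
    obtain ⟨g₁, g₂, h1, h2, h3⟩ := A.notMem_support.1 (hT x hx y hy)
    exact ⟨g₁, ⟨g₂, h3, h2⟩, h1⟩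

theorem support_add (S T : H →L[ℂ] H) : A.support (S + T) ⊆ A.support S ∪ A.support T := by
  intro p hp
  by_contra h
  rw [Set.mem_union, not_or, notMem_support, notMem_support] at h
  obtain ⟨⟨f₁, f₂, h1, h2, h3⟩, g₁, g₂, k1, k2, k3⟩ := h
  refine A.notMem_support.2 ⟨g₁ * f₁, f₂ * g₂, by simp [h1, k1], by simp [h2, k2], ?_⟩ hp
  have e1 : A.rep (g₁ * f₁) * S * A.rep (f₂ * g₂)
      = A.rep g₁ * (A.rep f₁ * S * A.rep f₂) * A.rep g₂ := by
    simp only [map_mul, mul_assoc]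
  have e2 : A.rep (g₁ * f₁) * T * A.rep (f₂ * g₂)
      = A.rep f₁ * (A.rep g₁ * T * A.rep g₂) * A.rep f₂ := by
    rw [mul_comm g₁, mul_comm f₂]
    simp only [map_mul, mul_assoc]
  rw [mul_add, add_mul, e1, e2, h3, k3]
  simp

theorem support_star (T : H →L[ℂ] H) {p : X × X} (hp : p ∈ A.support (star T)) :
    (p.2, p.1) ∈ A.support T := by
  by_contra h
  obtain ⟨f₁, f₂, h1, h2, h3⟩ := A.notMem_support.1 h
  refine A.notMem_support.2 ⟨star f₂, star f₁, by simpa using h2, by simpa using h1, ?_⟩ hp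
  have := congrArg star h3
  simpa [star_mul, mul_assoc, map_star] using this

theorem support_smul (c : ℂ) (T : H →L[ℂ] H) : A.support (c • T) ⊆ A.support T := by
  intro p hp
  by_contra h
  obtain ⟨f₁, f₂, h1, h2, h3⟩ := A.notMem_support.1 h
  refine A.notMem_support.2 ⟨f₁, f₂, h1, h2, ?_⟩ hp
  rw [mul_smul_comm, smul_mul_assoc, h3, smul_zero]

theorem propagation_add (S T : H →L[ℂ] H) :
    A.propagation (S + T) ≤ max (A.propagation S) (A.propagation T) := by
  refine A.propagation_le_iff.2 fun p hp => ?_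
  rcases A.support_add S T hp with h | h
  · exact (A.propagation_le_iff.1 le_rfl p h).trans (le_max_left _ _)
  · exact (A.propagation_le_iff.1 le_rfl p h).trans (le_max_right _ _)

theorem propagation_star (T : H →L[ℂ] H) : A.propagation (star T) ≤ A.propagation T := by
  refine A.propagation_le_iff.2 fun p hp => ?_
  rw [edist_comm]
  exact A.propagation_le_iff.1 le_rfl _ (A.support_star T hp)

theorem propagation_smul (c : ℂ) (T : H →L[ℂ] H) : A.propagation (c • T) ≤ A.propagation T :=
  A.propagation_le_iff.2 fun p hp => A.propagation_le_iff.1 le_rfl p (A.support_smul c T hp)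

theorem IsEquivariant.apply {T : H →L[ℂ] H} (hT : A.IsEquivariant T) (g : G) (v : H) :
    A.unitary g (T v) = T (A.unitary g v) := by
  simpa using hT g (A.unitary g v)

theorem isEquivariant_of_apply {T : H →L[ℂ] H}
    (hT : ∀ g v, A.unitary g (T v) = T (A.unitary g v)) : A.IsEquivariant T := by
  intro g v
  rw [hT, LinearIsometryEquiv.apply_symm_apply]

theorem IsEquivariant.star {T : H →L[ℂ] H} (hT : A.IsEquivariant T) :
    A.IsEquivariant (star T) := by
  refine A.isEquivariant_of_apply fun g v => ext_inner_right ℂ fun w => ?_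
  have h : A.unitary g ((A.unitary g).symm w) = w := by simp
  rw [ContinuousLinearMap.star_eq_adjoint, ContinuousLinearMap.adjoint_inner_left]
  conv_lhs => rw [← h]
  conv_rhs => rw [← h]
  rw [LinearIsometryEquiv.inner_map_map, ContinuousLinearMap.adjoint_inner_left, ← hT.apply,
    LinearIsometryEquiv.inner_map_map]

theorem isEquivariant_one : A.IsEquivariant 1 := A.isEquivariant_of_apply fun _ _ => rfl

theorem isEquivariant_zero : A.IsEquivariant 0 := A.isEquivariant_of_apply fun _ _ => by simp

theorem IsEquivariant.add {S T : H →L[ℂ] H} (hS : A.IsEquivariant S) (hT : A.IsEquivariant T) :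
    A.IsEquivariant (S + T) :=
  A.isEquivariant_of_apply fun g v => by simp [hS.apply, hT.apply]

theorem IsEquivariant.mul {S T : H →L[ℂ] H} (hS : A.IsEquivariant S) (hT : A.IsEquivariant T) :
    A.IsEquivariant (S * T) :=
  A.isEquivariant_of_apply fun g v => by simp [hS.apply, hT.apply]

theorem IsEquivariant.smul {T : H →L[ℂ] H} (c : ℂ) (hT : A.IsEquivariant T) :
    A.IsEquivariant (c • T) :=
  A.isEquivariant_of_apply fun g v => by simp [hT.apply]

theorem isLocallyCompact_zero : A.IsLocallyCompact 0 := fun f => by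
  simpa using isCompactOperator_zero

theorem IsLocallyCompact.add {S T : H →L[ℂ] H} (hS : A.IsLocallyCompact S)
    (hT : A.IsLocallyCompact T) : A.IsLocallyCompact (S + T) := fun f => by
  rw [mul_add, add_mul]
  exact ⟨(hS f).1.add (hT f).1, (hS f).2.add (hT f).2⟩

theorem IsLocallyCompact.smul {T : H →L[ℂ] H} (c : ℂ) (hT : A.IsLocallyCompact T) :
    A.IsLocallyCompact (c • T) := fun f => by
  rw [mul_smul_comm, smul_mul_assoc]
  exact ⟨(hT f).1.smul c, (hT f).2.smul c⟩

theorem IsLocallyCompact.mul {S T : H →L[ℂ] H} (hS : A.IsLocallyCompact S)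
    (hT : A.IsLocallyCompact T) : A.IsLocallyCompact (S * T) := fun f => by
  rw [← mul_assoc, mul_assoc S]
  exact ⟨(hS f).1.comp_clm T, (hT f).2.clm_comp S⟩

theorem IsLocallyCompact.star {T : H →L[ℂ] H} (hT : A.IsLocallyCompact T) :
    A.IsLocallyCompact (star T) := fun f => by
  have h1 := isCompactOperator_star (hT (Star.star f)).2
  have h2 := isCompactOperator_star (hT (Star.star f)).1
  rw [star_mul, map_star, star_star] at h1 h2
  exact ⟨h1, h2⟩

variable [LocallyCompactSpace X]

theorem propagation_one : A.propagation (1 : H →L[ℂ] H) = 0 := by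
  refine le_antisymm (A.propagation_le_iff.2 fun p hp => ?_) bot_le
  by_contra h
  have hd : 0 < dist p.1 p.2 := by
    rw [dist_pos]; rintro h'; simp [h'] at h
  obtain ⟨f₁, K₁, -, h1, z1, k1⟩ := exists_bump_at p.1 (half_pos hd)
  obtain ⟨f₂, K₂, -, h2, z2, k2⟩ := exists_bump_at p.2 (half_pos hd)
  refine A.notMem_support.2 ⟨f₁, f₂, by simp [h1], by simp [h2], ?_⟩ hp
  have : f₁ * f₂ = 0 := by
    ext x
    by_contra h0
    simp only [ZeroAtInftyContinuousMap.mul_apply, ZeroAtInftyContinuousMap.zero_apply,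
      mul_eq_zero, not_or] at h0
    have a1 := k1 x (not_imp_comm.1 (z1 x) h0.1)
    have a2 := k2 x (not_imp_comm.1 (z2 x) h0.2)
    linarith [dist_triangle_left p.1 p.2 x]
  rw [mul_one, ← map_mul, this, map_zero]

theorem propagation_zero : A.propagation (0 : H →L[ℂ] H) = 0 := by
  have := A.propagation_smul 0 (1 : H →L[ℂ] H)
  rw [zero_smul, A.propagation_one] at this
  exact le_antisymm this bot_le

/-- Every vector is a limit of its truncations by compactly supported functions. -/
theorem mem_closure_rep (v : H) :
    v ∈ closure {w : H | ∃ f : C₀(X, ℂ), HasCompactSupport f ∧ w = A.rep f v} := by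
  have key : ∀ z ∈ Submodule.span ℂ {v : H | ∃ f w, v = A.rep f w}, ∀ ε > 0, ∃ K : Set X,
      IsCompact K ∧ ∀ e : C₀(X, ℂ), (∀ x ∈ K, e x = 1) → (∀ x, ‖e x‖ ≤ 1) →
        ‖A.rep e z - z‖ ≤ ε := by
    intro z hz
    induction hz using Submodule.span_induction with
    | mem z hz =>
      obtain ⟨f, w, rfl⟩ := hz
      intro ε hε
      set η : ℝ := ε / (2 * (‖w‖ + 1)) with hη
      have hηpos : 0 < η := by positivity
      have hev : ∀ᶠ x in Filter.cocompact X, ‖f x‖ < η := by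
        have := (zero_at_infty f).norm
        rw [norm_zero] at this
        exact this.eventually_lt_const hηpos
      obtain ⟨K, hK, hKf⟩ := Filter.mem_cocompact.1 hev
      refine ⟨K, hK, fun e he1 he2 => ?_⟩
      have h1 : ‖e * f - f‖ ≤ 2 * η := by
        rw [← ZeroAtInftyContinuousMap.norm_toBCF_eq_norm]
        refine (BoundedContinuousFunction.norm_le (by positivity)).2 fun x => ?_
        change ‖e x * f x - f x‖ ≤ 2 * η
        by_cases hx : x ∈ K
        · rw [he1 x hx, one_mul, sub_self, norm_zero]; positivity
        · have h3 : ‖f x‖ < η := hKf hx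
          have h4 : ‖e x * f x‖ ≤ ‖f x‖ := by
            rw [norm_mul]
            exact mul_le_of_le_one_left (norm_nonneg _) (he2 x)
          linarith [norm_sub_le (e x * f x) (f x)]
      have h2 : A.rep e (A.rep f w) - A.rep f w = A.rep (e * f - f) w := by
        rw [map_sub, map_mul]; rfl
      rw [h2]
      calc ‖A.rep (e * f - f) w‖ ≤ ‖A.rep (e * f - f)‖ * ‖w‖ := ContinuousLinearMap.le_opNorm _ _
        _ ≤ (2 * η) * (‖w‖ + 1) := by
            gcongr
            · exact (NonUnitalStarAlgHom.norm_apply_le A.rep _).trans h1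
            · linarith
        _ = ε := by rw [hη]; field_simp
    | zero => intro ε hε; exact ⟨∅, isCompact_empty, fun e _ _ => by simpa using hε.le⟩
    | add y z _ _ hy hz =>
      intro ε hε
      obtain ⟨K, hK, h1⟩ := hy (ε / 2) (half_pos hε)
      obtain ⟨L, hL, h2⟩ := hz (ε / 2) (half_pos hε)
      refine ⟨K ∪ L, hK.union hL, fun e he1 he2 => ?_⟩
      have e1 := h1 e (fun x hx => he1 x (Or.inl hx)) he2
      have e2 := h2 e (fun x hx => he1 x (Or.inr hx)) he2
      rw [map_add, add_sub_add_comm]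
      linarith [norm_add_le (A.rep e y - y) (A.rep e z - z)]
    | smul c z _ hz =>
      intro ε hε
      obtain ⟨K, hK, h1⟩ := hz (ε / (‖c‖ + 1)) (by positivity)
      refine ⟨K, hK, fun e he1 he2 => ?_⟩
      rw [map_smul, ← smul_sub, norm_smul]
      calc ‖c‖ * ‖A.rep e z - z‖ ≤ (‖c‖ + 1) * (ε / (‖c‖ + 1)) := by
            gcongr
            · linarith
            · exact h1 e he1 he2
        _ = ε := by field_simp
  rw [Metric.mem_closure_iff]
  intro ε hε
  obtain ⟨z, hz, hvz⟩ := Metric.mem_closure_iff.1 (A.nondegenerate v) (ε / 3) (by positivity)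
  obtain ⟨K, hK, hKe⟩ := key z hz (ε / 4) (by positivity)
  obtain ⟨e, he1, -, hec, he2⟩ := exists_bump hK isOpen_univ (Set.subset_univ K)
  refine ⟨_, ⟨e, hec, rfl⟩, ?_⟩
  have h1 := hKe e he1 he2
  have hnorm : ‖A.rep e‖ ≤ 1 := by
    refine (NonUnitalStarAlgHom.norm_apply_le A.rep e).trans ?_
    rw [← ZeroAtInftyContinuousMap.norm_toBCF_eq_norm]
    exact (BoundedContinuousFunction.norm_le zero_le_one).2 he2
  have h2 : ‖A.rep e (z - v)‖ ≤ ‖z - v‖ :=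
    ((A.rep e).le_opNorm _).trans (mul_le_of_le_one_left (norm_nonneg _) hnorm)
  rw [dist_eq_norm] at hvz ⊢
  have h3 : v - A.rep e v = (v - z) - (A.rep e z - z) + A.rep e (z - v) := by
    rw [map_sub]; abel
  rw [h3]
  rw [norm_sub_rev z v] at h2
  linarith [norm_add_le ((v - z) - (A.rep e z - z)) (A.rep e (z - v)),
    norm_sub_le (v - z) (A.rep e z - z)]

theorem propagation_mul (S T : H →L[ℂ] H) :
    A.propagation (S * T) ≤ A.propagation S + A.propagation T := by
  refine A.propagation_le_iff.2 fun p hp => ?_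
  by_contra! hlt
  have hfin : A.propagation S + A.propagation T ≠ ⊤ := hlt.ne_top
  rw [ENNReal.add_ne_top] at hfin
  obtain ⟨hS, hT⟩ := hfin
  set a := (A.propagation S).toReal with ha
  set b := (A.propagation T).toReal with hb
  have haS : ∀ q : X × X, a < dist q.1 q.2 → q ∉ A.support S := fun q hq hq' => by
    have := A.propagation_le_iff.1 le_rfl q hq'
    rw [edist_dist, ENNReal.ofReal_le_iff_le_toReal hS] at this
    linarith
  have hbT : ∀ q : X × X, b < dist q.1 q.2 → q ∉ A.support T := fun q hq hq' => by
    have := A.propagation_le_iff.1 le_rfl q hq'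
    rw [edist_dist, ENNReal.ofReal_le_iff_le_toReal hT] at this
    linarith
  have hd : a + b < dist p.1 p.2 := by
    rw [edist_dist, ENNReal.lt_ofReal_iff_toReal_lt (ENNReal.add_ne_top.2 ⟨hS, hT⟩),
      ENNReal.toReal_add hS hT] at hlt
    exact hlt
  set δ := (dist p.1 p.2 - a - b) / 4 with hδ
  have hδpos : 0 < δ := by rw [hδ]; linarith
  obtain ⟨f₁, K₁, hK₁, h1, z1, k1⟩ := exists_bump_at p.1 hδpos
  obtain ⟨f₂, K₂, hK₂, h2, z2, k2⟩ := exists_bump_at p.2 hδpos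
  refine A.notMem_support.2 ⟨f₁, f₂, by simp [h1], by simp [h2], ?_⟩ hp
  have key : ∀ m : C₀(X, ℂ), HasCompactSupport m →
      A.rep f₁ * S * A.rep m * T * A.rep f₂ = 0 := by
    intro m hm
    refine (idealMem (fun h => A.rep f₁ * S * A.rep h * T * A.rep f₂ = 0 ∧
      ∀ k, A.rep f₁ * S * A.rep (k * h) * T * A.rep f₂ = 0) ?_ ?_ ?_ hm ?_ m
      fun x hx => image_eq_zero_of_notMem_tsupport hx).1
    · simp
    · rintro f g ⟨e1, e2⟩ ⟨e1', e2'⟩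
      refine ⟨?_, fun k => ?_⟩
      · simp only [map_add, mul_add, add_mul, e1, e1', add_zero]
      · rw [mul_add k f g, map_add]
        simp only [mul_add, add_mul, e2, e2', add_zero]
    · rintro f g ⟨e1, e2⟩
      exact ⟨e2 g, fun k => by rw [← mul_assoc k g f]; exact e2 _⟩
    · intro w _
      obtain ⟨h, K, hK, h3, z3, k3⟩ := exists_bump_at w hδpos
      have hzero : ∀ h' : C₀(X, ℂ), (∀ x ∉ K, h' x = 0) →
          A.rep f₁ * S * A.rep h' * T * A.rep f₂ = 0 := by
        intro h' hh'
        rcases le_or_gt (a + 2 * δ) (dist p.1 w) with hw | hw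
        · rw [A.rep_mul_rep_eq_zero hK₁ hK (fun x hx y hy => haS _ ?_) z1 hh', zero_mul, zero_mul]
          have a1 := k1 x hx
          have a2 := k3 y hy
          have := dist_triangle4 p.1 x y w
          rw [dist_comm p.1 x] at this
          change a < dist x y
          linarith
        · rw [mul_assoc, mul_assoc, ← mul_assoc (A.rep h'),
            A.rep_mul_rep_eq_zero hK hK₂ (fun x hx y hy => hbT _ ?_) hh' z2, mul_zero]
          have a1 := k3 x hx
          have a2 := k2 y hy
          have t1 := dist_triangle4 w x y p.2
          rw [dist_comm w x] at t1
          have t2 := dist_triangle p.1 w p.2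
          change b < dist x y
          linarith
      refine ⟨h, ⟨hzero h z3, fun k => hzero _ fun x hx => ?_⟩, by simp [h3]⟩
      simp [z3 x hx]
  ext v
  have hcl : IsClosed {w : H | A.rep f₁ (S w) = 0} :=
    isClosed_eq ((A.rep f₁).continuous.comp S.continuous) continuous_const
  have := closure_minimal (s := {w : H | ∃ f : C₀(X, ℂ), HasCompactSupport f ∧
      w = A.rep f (T (A.rep f₂ v))}) ?_ hcl (A.mem_closure_rep (T (A.rep f₂ v)))
  · exact this
  · rintro _ ⟨m, hm, rfl⟩
    exact DFunLike.congr_fun (key m hm) v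

/-- The `*`-algebra of bounded `G`-equivariant operators with finite propagation. -/
def finitePropagationAlgebra : StarSubalgebra ℂ (H →L[ℂ] H) where
  carrier := {T | A.IsEquivariant T ∧ A.propagation T < ⊤}
  mul_mem' := fun hS hT => ⟨hS.1.mul A hT.1,
    (A.propagation_mul _ _).trans_lt (ENNReal.add_lt_top.2 ⟨hS.2, hT.2⟩)⟩
  add_mem' := fun hS hT => ⟨hS.1.add A hT.1,
    (A.propagation_add _ _).trans_lt (max_lt hS.2 hT.2)⟩
  algebraMap_mem' := fun c => by
    rw [Algebra.algebraMap_eq_smul_one]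
    refine ⟨A.isEquivariant_one.smul A c, (A.propagation_smul c 1).trans_lt ?_⟩
    rw [A.propagation_one]
    exact ENNReal.zero_lt_top
  star_mem' := fun hT => ⟨hT.1.star A, (A.propagation_star _).trans_lt hT.2⟩

/-- The equivariant algebraic Roe algebra: the `*`-algebra of `G`-equivariant, locally compact
operators with finite propagation. -/
def roeAlgebra : NonUnitalStarSubalgebra ℂ (H →L[ℂ] H) where
  carrier := {T | A.IsEquivariant T ∧ A.IsLocallyCompact T ∧ A.propagation T < ⊤}
  zero_mem' := ⟨A.isEquivariant_zero, A.isLocallyCompact_zero, by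
    rw [A.propagation_zero]; exact ENNReal.zero_lt_top⟩
  mul_mem' := fun hS hT => ⟨hS.1.mul A hT.1, hS.2.1.mul A hT.2.1,
    (A.propagation_mul _ _).trans_lt (ENNReal.add_lt_top.2 ⟨hS.2.2, hT.2.2⟩)⟩
  add_mem' := fun hS hT => ⟨hS.1.add A hT.1, hS.2.1.add A hT.2.1,
    (A.propagation_add _ _).trans_lt (max_lt hS.2.2 hT.2.2)⟩
  smul_mem' := fun c _ hT => ⟨hT.1.smul A c, hT.2.1.smul A c,
    (A.propagation_smul c _).trans_lt hT.2.2⟩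
  star_mem' := fun hT => ⟨hT.1.star A, hT.2.1.star A, (A.propagation_star _).trans_lt hT.2.2⟩

theorem roeAlgebra_le {T : H →L[ℂ] H} (hT : T ∈ A.roeAlgebra) :
    T ∈ A.finitePropagationAlgebra := ⟨hT.1, hT.2.2⟩

end EquivariantModule
end Modules
section Sections

/-- A Hermitian vector bundle: the fibres are complex inner product spaces and the fibre norm is a
continuous function on the total space. -/
class IsHermitianBundle {N : Type*} [TopologicalSpace N] (F : Type*) [NormedAddCommGroup F]
    [NormedSpace ℂ F] (E : N → Type*) [∀ x, NormedAddCommGroup (E x)]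
    [∀ x, InnerProductSpace ℂ (E x)] [TopologicalSpace (TotalSpace F E)] [FiberBundle F E]
    [VectorBundle ℂ F E] : Prop where
  continuous_norm : Continuous fun v : TotalSpace F E => ‖v.2‖

variable {N : Type*} [MetricSpace N] (F : Type*) [NormedAddCommGroup F] [NormedSpace ℂ F]
  (E : N → Type*) [∀ x, NormedAddCommGroup (E x)] [∀ x, InnerProductSpace ℂ (E x)]
  [TopologicalSpace (TotalSpace F E)] [FiberBundle F E] [VectorBundle ℂ F E]
  {X : Type*} [TopologicalSpace X] [MeasurableSpace X]
  (q : C(X, N)) (μ : Measure X)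

/-- A section of the pulled back bundle `q^* E`, that is, a family `s x ∈ E (q x)`, is (Borel)
measurable if it is so in the local trivializations of `E`. (`linearMapAt` is the fibre coordinate
of the trivialization over its base set, and `0` elsewhere.) -/
def IsMeasurableSection (s : ∀ x : X, E (q x)) : Prop :=
  ∀ b : N, StronglyMeasurable fun x => (trivializationAt F E b).linearMapAt ℂ (q x) (s x)

variable {F E q} in
theorem IsMeasurableSection.add {s t : ∀ x : X, E (q x)} (hs : IsMeasurableSection F E q s)
    (ht : IsMeasurableSection F E q t) : IsMeasurableSection F E q (s + t) := fun b => by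
  simp only [Pi.add_apply, map_add]
  exact (hs b).add (ht b)

variable {F E q} in
theorem IsMeasurableSection.smul {s : ∀ x : X, E (q x)} (hs : IsMeasurableSection F E q s)
    {f : X → ℂ} (hf : StronglyMeasurable f) :
    IsMeasurableSection F E q fun x => f x • s x := fun b => by
  simp only [map_smul]
  exact hf.smul (hs b)

variable {F E q} in
theorem IsMeasurableSection.const_smul {s : ∀ x : X, E (q x)} (hs : IsMeasurableSection F E q s)
    (c : ℂ) : IsMeasurableSection F E q (c • s) := fun b => by
  simp only [Pi.smul_apply, map_smul]
  exact (hs b).const_smul c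

variable {F E q} in
theorem isMeasurableSection_zero : IsMeasurableSection F E q 0 := fun b => by
  simp only [Pi.zero_apply, map_zero]
  exact stronglyMeasurable_const

variable [CompactSpace N] [FiniteDimensional ℂ F] [IsHermitianBundle F E] [BorelSpace X]

variable {F E q} in
theorem IsMeasurableSection.norm {s : ∀ x : X, E (q x)} (hs : IsMeasurableSection F E q s) :
    Measurable fun x => ‖s x‖ := by
  classical
  borelize F
  borelize N
  have : ProperSpace F := FiniteDimensional.proper ℂ F
  obtain ⟨t, ht⟩ := isCompact_univ.elim_finite_subcover
    (fun b : N => (trivializationAt F E b).baseSet)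
    (fun b => (trivializationAt F E b).open_baseSet)
    (fun b _ => Set.mem_iUnion.2 ⟨b, FiberBundle.mem_baseSet_trivializationAt' b⟩)
  have key : ∀ b : N, ∃ h : X → ℝ, Measurable h ∧
      ∀ x, q x ∈ (trivializationAt F E b).baseSet → h x = ‖s x‖ := by
    intro b
    set e := trivializationAt F E b
    let g : N × F → ℝ := (e.baseSet ×ˢ Set.univ).piecewise (fun z => ‖e.symm z.1 z.2‖) 0
    have hg : Measurable g := by
      refine ContinuousOn.measurable_piecewise ?_ continuousOn_const
        (e.open_baseSet.measurableSet.prod MeasurableSet.univ)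
      exact (IsHermitianBundle.continuous_norm (F := F) (E := E)).comp_continuousOn
        e.continuousOn_symm
    refine ⟨fun x => g (q x, e.linearMapAt ℂ (q x) (s x)),
      hg.comp (q.continuous.measurable.prodMk (hs b).measurable), fun x hx => ?_⟩
    have : (q x, e.linearMapAt ℂ (q x) (s x)) ∈ e.baseSet ×ˢ (Set.univ : Set F) := ⟨hx, trivial⟩
    simp only [g, Set.piecewise_eq_of_mem _ _ _ this]
    rw [e.symm_linearMapAt hx]
  choose h hm he using key
  intro S hS
  have : (fun x => ‖s x‖) ⁻¹' S =
      ⋃ b ∈ t, (q ⁻¹' (trivializationAt F E b).baseSet) ∩ h b ⁻¹' S := by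
    ext x
    simp only [Set.mem_preimage, Set.mem_iUnion, Set.mem_inter_iff, exists_prop]
    constructor
    · intro hx
      obtain ⟨b, hb⟩ := Set.mem_iUnion.1 (ht (Set.mem_univ (q x)))
      obtain ⟨hbt, hbx⟩ := Set.mem_iUnion.1 hb
      exact ⟨b, hbt, hbx, by rwa [he b x hbx]⟩
    · rintro ⟨b, -, hbx, hx⟩
      rwa [he b x hbx] at hx
  rw [this]
  refine t.measurableSet_biUnion fun b _ => ?_
  exact (q.continuous.measurable (trivializationAt F E b).open_baseSet.measurableSet).inter
    (hm b hS)

/-- A measurable section `s` of `q^* E` with `∫ ‖s‖² dμ < ∞`. -/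
def IsSquareIntegrable (s : ∀ x : X, E (q x)) : Prop :=
  IsMeasurableSection F E q s ∧ MemLp (fun x => ‖s x‖) 2 μ

variable {F E q μ} in
theorem IsSquareIntegrable.mono {s : ∀ x : X, E (q x)} {g : X → ℝ} (hg : MemLp g 2 μ)
    (hs : IsMeasurableSection F E q s) (h : ∀ x, ‖s x‖ ≤ g x) :
    IsSquareIntegrable F E q μ s :=
  ⟨hs, hg.mono' hs.norm.aestronglyMeasurable (Filter.Eventually.of_forall fun x => by
    simpa using h x)⟩

/-- The vector space of square integrable sections of `q^* E`. -/
def squareIntegrableSubmodule : Submodule ℂ (∀ x : X, E (q x)) where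
  carrier := {s | IsSquareIntegrable F E q μ s}
  zero_mem' := ⟨isMeasurableSection_zero, by simp⟩
  add_mem' := fun {s t} hs ht => IsSquareIntegrable.mono (hs.2.add ht.2) (hs.1.add ht.1)
    fun x => norm_add_le (s x) (t x)
  smul_mem' := fun c s hs => IsSquareIntegrable.mono (hs.2.const_mul ‖c‖) (hs.1.const_smul c)
    fun x => (norm_smul c (s x)).le

/-- The square integrable sections of `q^* E`, with the positive semidefinite inner product
`⟪s, t⟫ = ∫ ⟪s x, t x⟫ dμ`. -/
def L2Section : Type _ := squareIntegrableSubmodule F E q μ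

namespace L2Section

instance : AddCommGroup (L2Section F E q μ) :=
  inferInstanceAs (AddCommGroup (squareIntegrableSubmodule F E q μ))

instance : Module ℂ (L2Section F E q μ) :=
  inferInstanceAs (Module ℂ (squareIntegrableSubmodule F E q μ))

variable {F E q μ}

/-- The section underlying an element of `L2Section`. -/
def val (s : L2Section F E q μ) : ∀ x : X, E (q x) := Subtype.val s

/-- The element of `L2Section` given by a square integrable section. -/
def mk (s : ∀ x : X, E (q x)) (hs : IsSquareIntegrable F E q μ s) : L2Section F E q μ := ⟨s, hs⟩

theorem prop (s : L2Section F E q μ) : IsSquareIntegrable F E q μ s.val := Subtype.prop s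

@[ext] theorem ext {s t : L2Section F E q μ} (h : ∀ x, s.val x = t.val x) : s = t :=
  Subtype.ext (funext h)

@[simp] theorem mk_val (s : ∀ x : X, E (q x)) (hs : IsSquareIntegrable F E q μ s) :
    (mk s hs).val = s := rfl

@[simp] theorem zero_val : (0 : L2Section F E q μ).val = 0 := rfl

@[simp] theorem add_val (s t : L2Section F E q μ) : (s + t).val = s.val + t.val := rfl

@[simp] theorem sub_val (s t : L2Section F E q μ) : (s - t).val = s.val - t.val := rfl

@[simp] theorem smul_val (c : ℂ) (s : L2Section F E q μ) : (c • s).val = c • s.val := rfl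

theorem integrable_inner (s t : L2Section F E q μ) :
    Integrable (fun x => inner ℂ (s.val x) (t.val x)) μ := by
  have hm : AEStronglyMeasurable (fun x => inner ℂ (s.val x) (t.val x)) μ := by
    have h : ∀ c : ℂ, Measurable fun x => ((‖s.val x + c • t.val x‖ : ℝ) : ℂ) := fun c =>
      Complex.measurable_ofReal.comp (s.prop.1.add (t.prop.1.const_smul c)).norm
    have h1 := h 1; have h2 := h (-1); have h3 := h Complex.I; have h4 := h (-Complex.I)
    simp only [one_smul, neg_smul, ← sub_eq_add_neg] at h1 h2 h3 h4
    simp only [inner_eq_sum_norm_sq_div_four]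
    refine Measurable.aestronglyMeasurable ?_
    exact (((h1.pow_const 2).sub (h2.pow_const 2)).add
      (((h4.pow_const 2).sub (h3.pow_const 2)).mul_const _)).div_const _
  exact (s.prop.2.integrable_mul t.prop.2).mono' hm
    (Filter.Eventually.of_forall fun x => norm_inner_le_norm _ _)

/-- The inner product `∫ ⟪s x, t x⟫ dμ`. -/
@[reducible] def core : PreInnerProductSpace.Core ℂ (L2Section F E q μ) where
  inner s t := ∫ x, inner ℂ (s.val x) (t.val x) ∂μ
  conj_inner_symm s t := by
    rw [← integral_conj]
    simp only [inner_conj_symm]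
  re_inner_nonneg s := by
    rw [← integral_re (integrable_inner s s)]
    exact integral_nonneg fun x => inner_self_nonneg
  add_left s t u := by
    change ∫ x, inner ℂ (s.val x + t.val x) (u.val x) ∂μ = _
    simp only [inner_add_left]
    exact integral_add (integrable_inner s u) (integrable_inner t u)
  smul_left s t c := by
    change ∫ x, inner ℂ (c • s.val x) (t.val x) ∂μ = _
    simp only [inner_smul_left]
    exact integral_const_mul _ _

instance : SeminormedAddCommGroup (L2Section F E q μ) :=
  @InnerProductSpace.Core.toSeminormedAddCommGroup ℂ _ _ _ _ core

instance : InnerProductSpace ℂ (L2Section F E q μ) := InnerProductSpace.ofCore core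

theorem inner_def (s t : L2Section F E q μ) :
    inner ℂ s t = ∫ x, inner ℂ (s.val x) (t.val x) ∂μ := rfl

theorem norm_sq (s : L2Section F E q μ) : ‖s‖ ^ 2 = ∫ x, ‖s.val x‖ ^ 2 ∂μ := by
  rw [← inner_self_eq_norm_sq (𝕜 := ℂ), inner_def, ← integral_re (integrable_inner s s)]
  simp only [inner_self_eq_norm_sq]

theorem ofReal_norm (s : L2Section F E q μ) :
    ENNReal.ofReal ‖s‖ = eLpNorm (fun x => ‖s.val x‖) 2 μ := by
  rw [s.prop.2.eLpNorm_eq_integral_rpow_norm (by simp) (by simp)]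
  congr 1
  have h : ∀ x, ‖‖s.val x‖‖ ^ (2 : ℝ≥0∞).toReal = ‖s.val x‖ ^ 2 := fun x => by simp
  simp only [h, ← norm_sq]
  rw [ENNReal.toReal_ofNat, ← one_div, ← Real.sqrt_eq_rpow, Real.sqrt_sq (norm_nonneg s)]

theorem norm_le_of_forall_le {s t : L2Section F E q μ} {C : ℝ} (hC : 0 ≤ C)
    (h : ∀ x, ‖s.val x‖ ≤ C * ‖t.val x‖) : ‖s‖ ≤ C * ‖t‖ := by
  refine le_of_sq_le_sq ?_ (by positivity)
  rw [mul_pow, norm_sq, norm_sq, ← integral_const_mul]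
  refine integral_mono s.prop.2.integrable_sq (t.prop.2.integrable_sq.const_mul _) fun x => ?_
  change ‖s.val x‖ ^ 2 ≤ C ^ 2 * ‖t.val x‖ ^ 2
  rw [← mul_pow]
  gcongr
  exact h x

theorem dist_ofReal (s t : L2Section F E q μ) :
    ENNReal.ofReal (dist s t) = eLpNorm (fun x => ‖s.val x - t.val x‖) 2 μ := by
  rw [dist_eq_norm, ofReal_norm]; rfl

/-- The Riesz-Fischer theorem for sections. -/
instance : CompleteSpace (L2Section F E q μ) := by
  classical
  refine Metric.complete_of_convergent_controlled_sequences (fun n => (1 / 2 : ℝ) ^ n)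
    (fun n => by positivity) fun u hu => ?_
  have hfd : ∀ y : N, CompleteSpace (E y) := fun y => by
    have h := (trivializationAt F E y).continuousLinearEquivAt ℂ y
      (FiberBundle.mem_baseSet_trivializationAt' y)
    have : FiniteDimensional ℂ (E y) := h.symm.toLinearEquiv.finiteDimensional
    exact FiniteDimensional.complete ℂ (E y)
  set d : ℕ → X → ℝ := fun k x => ‖(u (k + 1)).val x - (u k).val x‖ with hd
  have hdm : ∀ k, Measurable (d k) := fun k => (u (k + 1) - u k).prop.1.norm
  have hdn : ∀ k, eLpNorm (d k) 2 μ ≤ ENNReal.ofReal ((1 / 2 : ℝ) ^ k) := fun k => by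
    rw [hd]
    simp only
    rw [← dist_ofReal]
    exact ENNReal.ofReal_le_ofReal (hu k (k + 1) k (by omega) le_rfl).le
  set g : ℕ → X → ℝ := fun n x => ∑ k ∈ Finset.range n, d k x with hg
  have hgm : ∀ n, Measurable (g n) := fun n => Finset.measurable_sum _ fun k _ => hdm k
  have hgc : ∀ᵐ x ∂μ, ∃ l : ℝ, Filter.Tendsto (fun n => g n x) Filter.atTop (𝓝 l) := by
    have hmn : ∀ K n m : ℕ, K ≤ m → m ≤ n →
        eLpNorm (g n - g m) 2 μ < ENNReal.ofReal (3 * (1 / 2 : ℝ) ^ K) := by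
      intro K n m hKm hmn
      have e : g n - g m = ∑ k ∈ Finset.Ico m n, d k := by
        ext x
        simp only [hg, Pi.sub_apply, Finset.sum_apply]
        rw [Finset.sum_Ico_eq_sub _ hmn]
      rw [e]
      calc eLpNorm (∑ k ∈ Finset.Ico m n, d k) 2 μ
          ≤ ∑ k ∈ Finset.Ico m n, eLpNorm (d k) 2 μ :=
            eLpNorm_sum_le (fun k _ => (hdm k).aestronglyMeasurable) (by norm_num)
        _ ≤ ∑ k ∈ Finset.Ico m n, ENNReal.ofReal ((1 / 2 : ℝ) ^ k) :=
            Finset.sum_le_sum fun k _ => hdn k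
        _ = ENNReal.ofReal (∑ k ∈ Finset.Ico m n, (1 / 2 : ℝ) ^ k) :=
            (ENNReal.ofReal_sum_of_nonneg fun k _ => by positivity).symm
        _ < ENNReal.ofReal (3 * (1 / 2 : ℝ) ^ K) := by
            refine (ENNReal.ofReal_lt_ofReal_iff (by positivity)).2 ?_
            rw [geom_sum_Ico (by norm_num) hmn]
            have h1 : (1 / 2 : ℝ) ^ m ≤ (1 / 2 : ℝ) ^ K :=
              pow_le_pow_of_le_one (by norm_num) (by norm_num) hKm
            have h2 : 0 < (1 / 2 : ℝ) ^ n := by positivity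
            have h3 : 0 < (1 / 2 : ℝ) ^ m := by positivity
            have h4 : ((1 / 2 : ℝ) ^ n - (1 / 2) ^ m) / (1 / 2 - 1)
              = 2 * ((1 / 2 : ℝ) ^ m - (1 / 2) ^ n) := by ring
            rw [h4]
            linarith
    refine Lp.ae_tendsto_of_cauchy_eLpNorm (p := 2) (fun n => (hgm n).aestronglyMeasurable)
      (by norm_num) (B := fun K => ENNReal.ofReal (3 * (1 / 2 : ℝ) ^ K)) ?_ ?_
    · rw [← ENNReal.ofReal_tsum_of_nonneg (fun K => by positivity)
        ((summable_geometric_of_lt_one (by norm_num) (by norm_num)).mul_left 3)]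
      exact ENNReal.ofReal_ne_top
    · intro K n m hn hm
      rcases le_total m n with h | h
      · exact hmn K n m hm h
      · have : g n - g m = -(g m - g n) := by abel
        rw [this, eLpNorm_neg]
        exact hmn K m n hn h
  set C : Set X := {x | ∃ l : ℝ, Filter.Tendsto (fun n => g n x) Filter.atTop (𝓝 l)} with hC
  have hCm : MeasurableSet C := measurableSet_exists_tendsto fun n => hgm n
  have hlim : ∀ x : X, ∃ l : E (q x), Filter.Tendsto
      (fun n => if x ∈ C then (u n).val x else 0) Filter.atTop (𝓝 l) := by
    intro x
    by_cases hx : x ∈ C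
    · simp only [hx, if_true]
      have := hfd (q x)
      refine cauchySeq_tendsto_of_complete (cauchySeq_of_summable_dist ?_)
      obtain ⟨l, hl⟩ := hx
      refine ((hasSum_iff_tendsto_nat_of_nonneg (fun k => dist_nonneg) l).2 ?_).summable
      convert hl using 2 with n
      refine Finset.sum_congr rfl fun k _ => ?_
      rw [dist_comm, dist_eq_norm]
    · simp only [hx, if_false]
      exact ⟨0, tendsto_const_nhds⟩
  choose s hs using hlim
  have hsm : IsMeasurableSection F E q s := by
    intro b
    set e := trivializationAt F E b
    refine stronglyMeasurable_of_tendsto (u := Filter.atTop)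
      (f := fun n x => e.linearMapAt ℂ (q x) (if x ∈ C then (u n).val x else 0)) ?_ ?_
    · intro n
      have : (fun x => e.linearMapAt ℂ (q x) (if x ∈ C then (u n).val x else 0))
          = C.indicator fun x => e.linearMapAt ℂ (q x) ((u n).val x) := by
        ext x
        by_cases hx : x ∈ C <;> simp [hx]
      rw [this]
      exact ((u n).prop.1 b).indicator hCm
    · refine tendsto_pi_nhds.2 fun x => ?_
      exact ((e.continuousLinearMapAt ℂ (q x)).continuous.tendsto (s x)).comp (hs x)
  have hbound : ∀ n, eLpNorm (fun x => ‖s x - (u n).val x‖) 2 μ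
      ≤ ENNReal.ofReal ((1 / 2 : ℝ) ^ n) := by
    intro n
    refine (Lp.eLpNorm_lim_le_liminf_eLpNorm
      (f := fun m x => ‖(u m).val x - (u n).val x‖)
      (fun m => (u m - u n).prop.1.norm.aestronglyMeasurable) _ ?_).trans ?_
    · filter_upwards [hgc] with x hx
      have hx' : x ∈ C := hx
      have := hs x
      simp only [hx', if_true] at this
      exact (this.sub_const _).norm
    · refine Filter.liminf_le_of_le (by isBoundedDefault) fun c hc => ?_
      obtain ⟨m, hm, hmn⟩ := (hc.and (Filter.eventually_ge_atTop n)).exists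
      refine hm.trans ?_
      rw [← dist_ofReal]
      exact ENNReal.ofReal_le_ofReal (hu n m n hmn le_rfl).le
  have hsn : ∀ n, IsMeasurableSection F E q (s - (u n).val) := fun n => by
    have := hsm.add ((u n).prop.1.const_smul (-1))
    rwa [neg_one_smul, ← sub_eq_add_neg] at this
  have hmem : IsSquareIntegrable F E q μ s := by
    have h0 : IsSquareIntegrable F E q μ (s - (u 0).val) :=
      ⟨hsn 0, (hsn 0).norm.aestronglyMeasurable, (hbound 0).trans_lt ENNReal.ofReal_lt_top⟩
    have := (squareIntegrableSubmodule F E q μ).add_mem h0 (u 0).prop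
    rw [sub_add_cancel] at this
    exact this
  refine ⟨mk s hmem, ?_⟩
  rw [tendsto_iff_dist_tendsto_zero]
  refine squeeze_zero (fun _ => dist_nonneg) (fun n => ?_)
    (tendsto_pow_atTop_nhds_zero_of_lt_one (r := (1 / 2 : ℝ)) (by norm_num) (by norm_num))
  rw [dist_comm, ← ENNReal.ofReal_le_ofReal_iff (by positivity), dist_ofReal]
  exact hbound n

end L2Section

end Sections

section HilbertSpace

variable {N : Type*} [MetricSpace N] {F : Type*} [NormedAddCommGroup F] [NormedSpace ℂ F]
  {E : N → Type*} [∀ x, NormedAddCommGroup (E x)] [∀ x, InnerProductSpace ℂ (E x)]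
  [TopologicalSpace (TotalSpace F E)] [FiberBundle F E] [VectorBundle ℂ F E]

/-- The identification of two fibres of `E` over equal points. -/
def fiberCast {a b : N} (h : a = b) : E a ≃ₗᵢ[ℂ] E b :=
  h ▸ LinearIsometryEquiv.refl ℂ (E a)

theorem fiberCast_trans {a b c : N} (h : a = b) (h' : b = c) (v : E a) :
    fiberCast h' (fiberCast h v) = fiberCast (h.trans h') v := by
  subst h h'; rfl

theorem fiberCast_eq {α : Type*} {f : α → N} (s : ∀ a, E (f a)) {a b : α} (hab : a = b)
    (h : f a = f b) : fiberCast h (s a) = s b := by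
  subst hab; rfl

theorem linearMapAt_fiberCast (e : Trivialization F (π F E)) [e.IsLinear ℂ] {a b : N} (h : a = b)
    (v : E a) : e.linearMapAt ℂ b (fiberCast h v) = e.linearMapAt ℂ a v := by
  subst h; rfl

variable [CompactSpace N] [FiniteDimensional ℂ F] [IsHermitianBundle F E]

section General

variable {X : Type*} [TopologicalSpace X] [MeasurableSpace X] [BorelSpace X]

variable (F E) in
/-- The Hilbert space `L²(q^* E)`: square integrable sections modulo equality almost everywhere (see
`L2.mk_eq_mk_iff`). -/
abbrev L2 (q : C(X, N)) (μ : Measure X) : Type _ := SeparationQuotient (L2Section F E q μ)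

variable {q : C(X, N)} {μ : Measure X}

namespace L2

/-- A square integrable section representing the class `u`. -/
def rep (u : L2 F E q μ) : ∀ x, E (q x) := (Quotient.out u : L2Section F E q μ).val

open Classical in
/-- The class of the section `s` (and `0` if `s` is not square integrable). -/
def ofSection (s : ∀ x, E (q x)) : L2 F E q μ :=
  if h : IsSquareIntegrable F E q μ s then SeparationQuotient.mk (L2Section.mk s h) else 0

/-- Two square integrable sections define the same class iff they agree almost everywhere. -/
theorem mk_eq_mk_iff {s t : L2Section F E q μ} :
    (SeparationQuotient.mk s : L2 F E q μ) = SeparationQuotient.mk t ↔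
      ∀ᵐ x ∂μ, s.val x = t.val x := by
  rw [SeparationQuotient.mk_eq_mk, Metric.inseparable_iff, dist_eq_norm,
    ← sq_eq_zero_iff, L2Section.norm_sq,
    integral_eq_zero_iff_of_nonneg (fun x => by positivity) (s - t).prop.2.integrable_sq]
  refine Filter.eventually_congr (Filter.Eventually.of_forall fun x => ?_)
  simp [sub_eq_zero]

theorem rep_ofSection {s : ∀ x, E (q x)} (hs : IsSquareIntegrable F E q μ s) :
    ∀ᵐ x ∂μ, (ofSection s : L2 F E q μ).rep x = s x := by
  have h : (SeparationQuotient.mk (Quotient.out (ofSection s : L2 F E q μ)) : L2 F E q μ)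
      = SeparationQuotient.mk (L2Section.mk s hs) := by
    rw [show (SeparationQuotient.mk (Quotient.out (ofSection s : L2 F E q μ)) : L2 F E q μ)
      = ofSection s from Quotient.out_eq _, ofSection, dif_pos hs]
  exact mk_eq_mk_iff.1 h

/-- The operator on classes induced by a bounded operator on sections. -/
def lift (A : L2Section F E q μ →L[ℂ] L2Section F E q μ) : L2 F E q μ →L[ℂ] L2 F E q μ :=
  SeparationQuotient.liftCLM ((SeparationQuotient.mkCLM ℂ _).comp A) fun x y h => by
    exact SeparationQuotient.mk_eq_mk.2 (h.map A.continuous)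

@[simp] theorem lift_mk (A : L2Section F E q μ →L[ℂ] L2Section F E q μ) (s : L2Section F E q μ) :
    lift A (SeparationQuotient.mk s) = SeparationQuotient.mk (A s) := rfl

end L2

section Multiplication

/-- Pointwise multiplication of sections by a function vanishing at infinity. -/
def mulSection (f : C₀(X, ℂ)) : L2Section F E q μ →L[ℂ] L2Section F E q μ :=
  LinearMap.mkContinuous
    { toFun := fun s => L2Section.mk (fun x => f x • s.val x)
        (IsSquareIntegrable.mono (s.prop.2.const_mul ‖f‖)
          (s.prop.1.smul f.continuous.stronglyMeasurable) fun x => by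
            rw [norm_smul]
            gcongr
            exact f.toBCF.norm_coe_le_norm x)
      map_add' := fun s t => by ext x; simp
      map_smul' := fun c s => by ext x; simp [smul_comm c] }
    ‖f‖ fun s => L2Section.norm_le_of_forall_le (norm_nonneg f) fun x => by
      change ‖f x • s.val x‖ ≤ _
      rw [norm_smul]
      gcongr
      exact f.toBCF.norm_coe_le_norm x

@[simp] theorem mulSection_val (f : C₀(X, ℂ)) (s : L2Section F E q μ) (x : X) :
    (mulSection f s).val x = f x • s.val x := rfl

variable (F E q μ) in
/-- The representation of `C₀(X)` on `L²` by pointwise multiplication. -/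
def mulRep : C₀(X, ℂ) →⋆ₙₐ[ℂ] (L2 F E q μ →L[ℂ] L2 F E q μ) where
  toFun f := L2.lift (mulSection f)
  map_smul' c f := by
    ext v
    obtain ⟨s, rfl⟩ := SeparationQuotient.surjective_mk v
    refine congrArg SeparationQuotient.mk (L2Section.ext fun x => ?_)
    simp [mul_smul]
  map_zero' := by
    ext v
    obtain ⟨s, rfl⟩ := SeparationQuotient.surjective_mk v
    refine congrArg SeparationQuotient.mk (L2Section.ext fun x => ?_)
    simp
  map_add' f g := by
    ext v
    obtain ⟨s, rfl⟩ := SeparationQuotient.surjective_mk v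
    refine congrArg SeparationQuotient.mk (L2Section.ext fun x => ?_)
    simp [add_smul]
  map_mul' f g := by
    ext v
    obtain ⟨s, rfl⟩ := SeparationQuotient.surjective_mk v
    refine congrArg SeparationQuotient.mk (L2Section.ext fun x => ?_)
    simp [mul_smul]
  map_star' f := by
    rw [ContinuousLinearMap.star_eq_adjoint, ContinuousLinearMap.eq_adjoint_iff]
    intro v w
    obtain ⟨s, rfl⟩ := SeparationQuotient.surjective_mk v
    obtain ⟨t, rfl⟩ := SeparationQuotient.surjective_mk w
    simp only [L2.lift_mk, SeparationQuotient.inner_mk_mk, L2Section.inner_def, mulSection_val,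
      inner_smul_left, inner_smul_right, ZeroAtInftyContinuousMap.star_apply]
    simp

end Multiplication

section Action

variable {G : Type*} [Group G] [MulAction G X] [MeasurableConstSMul G X] [SMulInvariantMeasure G X μ]

/-- The action `(g · s)(x) = g (s (g⁻¹ x))` on sections of the pulled back bundle. -/
def actSection (hq : ∀ (g : G) (x : X), q (g • x) = q x) (g : G) :
    L2Section F E q μ →ₗᵢ[ℂ] L2Section F E q μ where
  toFun s := L2Section.mk (fun x => fiberCast (hq g⁻¹ x) (s.val (g⁻¹ • x))) (by
    refine ⟨fun b => ?_, ?_⟩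
    · simp only [linearMapAt_fiberCast]
      exact (s.prop.1 b).comp_measurable (measurable_const_smul g⁻¹)
    · simp only [LinearIsometryEquiv.norm_map]
      exact s.prop.2.comp_measurePreserving (measurePreserving_smul g⁻¹ μ))
  map_add' s t := by ext x; simp; rfl
  map_smul' c s := by ext x; simp; rfl
  norm_map' s := by
    have h : ∀ r : L2Section F E q μ, ‖r‖ = (eLpNorm (fun x => ‖r.val x‖) 2 μ).toReal := fun r => by
      rw [← L2Section.ofReal_norm, ENNReal.toReal_ofReal (norm_nonneg _)]
    rw [h, h]
    change (eLpNorm (fun x => ‖fiberCast (hq g⁻¹ x) (s.val (g⁻¹ • x))‖) 2 μ).toReal = _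
    simp only [LinearIsometryEquiv.norm_map]
    exact congrArg ENNReal.toReal (eLpNorm_comp_measurePreserving (g := fun x => ‖s.val x‖)
      s.prop.2.aestronglyMeasurable (measurePreserving_smul g⁻¹ μ))

theorem actSection_val (hq : ∀ (g : G) (x : X), q (g • x) = q x) (g : G)
    (s : L2Section F E q μ) (x : X) :
    (actSection hq g s).val x = fiberCast (hq g⁻¹ x) (s.val (g⁻¹ • x)) := rfl

theorem actSection_one (hq : ∀ (g : G) (x : X), q (g • x) = q x) (s : L2Section F E q μ) :
    actSection hq 1 s = s := by
  ext x
  rw [actSection_val]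
  exact fiberCast_eq s.val (by simp) _

theorem actSection_mul (hq : ∀ (g : G) (x : X), q (g • x) = q x) (g h : G)
    (s : L2Section F E q μ) : actSection hq (g * h) s = actSection hq g (actSection hq h s) := by
  ext x
  simp only [actSection_val, fiberCast_trans]
  have e : (g * h)⁻¹ • x = h⁻¹ • g⁻¹ • x := by rw [mul_inv_rev, mul_smul]
  have := fiberCast_eq (f := q) s.val e (by rw [e])
  rw [← this, fiberCast_trans]

variable (F E μ) in
/-- The unitary representation of `G` on `L²` induced by the action on sections. -/
def unitaryRep (hq : ∀ (g : G) (x : X), q (g • x) = q x) : G →* (L2 F E q μ ≃ₗᵢ[ℂ] L2 F E q μ) where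
  toFun g :=
    { toFun := L2.lift (actSection hq g).toContinuousLinearMap
      invFun := L2.lift (actSection hq g⁻¹).toContinuousLinearMap
      map_add' := map_add _
      map_smul' := map_smul _
      left_inv := fun v => by
        obtain ⟨s, rfl⟩ := SeparationQuotient.surjective_mk v
        refine congrArg SeparationQuotient.mk ?_
        change actSection hq g⁻¹ (actSection hq g s) = s
        rw [← actSection_mul, inv_mul_cancel, actSection_one]
      right_inv := fun v => by
        obtain ⟨s, rfl⟩ := SeparationQuotient.surjective_mk v
        refine congrArg SeparationQuotient.mk ?_
        change actSection hq g (actSection hq g⁻¹ s) = s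
        rw [← actSection_mul, mul_inv_cancel, actSection_one]
      norm_map' := fun v => by
        obtain ⟨s, rfl⟩ := SeparationQuotient.surjective_mk v
        exact (actSection hq g).norm_map s }
  map_one' := by
    ext v
    obtain ⟨s, rfl⟩ := SeparationQuotient.surjective_mk v
    exact congrArg SeparationQuotient.mk (actSection_one hq s)
  map_mul' g h := by
    ext v
    obtain ⟨s, rfl⟩ := SeparationQuotient.surjective_mk v
    exact congrArg SeparationQuotient.mk (actSection_mul hq g h s)

theorem unitaryRep_mk (hq : ∀ (g : G) (x : X), q (g • x) = q x) (g : G)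
    (s : L2Section F E q μ) :
    unitaryRep F E μ hq g (SeparationQuotient.mk s) = SeparationQuotient.mk (actSection hq g s) :=
  rfl

theorem unitaryRep_symm_mk (hq : ∀ (g : G) (x : X), q (g • x) = q x) (g : G)
    (s : L2Section F E q μ) :
    (unitaryRep F E μ hq g).symm (SeparationQuotient.mk s)
      = SeparationQuotient.mk (actSection hq g⁻¹ s) :=
  rfl

end Action

end General

section Module

variable {X : Type*} [MetricSpace X] [LocallyCompactSpace X] [SecondCountableTopology X]
  [MeasurableSpace X] [BorelSpace X] {q : C(X, N)} {μ : Measure X}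

theorem mem_closure_mulRep (v : L2 F E q μ) :
    v ∈ closure {w : L2 F E q μ | ∃ f, w = mulRep F E q μ f v} := by
  obtain ⟨s, rfl⟩ := SeparationQuotient.surjective_mk v
  let K : CompactExhaustion X := default
  choose e he1 _ _ he2 using fun n => exists_bump (K.isCompact n) isOpen_univ (Set.subset_univ _)
  refine mem_closure_of_tendsto (f := fun n => mulRep F E q μ (e n) (SeparationQuotient.mk s))
    (b := Filter.atTop) ?_ (Filter.Eventually.of_forall fun n => ⟨e n, rfl⟩)
  change Filter.Tendsto (fun n => (SeparationQuotient.mk (mulSection (e n) s) : L2 F E q μ)) _ _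
  refine (SeparationQuotient.continuous_mk.tendsto s).comp ?_
  rw [tendsto_iff_norm_sub_tendsto_zero]
  have hsq : Filter.Tendsto (fun n => ‖mulSection (e n) s - s‖ ^ 2) Filter.atTop (𝓝 0) := by
    simp only [L2Section.norm_sq]
    rw [← integral_zero X ℝ (μ := μ)]
    refine tendsto_integral_of_dominated_convergence (fun x => 4 * ‖s.val x‖ ^ 2)
      (fun n => ((mulSection (e n) s - s).prop.2.integrable_sq).aestronglyMeasurable)
      (s.prop.2.integrable_sq.const_mul 4) (fun n => Filter.Eventually.of_forall fun x => ?_)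
      (Filter.Eventually.of_forall fun x => ?_)
    · have h1 : ‖(mulSection (e n) s - s).val x‖ ≤ 2 * ‖s.val x‖ := by
        change ‖e n x • s.val x - s.val x‖ ≤ _
        have h2 : ‖e n x • s.val x‖ ≤ ‖s.val x‖ := by
          rw [norm_smul]
          exact mul_le_of_le_one_left (norm_nonneg _) (he2 n x)
        linarith [norm_sub_le (e n x • s.val x) (s.val x)]
      rw [Real.norm_of_nonneg (by positivity)]
      calc ‖(mulSection (e n) s - s).val x‖ ^ 2 ≤ (2 * ‖s.val x‖) ^ 2 := by gcongr
        _ = 4 * ‖s.val x‖ ^ 2 := by ring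
    · obtain ⟨m, hm⟩ := K.exists_mem x
      refine tendsto_const_nhds.congr' ?_
      filter_upwards [Filter.eventually_ge_atTop m] with n hn
      have : e n x = 1 := he1 n x (K.subset hn hm)
      change 0 = ‖e n x • s.val x - s.val x‖ ^ 2
      simp [this]
  have := hsq.sqrt
  simpa [Real.sqrt_sq (norm_nonneg _)] using this

variable {G : Type*} [Group G] [MulAction G X] [MeasurableConstSMul G X] [SMulInvariantMeasure G X μ]

variable (F E μ) in
/-- The Hilbert space `L²(q^* E)` with pointwise multiplication by functions and the natural action
of `G` on sections. -/
def l2Module (hq : ∀ (g : G) (x : X), q (g • x) = q x) : EquivariantModule X G (L2 F E q μ) where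
  rep := mulRep F E q μ
  nondegenerate v := closure_mono (by
    rintro w ⟨f, rfl⟩
    exact Submodule.subset_span ⟨f, v, rfl⟩) (mem_closure_mulRep v)
  unitary := unitaryRep F E μ hq
  covariant g f f' hf v := by
    obtain ⟨s, rfl⟩ := SeparationQuotient.surjective_mk v
    rw [unitaryRep_symm_mk]
    change unitaryRep F E μ hq g (SeparationQuotient.mk (mulSection f (actSection hq g⁻¹ s)))
      = SeparationQuotient.mk (mulSection f' s)
    rw [unitaryRep_mk]
    refine congrArg SeparationQuotient.mk (L2Section.ext fun x => ?_)
    rw [actSection_val, mulSection_val, mulSection_val, map_smul, actSection_val, fiberCast_trans,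
      hf x]
    congr 1
    exact fiberCast_eq s.val (by simp) _

end Module

end HilbertSpace

section Geometry

/-- The Riemannian volume measure of an `n`-dimensional Riemannian manifold, as the `n`-dimensional
Hausdorff measure of the Riemannian distance, normalised to be Lebesgue measure on `ℝⁿ`. -/
abbrev riemannianVolume (n : ℕ) (M : Type*) [EMetricSpace M] [MeasurableSpace M] [BorelSpace M] :
    Measure M :=
  Measure.euclideanHausdorffMeasure n

instance {n : ℕ} {G M : Type*} [EMetricSpace M] [MeasurableSpace M] [BorelSpace M] [Group G]
    [MulAction G M] [IsIsometricSMul G M] : SMulInvariantMeasure G M (riemannianVolume n M) where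
  measure_preimage_smul c s _ := by
    rw [riemannianVolume, Measure.euclideanHausdorffMeasure_def, Measure.smul_apply, Measure.smul_apply]
    congr 1
    exact (IsometryEquiv.constSMul c).hausdorffMeasure_preimage _ _

/-- `p : M → N` is a Riemannian Galois covering with deck transformation group `Γ`: it is the
covering given by quotienting by the properly discontinuous action of `Γ`, it is smooth, and the
Riemannian metric of `M` is the lift of the one of `N`. -/
structure IsRiemannianGaloisCover (n : ℕ) (Γ : Type*) {M N : Type*} [Group Γ]
    [MetricSpace M] [ChartedSpace (EuclideanSpace ℝ (Fin n)) M] [MulAction Γ M]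
    [RiemannianBundle fun x : M => TangentSpace (𝓡 n) x]
    [MetricSpace N] [ChartedSpace (EuclideanSpace ℝ (Fin n)) N]
    [RiemannianBundle fun x : N => TangentSpace (𝓡 n) x] (p : C(M, N)) : Prop where
  isQuotientCoveringMap : IsQuotientCoveringMap p Γ
  contMDiff : ContMDiff (𝓡 n) (𝓡 n) ∞ p
  norm_mfderiv : ∀ (x : M) (v : TangentSpace (𝓡 n) x), ‖mfderiv (𝓡 n) (𝓡 n) p x v‖ = ‖v‖

theorem IsRiemannianGaloisCover.map_smul {n : ℕ} {Γ M N : Type*} [Group Γ]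
    [MetricSpace M] [ChartedSpace (EuclideanSpace ℝ (Fin n)) M] [MulAction Γ M]
    [RiemannianBundle fun x : M => TangentSpace (𝓡 n) x]
    [MetricSpace N] [ChartedSpace (EuclideanSpace ℝ (Fin n)) N]
    [RiemannianBundle fun x : N => TangentSpace (𝓡 n) x] {p : C(M, N)}
    (hp : IsRiemannianGaloisCover n Γ p) (g : Γ) (x : M) : p (g • x) = p x :=
  hp.isQuotientCoveringMap.apply_eq_iff_mem_orbit.2 ⟨g, rfl⟩

/-- `pr : M₁ → M₂` is the projection between two covers of `N` that exhibits `M₂` as `M₁ / H`,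
where `H` is the kernel of the surjection `quot : Γ₁ → Γ₂` of deck transformation groups. -/
structure IsCoverProjection {Γ₁ Γ₂ M₁ M₂ N : Type*} [Group Γ₁] [Group Γ₂] [TopologicalSpace M₁]
    [TopologicalSpace M₂] [TopologicalSpace N] [MulAction Γ₁ M₁] [MulAction Γ₂ M₂]
    (quot : Γ₁ →* Γ₂) (p₁ : C(M₁, N)) (p₂ : C(M₂, N)) (pr : C(M₁, M₂)) : Prop where
  surjective : Function.Surjective quot
  map_proj : ∀ y, p₂ (pr y) = p₁ y
  map_smul : ∀ (g : Γ₁) (y : M₁), pr (g • y) = quot g • pr y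

/-- The choices entering the definition of the folding map: a finite open cover `U i` of `N`, a
partition of unity subordinate to it, lifts of the `U i` to `M₁`, and a set of representatives for
the classes of `Γ₁` modulo the kernel of `quot`. -/
structure FoldingData (ι : Type*) {Γ₁ Γ₂ M₁ N : Type*} [Group Γ₁] [Group Γ₂] [TopologicalSpace M₁]
    [TopologicalSpace N] (quot : Γ₁ →* Γ₂) (p₁ : C(M₁, N)) where
  finite : Finite ι
  U : ι → Set N
  isOpen_U : ∀ i, IsOpen (U i)
  φ : PartitionOfUnity ι N Set.univ
  isSubordinate : φ.IsSubordinate U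
  /-- The lift `Uᵢᵉ ⊆ M₁` of `Uᵢ`. -/
  Ue : ι → Set M₁
  isOpen_Ue : ∀ i, IsOpen (Ue i)
  bijOn_Ue : ∀ i, Set.BijOn p₁ (Ue i) (U i)
  S : Set Γ₁
  bijOn_S : Set.BijOn quot S Set.univ

/-- The function `φᵢᵍ` on `M₁`: the `g`-translate of the lift of `φᵢ` to `Uᵢᵉ`. -/
def FoldingData.bump {ι Γ₁ Γ₂ M₁ N : Type*} [Group Γ₁] [Group Γ₂] [TopologicalSpace M₁]
    [TopologicalSpace N] [MulAction Γ₁ M₁] {quot : Γ₁ →* Γ₂} {p₁ : C(M₁, N)}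
    (D : FoldingData ι quot p₁) (i : ι) (g : Γ₁) : M₁ → ℝ :=
  Set.indicator {y | g⁻¹ • y ∈ D.Ue i} fun y => D.φ i (p₁ y)

variable {N : Type*} [MetricSpace N] [CompactSpace N]
  {F : Type*} [NormedAddCommGroup F] [NormedSpace ℂ F] [FiniteDimensional ℂ F]
  {E : N → Type*} [∀ x, NormedAddCommGroup (E x)] [∀ x, InnerProductSpace ℂ (E x)]
  [TopologicalSpace (TotalSpace F E)] [FiberBundle F E] [VectorBundle ℂ F E]
  [IsHermitianBundle F E]

section Algebras

variable (n : ℕ) {Γ M : Type*} [Group Γ] [MetricSpace M]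
  [ChartedSpace (EuclideanSpace ℝ (Fin n)) M] [SecondCountableTopology M]
  [MeasurableSpace M] [BorelSpace M] [MulAction Γ M] [IsIsometricSMul Γ M]
  (F E) {p : C(M, N)}

/-- The `M`-`Γ`-module `L²(p^* E)`. -/
def bundleModule (hp : ∀ (g : Γ) (x : M), p (g • x) = p x) :
    EquivariantModule M Γ (L2 F E p (riemannianVolume n M)) :=
  haveI : LocallyCompactSpace M := ChartedSpace.locallyCompactSpace (EuclideanSpace ℝ (Fin n)) M
  l2Module F E (riemannianVolume n M) hp

/-- The `*`-algebra of bounded `Γ`-equivariant operators with finite propagation on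
`L²(p^* E)`. -/
def fpAlgebra (hp : ∀ (g : Γ) (x : M), p (g • x) = p x) :
    StarSubalgebra ℂ (L2 F E p (riemannianVolume n M) →L[ℂ] L2 F E p (riemannianVolume n M)) :=
  haveI : LocallyCompactSpace M := ChartedSpace.locallyCompactSpace (EuclideanSpace ℝ (Fin n)) M
  (bundleModule F E n hp).finitePropagationAlgebra

/-- The equivariant algebraic Roe algebra of `M` for the module `L²(p^* E)`. -/
def algebraicRoeAlgebra (hp : ∀ (g : Γ) (x : M), p (g • x) = p x) :
    NonUnitalStarSubalgebra ℂ
      (L2 F E p (riemannianVolume n M) →L[ℂ] L2 F E p (riemannianVolume n M)) :=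
  haveI : LocallyCompactSpace M := ChartedSpace.locallyCompactSpace (EuclideanSpace ℝ (Fin n)) M
  (bundleModule F E n hp).roeAlgebra

variable {n F E} in
theorem mem_fpAlgebra {hp : ∀ (g : Γ) (x : M), p (g • x) = p x}
    {T : L2 F E p (riemannianVolume n M) →L[ℂ] L2 F E p (riemannianVolume n M)} :
    T ∈ fpAlgebra F E n hp ↔
      (bundleModule F E n hp).IsEquivariant T ∧ (bundleModule F E n hp).propagation T < ⊤ :=
  Iff.rfl

variable {n F E} in
theorem mem_algebraicRoeAlgebra {hp : ∀ (g : Γ) (x : M), p (g • x) = p x}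
    {T : L2 F E p (riemannianVolume n M) →L[ℂ] L2 F E p (riemannianVolume n M)} :
    T ∈ algebraicRoeAlgebra F E n hp ↔
      (bundleModule F E n hp).IsEquivariant T ∧ (bundleModule F E n hp).IsLocallyCompact T ∧
        (bundleModule F E n hp).propagation T < ⊤ :=
  Iff.rfl

variable {n F E} in
theorem algebraicRoeAlgebra_le {hp : ∀ (g : Γ) (x : M), p (g • x) = p x}
    (T : algebraicRoeAlgebra F E n hp) : T.1 ∈ fpAlgebra F E n hp :=
  ⟨T.2.1, T.2.2.2⟩

end Algebras

section Folding

variable {ι Γ₁ Γ₂ M₁ M₂ : Type*} [Group Γ₁] [Group Γ₂]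
  [MetricSpace M₁] [MeasurableSpace M₁] [BorelSpace M₁] [MulAction Γ₁ M₁]
  [MetricSpace M₂] [MeasurableSpace M₂] [BorelSpace M₂] [MulAction Γ₂ M₂]
  {quot : Γ₁ →* Γ₂} {p₁ : C(M₁, N)} {p₂ : C(M₂, N)} {pr : C(M₁, M₂)}
  {μ₁ : Measure M₁} {μ₂ : Measure M₂}

namespace FoldingData

variable (D : FoldingData ι quot p₁) (hpr : IsCoverProjection quot p₁ p₂ pr)

/-- The section `φⱼᵍ u` of `E₁`, for a section `u` of `E₂`: cut `u` off to `pr(Uⱼᵍ)` and lift it to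
`Uⱼᵍ`. -/
def pull (j : ι) (g : Γ₁) (u : L2 F E p₂ μ₂) : L2 F E p₁ μ₁ :=
  L2.ofSection fun y => (D.bump j g y : ℂ) • fiberCast (hpr.map_proj y) (u.rep (pr y))

/-- The section `pr_*(φᵢᵍ v)` of `E₂`, for a section `v` of `E₁`. As `φᵢᵍ` is supported in `Uᵢᵍ`, on
which `pr` is injective, at most one term of the sum over the fibre is nonzero. -/
def push (i : ι) (g : Γ₁) (v : L2 F E p₁ μ₁) : L2 F E p₂ μ₂ :=
  L2.ofSection fun x => ∑ᶠ y : {y : M₁ // pr y = x},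
    (D.bump i g y : ℂ) • fiberCast (((hpr.map_proj y).symm.trans (congrArg p₂ y.2))) (v.rep y)

/-- The terms `pr_*(φᵢᵍ T (φⱼˢ u))` of the sum defining the folding `Ψ(T) u`. -/
def foldTerm (T : L2 F E p₁ μ₁ →L[ℂ] L2 F E p₁ μ₁) (u : L2 F E p₂ μ₂) :
    Γ₁ × D.S × ι × ι → L2 F E p₂ μ₂ :=
  fun ⟨g, s, i, j⟩ => D.push hpr i g (T (D.pull hpr j s u))

/-- The terms `φⱼᵍˢ T₂ (pr_*(φᵢᵍ v))` of the sum defining the preimage of `T₂`. -/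
def preimageTerm (T₂ : L2 F E p₂ μ₂ →L[ℂ] L2 F E p₂ μ₂) (v : L2 F E p₁ μ₁) :
    Γ₁ × D.S × ι × ι → L2 F E p₁ μ₁ :=
  fun ⟨g, s, i, j⟩ => D.pull hpr j (g * s) (T₂ (D.push hpr i g v))

end FoldingData

end Folding

end Geometry

end Folding

end

noncomputable section

/-! The folding map is the descent of operators along fibrewise summation. Let `H` be the kernel of
`quot`, and call core the space of vectors that only finitely many cut-offs φᵢᵍ fail to kill. On the
core the pushforward π_* w = ∑ φᵢ^{[g]} w is a finite sum. Lifting a local pushforward back to `M₁`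
produces all its `H`-translates, which gives the identity ⟪π_* a, π_* b⟫ = ∑ ⟪a, h b⟫, summed over h
in `H` (`FoldingSystem.hasSum_inner_push`). Moreover π_* has dense range (`dense_range_push`).

An equivariant operator T of finite propagation preserves the core and commutes with `H`, so the
identity passes from T to its adjoint. It follows that the sum defining Ψ(T) satisfies Ψ(T) π_* w =
π_* T w (`apply_push_of_hasSum_foldTerm`). By density this determines Ψ(T), and linearity,
multiplicativity, compatibility with adjoints and equivariance can all be read off from it. In the
other direction, lifting with the partition of unity along one full set of coset representatives and
then pushing down is the identity. Hence the operator T₁ built from T₂ satisfies π_* T₁ w = T₂ π_* w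
(`push_of_hasSum_unfoldTerm`), that is, Ψ(T₁) = T₂, and surjectivity follows.

Convergence is an almost orthogonality argument. Finite propagation sorts the nonzero terms into
finitely many classes according to their relative position in the group. Within a class both the
ranges and the initial spaces of the terms are pairwise orthogonal, so every finite partial sum has
norm at most that of the operator (`norm_sum_orthogonal_le`). On a dense set of vectors only
finitely many terms are nonzero (`exists_hasSum_of_bounded`). The same bookkeeping bounds the
propagation of the sums. It also shows that, after multiplication by a compactly supported function,
only finitely many terms remain, each of them compact if the given operator is locally compact.

Geometry enters in three places. The coverings are local isometries, so the projection preserves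
volume wherever it is injective. The covers are proper, because they carry cocompact isometric
actions. The actions are properly discontinuous, which turns bounded distance into finiteness in the
groups. All operator theory is done in an abstract `FoldingSystem`, which the bundle data are then
shown to form. -/

namespace Folding

open scoped InnerProductSpace Pointwise

section

/-! ### Metric-preserving local diffeomorphisms are local isometries -/

section LocalIsometry

variable {n : ℕ} {M N : Type*}
  [MetricSpace M] [ChartedSpace (EuclideanSpace ℝ (Fin n)) M] [IsManifold (𝓡 n) ∞ M]
  [MetricSpace N] [ChartedSpace (EuclideanSpace ℝ (Fin n)) N] [IsManifold (𝓡 n) ∞ N]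

/-- A smooth map between manifolds of the same dimension with injective differential at `x` has a
differentiable local section through `x`. -/
theorem exists_contMDiffAt_section {p : M → N} (hp : ContMDiff (𝓡 n) (𝓡 n) ∞ p) (x : M)
    (hinj : Function.Injective (mfderiv (𝓡 n) (𝓡 n) p x)) :
    ∃ σ : N → M, σ (p x) = x ∧ ContMDiffAt (𝓡 n) (𝓡 n) 1 σ (p x) ∧
      ∀ᶠ z in 𝓝 (p x), p (σ z) = z := by
  set e := extChartAt (𝓡 n) x with he
  set e' := extChartAt (𝓡 n) (p x) with he'
  set f : EuclideanSpace ℝ (Fin n) → EuclideanSpace ℝ (Fin n) := e' ∘ p ∘ e.symm with hf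
  have hfd : ContDiffAt ℝ ∞ f (e x) := by
    have := (contMDiffAt_iff.1 (hp.contMDiffAt (x := x))).2
    rwa [ModelWithCorners.range_eq_univ, contDiffWithinAt_univ] at this
  have hder : mfderiv (𝓡 n) (𝓡 n) p x = fderiv ℝ f (e x) := by
    have h := (hp.mdifferentiableAt (by simp) : MDifferentiableAt (𝓡 n) (𝓡 n) p x).mfderiv
    rw [ModelWithCorners.range_eq_univ, fderivWithin_univ] at h
    exact h
  have hinj' : Function.Injective (fderiv ℝ f (e x)) := by
    intro u v huv
    have : mfderiv (𝓡 n) (𝓡 n) p x u = mfderiv (𝓡 n) (𝓡 n) p x v := by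
      rw [hder]; exact huv
    exact hinj this
  -- In equal finite dimensions an injective derivative is invertible, so the inverse function
  -- theorem applies to the chart expression `f`. The section is its local inverse read back through
  -- the charts.
  let L : EuclideanSpace ℝ (Fin n) ≃L[ℝ] EuclideanSpace ℝ (Fin n) :=
    (LinearEquiv.ofInjectiveEndo (fderiv ℝ f (e x) : EuclideanSpace ℝ (Fin n) →ₗ[ℝ] _)
      hinj').toContinuousLinearEquiv
  have hL : HasFDerivAt f (L : EuclideanSpace ℝ (Fin n) →L[ℝ] EuclideanSpace ℝ (Fin n)) (e x) := by
    have h1 := (hfd.differentiableAt (by simp)).hasFDerivAt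
    have : (L : EuclideanSpace ℝ (Fin n) →L[ℝ] EuclideanSpace ℝ (Fin n)) = fderiv ℝ f (e x) := by
      ext v; rfl
    rwa [this]
  have hn0 : (∞ : WithTop ℕ∞) ≠ 0 := by simp
  set g := hfd.localInverse hL hn0 with hg
  have hfx : f (e x) = e' (p x) := by
    simp [hf, he, he']
  have hgd : ContDiffAt ℝ ∞ g (e' (p x)) := by
    rw [← hfx]; exact hfd.to_localInverse hL hn0
  have hgx : g (e' (p x)) = e x := by
    rw [← hfx]; exact hfd.localInverse_apply_image hL hn0
  have hfg : ∀ᶠ w in 𝓝 (e' (p x)), f (g w) = w := by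
    rw [← hfx]
    exact (hfd.hasStrictFDerivAt' hL hn0).eventually_right_inverse
  have hse : ContinuousAt e.symm (e x) := continuousAt_extChartAt_symm x
  have hσc : ContMDiffAt (𝓡 n) (𝓡 n) 1 (e.symm ∘ g ∘ e') (p x) := by
    have h1 : ContMDiffAt (𝓡 n) 𝓘(ℝ, EuclideanSpace ℝ (Fin n)) 1 e' (p x) :=
      (contMDiffAt_extChartAt (n := 1))
    have h2 : ContMDiffAt 𝓘(ℝ, EuclideanSpace ℝ (Fin n)) 𝓘(ℝ, EuclideanSpace ℝ (Fin n)) 1 g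
        (e' (p x)) := (hgd.of_le (by simp)).contMDiffAt
    have h3 : ContMDiffAt 𝓘(ℝ, EuclideanSpace ℝ (Fin n)) (𝓡 n) 1 e.symm (g (e' (p x))) := by
      rw [hgx]
      exact (contMDiffOn_extChartAt_symm (n := 1) x).contMDiffAt
        (extChartAt_target_mem_nhds x)
    exact ContMDiffAt.comp (p x) h3 (ContMDiffAt.comp (p x) h2 h1)
  refine ⟨e.symm ∘ g ∘ e', ?_, hσc, ?_⟩
  · simp [hgx, he]
  · have hval : (e.symm ∘ g ∘ e') (p x) = x := by simp [hgx, he]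
    have c1 : ContinuousAt e' (p x) := continuousAt_extChartAt (p x)
    have h1 : ∀ᶠ z in 𝓝 (p x), f (g (e' z)) = e' z := c1.eventually hfg
    have h2 : ∀ᶠ z in 𝓝 (p x), z ∈ e'.source := extChartAt_source_mem_nhds (p x)
    -- The chart `e'` is injective only on its source, so the point `p (σ z)` must be known to lie
    -- there before `e'` can be cancelled.
    have h3 : ∀ᶠ z in 𝓝 (p x), p ((e.symm ∘ g ∘ e') z) ∈ e'.source := by
      have c2 : ContinuousAt (fun z => p ((e.symm ∘ g ∘ e') z)) (p x) :=
        hp.continuous.continuousAt.comp hσc.continuousAt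
      have h4 : e'.source ∈ 𝓝 (p ((e.symm ∘ g ∘ e') (p x))) := by
        rw [hval]
        exact extChartAt_source_mem_nhds (p x)
      exact c2.eventually h4
    filter_upwards [h1, h2, h3] with z hz1 hz2 hz3
    exact e'.injOn hz3 hz2 hz1

variable [RiemannianBundle fun x : M => TangentSpace (𝓡 n) x]
  [RiemannianBundle fun x : N => TangentSpace (𝓡 n) x]

theorem pathELength_comp_le {p : M → N} {U : Set M} (hU : IsOpen U)
    (hp : ContMDiffOn (𝓡 n) (𝓡 n) 1 p U)
    (hn : ∀ x ∈ U, ∀ v : TangentSpace (𝓡 n) x, ‖mfderiv (𝓡 n) (𝓡 n) p x v‖ = ‖v‖)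
    {γ : ℝ → M} (hγ : ContMDiff 𝓘(ℝ, ℝ) (𝓡 n) 1 γ) {a b : ℝ} (hγU : ∀ t ∈ Set.Icc a b, γ t ∈ U) :
    Manifold.pathELength (𝓡 n) (p ∘ γ) a b = Manifold.pathELength (𝓡 n) γ a b := by
  rw [Manifold.pathELength_eq_lintegral_mfderiv_Icc, Manifold.pathELength_eq_lintegral_mfderiv_Icc]
  refine setLIntegral_congr_fun measurableSet_Icc fun t ht => ?_
  have h := hγU t ht
  change ‖mfderiv 𝓘(ℝ, ℝ) (𝓡 n) (p ∘ γ) t 1‖ₑ = ‖mfderiv 𝓘(ℝ, ℝ) (𝓡 n) γ t 1‖ₑ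
  rw [mfderiv_comp t ((hp.contMDiffAt (hU.mem_nhds h)).mdifferentiableAt one_ne_zero)
    (hγ.mdifferentiableAt one_ne_zero), ContinuousLinearMap.comp_apply, ← ofReal_norm,
    ← ofReal_norm, hn _ h]

variable [IsRiemannianManifold (𝓡 n) M] [IsRiemannianManifold (𝓡 n) N]

/-- A metric-preserving map contracts the distance of points whose distance is short enough for
almost minimal paths between them to remain in its domain. -/
theorem edist_le_of_norm_mfderiv {p : M → N} {U : Set M} (hU : IsOpen U)
    (hp : ContMDiffOn (𝓡 n) (𝓡 n) 1 p U)
    (hn : ∀ x ∈ U, ∀ v : TangentSpace (𝓡 n) x, ‖mfderiv (𝓡 n) (𝓡 n) p x v‖ = ‖v‖)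
    {a b : M} {R : ℝ≥0∞} (hab : edist a b < R) (hR : Metric.eball a R ⊆ U) :
    edist (p a) (p b) ≤ edist a b := by
  refine le_of_forall_gt_imp_ge_of_dense fun r hr => ?_
  -- Each point of a path from `a` of length less than `r` lies within `r` of `a`; with `r ≤ R` the
  -- path therefore cannot leave `U`.
  wlog hrR : r ≤ R generalizing r
  · exact (this (min r R) (lt_min hr hab) (min_le_right _ _)).trans (min_le_left _ _)
  rw [IsRiemannianManifold.out (I := 𝓡 n) a b] at hr
  obtain ⟨γ, h0, h1, hγ, hlen, -, -⟩ :=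
    Manifold.exists_lt_locally_constant_of_riemannianEDist_lt hr zero_lt_one
  have hmem : ∀ t ∈ Set.Icc (0 : ℝ) 1, γ t ∈ U := fun t ht => by
    refine hR ?_
    rw [Metric.mem_eball, edist_comm, IsRiemannianManifold.out (I := 𝓡 n)]
    refine lt_of_lt_of_le ?_ hrR
    refine ((Manifold.riemannianEDist_le_pathELength hγ.contMDiffOn h0 rfl ht.1).trans
      (Manifold.pathELength_mono le_rfl ht.2)).trans_lt hlen
  rw [IsRiemannianManifold.out (I := 𝓡 n) (p a)]
  refine (Manifold.riemannianEDist_le_pathELength (γ := p ∘ γ) (a := 0) (b := 1)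
    (hp.comp hγ.contMDiffOn hmem) (by simp [h0]) (by simp [h1]) zero_le_one).trans ?_
  rw [pathELength_comp_le hU hp hn hγ hmem]
  exact hlen.le

/-- A smooth, locally injective map preserving the Riemannian metrics is locally isometric. -/
theorem exists_nhds_edist_eq {p : M → N} (hp : ContMDiff (𝓡 n) (𝓡 n) ∞ p)
    (hn : ∀ (x : M) (v : TangentSpace (𝓡 n) x), ‖mfderiv (𝓡 n) (𝓡 n) p x v‖ = ‖v‖)
    (hinj : ∀ x, ∃ U ∈ 𝓝 x, Set.InjOn p U) (x : M) :
    ∃ V ∈ 𝓝 x, ∀ a ∈ V, ∀ b ∈ V, edist (p a) (p b) = edist a b := by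
  have hpc := hp.continuous
  -- Contraction holds globally. The reverse inequality near `x` comes from a local section σ: its
  -- differential inverts that of `p`, hence preserves norms, and σ contracts as well.
  have hle : ∀ a b : M, edist (p a) (p b) ≤ edist a b := fun a b =>
    edist_le_of_norm_mfderiv isOpen_univ (hp.of_le (by simp)).contMDiffOn (fun x _ => hn x)
      (edist_lt_top a b) (Set.subset_univ _)
  obtain ⟨σ, hσx, hσ, hpσ⟩ := exists_contMDiffAt_section hp x (by
    rw [injective_iff_map_eq_zero]
    intro v hv
    rw [← norm_eq_zero, ← hn x v, hv, norm_zero])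
  obtain ⟨U, hU, hUinj⟩ := hinj x
  have h1 := (contMDiffAt_iff_contMDiffAt_nhds (by simp)).1 hσ
  obtain ⟨R, hR, hball⟩ := EMetric.mem_nhds_iff.1 (hpσ.eventually_nhds.and h1)
  have hballU : ∀ z ∈ Metric.eball (p x) R, (∀ᶠ w in 𝓝 z, p (σ w) = w) ∧
    ContMDiffAt (𝓡 n) (𝓡 n) 1 σ z := fun z hz => hball hz
  have hσn : ∀ z ∈ Metric.eball (p x) R, ∀ v : TangentSpace (𝓡 n) z,
      ‖mfderiv (𝓡 n) (𝓡 n) σ z v‖ = ‖v‖ := by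
    intro z hz v
    obtain ⟨hz1, hz2⟩ := hballU z hz
    have h3 : mfderiv (𝓡 n) (𝓡 n) (p ∘ σ) z = mfderiv (𝓡 n) (𝓡 n) id z :=
      Filter.EventuallyEq.mfderiv_eq hz1
    rw [mfderiv_comp z (hp.mdifferentiableAt (by simp)) (hz2.mdifferentiableAt one_ne_zero)] at h3
    have hpz : p (σ z) = z := hz1.self_of_nhds
    have h4 : ‖mfderiv (𝓡 n) (𝓡 n) p (σ z) (mfderiv (𝓡 n) (𝓡 n) σ z v)‖ = ‖v‖ := by
      have h5 : (mfderiv (𝓡 n) (𝓡 n) p (σ z) (mfderiv (𝓡 n) (𝓡 n) σ z v) :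
          EuclideanSpace ℝ (Fin n)) = v := by
        rw [mfderiv_id] at h3
        exact congrArg (fun L : EuclideanSpace ℝ (Fin n) →L[ℝ] EuclideanSpace ℝ (Fin n) => L v) h3
      -- The equality `p (σ z) = z` is not definitional, so vectors in the two tangent spaces are
      -- compared through their common model space.
      have h6 : ∀ (w : N) (_ : w = z) (u : EuclideanSpace ℝ (Fin n)),
          ‖(show TangentSpace (𝓡 n) w from u)‖ = ‖(show TangentSpace (𝓡 n) z from u)‖ := by
        rintro w rfl u; rfl
      exact (h6 _ hpz _).trans (congrArg (fun u : EuclideanSpace ℝ (Fin n) =>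
        ‖(show TangentSpace (𝓡 n) z from u)‖) h5)
    rw [← hn, h4]
  have hσx' : ContinuousAt (fun y => σ (p y)) x :=
    ContinuousAt.comp (f := p) hσ.continuousAt hpc.continuousAt
  have e1 : ∀ᶠ y in 𝓝 x, σ (p y) = y := by
    have h3 : ∀ᶠ y in 𝓝 x, σ (p y) ∈ U := hσx'.eventually (show U ∈ 𝓝 (σ (p x)) by rwa [hσx])
    filter_upwards [h3, hU, hpc.continuousAt.eventually hpσ] with y hy1 hy2 hy3
    exact hUinj hy1 hy2 hy3
  -- Why thirds: two points of this ball are less than `2R/3` apart, and the ball of radius `2R/3`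
  -- about either one still lies in the ball of radius `R` where σ is controlled.
  have e2 : ∀ᶠ y in 𝓝 x, p y ∈ Metric.eball (p x) (R / 3) :=
    hpc.continuousAt.eventually (Metric.eball_mem_nhds _ (ENNReal.div_pos hR.ne' (by simp)))
  refine ⟨_, e1.and e2, ?_⟩
  rintro a ⟨ha, ha'⟩ b ⟨hb, hb'⟩
  refine le_antisymm (hle a b) ?_
  have key : edist (σ (p a)) (σ (p b)) ≤ edist (p a) (p b) := by
    refine edist_le_of_norm_mfderiv (R := R / 3 + R / 3) Metric.isOpen_eball (fun z hz => (hballU z hz).2.contMDiffWithinAt) hσn ?_ ?_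
    · rw [Metric.mem_eball] at ha' hb'
      rw [edist_comm] at hb'
      exact (edist_triangle _ (p x) _).trans_lt (ENNReal.add_lt_add ha' hb')
    · intro z hz
      rw [Metric.mem_eball] at hz ha' ⊢
      refine (edist_triangle _ (p a) _).trans_lt ?_
      calc _ < R / 3 + R / 3 + R / 3 := ENNReal.add_lt_add hz ha'
        _ = R := ENNReal.add_thirds R
  rwa [ha, hb] at key

end LocalIsometry

end

section

/-! ### Cocompact Riemannian manifolds are proper -/

section Proper

/-- In a Riemannian manifold, a point at distance less than `r + δ` from `x`, with `0 ≤ r`, is at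
distance less than `δ` from some point of the closed ball of radius `r` about `x`. -/
theorem exists_mem_closedBall_dist_lt {n : ℕ} {M : Type*} [MetricSpace M]
    [ChartedSpace (EuclideanSpace ℝ (Fin n)) M]
    [RiemannianBundle fun x : M => TangentSpace (𝓡 n) x] [IsRiemannianManifold (𝓡 n) M]
    {x y : M} {r δ : ℝ} (hr : 0 ≤ r) (hδ : 0 < δ) (hxy : dist x y < r + δ) :
    ∃ z ∈ Metric.closedBall x r, dist z y < δ := by
  rcases le_or_gt (dist x y) r with h | h
  · exact ⟨y, by rwa [Metric.mem_closedBall, dist_comm], by simpa using hδ⟩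
  have h1 : edist x y < ENNReal.ofReal (r + δ) := by
    rw [edist_dist]
    exact (ENNReal.ofReal_lt_ofReal_iff (by linarith)).2 hxy
  rw [IsRiemannianManifold.out (I := 𝓡 n) x y] at h1
  obtain ⟨γ, h0, hγ1, hγ, hlen, -, -⟩ :=
    Manifold.exists_lt_locally_constant_of_riemannianEDist_lt h1 zero_lt_one
  have hc : ContinuousOn (fun t => dist x (γ t)) (Set.Icc 0 1) :=
    (continuous_const.dist hγ.continuous).continuousOn
  -- The path is cut where its distance to `x` equals `r`. The initial piece has length at least
  -- `r`, which leaves less than `δ` for the rest.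
  obtain ⟨t, ht, htr⟩ := intermediate_value_Icc zero_le_one hc
    (show r ∈ Set.Icc (dist x (γ 0)) (dist x (γ 1)) by simp [h0, hγ1, hr, h.le])
  simp only at htr
  refine ⟨γ t, by rw [Metric.mem_closedBall, dist_comm, htr], ?_⟩
  have e1 : edist x (γ t) ≤ Manifold.pathELength (𝓡 n) γ 0 t := by
    rw [IsRiemannianManifold.out (I := 𝓡 n) x]
    exact Manifold.riemannianEDist_le_pathELength hγ.contMDiffOn h0 rfl ht.1
  have e2 : edist (γ t) y ≤ Manifold.pathELength (𝓡 n) γ t 1 := by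
    rw [IsRiemannianManifold.out (I := 𝓡 n) (γ t)]
    exact Manifold.riemannianEDist_le_pathELength hγ.contMDiffOn rfl hγ1 ht.2
  have e3 : edist x (γ t) + edist (γ t) y < ENNReal.ofReal (r + δ) := by
    refine (add_le_add e1 e2).trans_lt ?_
    rwa [Manifold.pathELength_add ht.1 ht.2]
  rw [edist_dist, edist_dist, htr, ← ENNReal.ofReal_add hr dist_nonneg,
    ENNReal.ofReal_lt_ofReal_iff (by linarith)] at e3
  linarith

/-- A Riemannian manifold with a cocompact isometric group action is proper. -/
theorem properSpace_of_cocompact {n : ℕ} {G M : Type*} [MetricSpace M]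
    [ChartedSpace (EuclideanSpace ℝ (Fin n)) M]
    [RiemannianBundle fun x : M => TangentSpace (𝓡 n) x] [IsRiemannianManifold (𝓡 n) M]
    [Group G] [MulAction G M] [IsIsometricSMul G M] {K : Set M} (hK : IsCompact K)
    (hGK : ∀ x : M, ∃ g : G, g • x ∈ K) : ProperSpace M := by
  have : LocallyCompactSpace M := ChartedSpace.locallyCompactSpace (EuclideanSpace ℝ (Fin n)) M
  obtain ⟨L, hL, hKL⟩ := exists_compact_superset hK
  obtain ⟨ε, hε, hεL⟩ := hK.exists_cthickening_subset_open isOpen_interior hKL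
  -- Cocompactness gives one radius that works for all centres: translate the centre into `K`, whose
  -- closed `ε`-thickening lies in the compact set `L`.
  have hball : ∀ x : M, IsCompact (Metric.closedBall x ε) := by
    intro x
    obtain ⟨g, hg⟩ := hGK x
    have h1 : IsCompact (Metric.closedBall (g • x) ε) :=
      hL.of_isClosed_subset Metric.isClosed_closedBall
        (((Metric.closedBall_subset_cthickening hg ε).trans hεL).trans interior_subset)
    have h2 : Metric.closedBall x ε = (fun y => g⁻¹ • y) '' Metric.closedBall (g • x) ε := by
      have := (IsometryEquiv.constSMul (X := M) g⁻¹).image_closedBall (g • x) ε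
      rw [IsometryEquiv.constSMul_apply, inv_smul_smul] at this
      exact this.symm
    rw [h2]
    exact h1.image (isometry_smul M g⁻¹).continuous
  -- Radii grow by `ε/3`. A point of the next ball is within `2ε/3` of the current one, which is
  -- covered by finitely many balls of radius `ε/3`; so finitely many compact `ε`-balls cover the
  -- next ball.
  have hstep : ∀ (x : M) (k : ℕ), IsCompact (Metric.closedBall x (k * (ε / 3))) := by
    intro x k
    induction k with
    | zero => simp
    | succ k ih =>
      obtain ⟨t, htK, hcov⟩ := ih.elim_nhds_subcover (fun z => Metric.ball z (ε / 3))
        fun z _ => Metric.ball_mem_nhds z (by positivity)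
      refine (t.isCompact_biUnion fun z _ => hball z).of_isClosed_subset
        Metric.isClosed_closedBall fun y hy => ?_
      rw [Metric.mem_closedBall, dist_comm] at hy
      obtain ⟨w, hw, hwy⟩ := exists_mem_closedBall_dist_lt (n := n) (x := x) (y := y)
        (r := k * (ε / 3)) (δ := 2 * (ε / 3)) (by positivity) (by positivity)
        (by push_cast at hy; linarith)
      obtain ⟨z, hz, hzw⟩ := Set.mem_iUnion₂.1 (hcov hw)
      refine Set.mem_iUnion₂.2 ⟨z, hz, ?_⟩
      rw [Metric.mem_ball] at hzw
      rw [Metric.mem_closedBall, dist_comm]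
      rw [dist_comm] at hzw
      linarith [dist_triangle z w y]
  refine ⟨fun x r => ?_⟩
  obtain ⟨k, hk⟩ := exists_nat_gt (r / (ε / 3))
  rw [div_lt_iff₀ (by positivity)] at hk
  exact (hstep x k).of_isClosed_subset Metric.isClosed_closedBall
    (Metric.closedBall_subset_closedBall hk.le)

end Proper

/-! ### Proper discontinuity of deck groups -/

section Discontinuous

variable {G X Y : Type*} [Group G] [TopologicalSpace X] [MulAction G X] [TopologicalSpace Y]
  [T2Space Y]

/-- The action defining a Galois covering of a Hausdorff space is properly discontinuous. -/
theorem finite_smul_inter_nonempty {p : X → Y} (hp : IsQuotientCoveringMap p G) {K L : Set X}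
    (hK : IsCompact K) (hL : IsCompact L) :
    {g : G | ∃ x ∈ K, g • x ∈ L}.Finite := by
  -- Locally near a pair `(x, y)`: if `y = k • x`, the neighbourhood `U × kU` admits only `g = k`;
  -- if the points have different images, separating these in `Y` admits no `g`. Compactness of `K ×
  -- L` then gives finiteness.
  have key : ∀ z : X × X, ∃ W ∈ 𝓝 z, {g : G | ∃ x, (x, g • x) ∈ W}.Finite := by
    rintro ⟨x, y⟩
    by_cases hxy : p y = p x
    · obtain ⟨k, rfl⟩ := hp.apply_eq_iff_mem_orbit.1 hxy
      obtain ⟨U, hU, hUd⟩ := hp.disjoint x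
      have hc := hp.continuous_const_smul k⁻¹
      refine ⟨U ×ˢ ((fun y => k⁻¹ • y) ⁻¹' U), prod_mem_nhds hU
        (hc.continuousAt.preimage_mem_nhds (by simpa using hU)), ?_⟩
      refine (Set.finite_singleton k).subset ?_
      rintro g ⟨z, hz1, hz2⟩
      have := hUd (k⁻¹ * g) ⟨k⁻¹ • g • z, ⟨z, hz1, by simp [mul_smul]⟩, hz2⟩
      exact (inv_mul_eq_one.1 this).symm
    · obtain ⟨U, V, hU, hV, hyU, hxV, hUV⟩ := t2_separation hxy
      refine ⟨(p ⁻¹' V) ×ˢ (p ⁻¹' U), prod_mem_nhds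
        ((hV.preimage hp.continuous).mem_nhds hxV) ((hU.preimage hp.continuous).mem_nhds hyU), ?_⟩
      refine Set.finite_empty.subset ?_
      rintro g ⟨z, hz1, hz2⟩
      rw [Set.mem_preimage, hp.map_smul] at hz2
      exact Set.disjoint_left.1 hUV hz2 hz1
  choose W hW hWf using key
  obtain ⟨t, -, hcov⟩ := (hK.prod hL).elim_nhds_subcover W fun z _ => hW z
  refine (t.finite_toSet.biUnion fun z _ => hWf z).subset ?_
  rintro g ⟨x, hx, hgx⟩
  obtain ⟨z, hz, hzW⟩ := Set.mem_iUnion₂.1 (hcov (Set.mk_mem_prod hx hgx))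
  exact Set.mem_iUnion₂.2 ⟨z, hz, x, hzW⟩

/-- In a proper space the closed thickening of `L` is again compact, which reduces the claim to
proper discontinuity. -/
theorem finite_dist_smul_le {X : Type*} [MetricSpace X] [ProperSpace X] [MulAction G X] {p : X → Y}
    (hp : IsQuotientCoveringMap p G) {K L : Set X} (hK : IsCompact K) (hL : IsCompact L) (R : ℝ) :
    {g : G | ∃ x ∈ K, ∃ y ∈ L, dist (g • x) y ≤ R}.Finite := by
  refine (finite_smul_inter_nonempty hp hK (hL.cthickening (r := R))).subset ?_
  rintro g ⟨x, hx, y, hy, h⟩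
  exact ⟨x, hx, Metric.mem_cthickening_of_dist_le _ _ _ _ hy h⟩

end Discontinuous

/-! ### Local isometries preserve the volume -/

section Measure

variable {X Y : Type*} [MetricSpace X] [MeasurableSpace X] [BorelSpace X]
  [MetricSpace Y] [MeasurableSpace Y] [BorelSpace Y]

/-- The inclusion of `V` and the restriction of `f` are both isometric embeddings of the metric
space `V`, so both sides are its own Hausdorff measure with the same normalisation. -/
theorem riemannianVolume_image (n : ℕ) {f : X → Y} {V : Set X}
    (hf : ∀ a ∈ V, ∀ b ∈ V, edist (f a) (f b) = edist a b) :
    riemannianVolume n Y (f '' V) = riemannianVolume n X V := by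
  have h1 : Isometry (fun a : V => f a) := fun a b => hf a a.2 b b.2
  have e1 := h1.hausdorffMeasure_image (d := n) (Or.inl (by positivity)) Set.univ
  have e2 := (isometry_subtype_coe (s := V)).hausdorffMeasure_image (d := n)
    (Or.inl (by positivity)) Set.univ
  rw [Set.image_univ, Subtype.range_coe] at e2
  have e3 : (fun a : V => f a) '' Set.univ = f '' V := by
    rw [Set.image_univ, Set.image_eq_range]
  rw [e3] at e1
  simp only [riemannianVolume, Measure.euclideanHausdorffMeasure_def, Measure.smul_apply]
  rw [e1, e2]

/-- A locally isometric map preserves the Riemannian volume on open sets where it is injective. -/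
theorem measurePreserving_of_locally_isometric (n : ℕ) [SecondCountableTopology X] {f : X → Y}
    (hfc : Continuous f) (hfo : IsOpenMap f)
    (hf : ∀ x : X, ∃ V ∈ 𝓝 x, ∀ a ∈ V, ∀ b ∈ V, edist (f a) (f b) = edist a b) {U : Set X}
    (hU : IsOpen U) (hinj : Set.InjOn f U) :
    MeasurePreserving f ((riemannianVolume n X).restrict U)
      ((riemannianVolume n Y).restrict (f '' U)) := by
  refine ⟨hfc.measurable, ?_⟩
  have hf' : ∀ x : X, ∃ V, IsOpen V ∧ x ∈ V ∧ ∀ a ∈ V, ∀ b ∈ V, edist (f a) (f b) = edist a b := by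
    intro x
    obtain ⟨V, hV, h⟩ := hf x
    obtain ⟨W, hWV, hW, hxW⟩ := mem_nhds_iff.1 hV
    exact ⟨W, hW, hxW, fun a ha b hb => h a (hWV ha) b (hWV hb)⟩
  choose V hVo hxV hV using hf'
  obtain ⟨s, hs, hcov⟩ := TopologicalSpace.countable_cover_nhds fun x => (hVo x).mem_nhds (hxV x)
  rcases s.eq_empty_or_nonempty with rfl | hne
  · have : IsEmpty X := by
      rw [← Set.univ_eq_empty_iff, ← hcov]; simp
    have hU0 : U = ∅ := Set.eq_empty_of_isEmpty U
    subst hU0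
    simp
  obtain ⟨x, rfl⟩ := hs.exists_eq_range hne
  -- By second countability, `U` splits into countably many disjoint Borel pieces on each of which
  -- `f` is isometric.
  let W : ℕ → Set X := fun k => U ∩ V (x k)
  have hWo : ∀ k, IsOpen (W k) := fun k => hU.inter (hVo _)
  let D : ℕ → Set X := disjointed W
  have hDd : Pairwise (Function.onFun Disjoint D) := disjoint_disjointed W
  have hDU : ⋃ k, D k = U := by
    rw [iUnion_disjointed, ← Set.inter_iUnion]
    rw [Set.biUnion_range] at hcov
    rw [hcov, Set.inter_univ]
  have hDm : ∀ k, MeasurableSet (D k) := MeasurableSet.disjointed fun k => (hWo k).measurableSet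
  have hDsub : ∀ k, D k ⊆ W k := disjointed_subset W
  -- Images of Borel sets are not automatically Borel. Here each piece is a difference of open sets,
  -- and the injective open map `f` carries it to a difference of open sets.
  have hfDm : ∀ k, MeasurableSet (f '' D k) := by
    intro k
    have : D k = W k \ ⋃ j ∈ Finset.Iio k, W j := by
      simp [D, disjointed_apply, Finset.sup_eq_iSup]
    rw [this, (hinj.mono Set.inter_subset_left).image_sdiff]
    exact (hfo _ (hWo k)).measurableSet.diff
      (hfo _ ((hWo k).inter (isOpen_biUnion fun j _ => hWo j))).measurableSet
  ext A hA
  rw [Measure.map_apply hfc.measurable hA, Measure.restrict_apply (hfc.measurable hA),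
    Measure.restrict_apply hA]
  have e1 : f ⁻¹' A ∩ U = ⋃ k, f ⁻¹' A ∩ D k := by rw [← Set.inter_iUnion, hDU]
  have e2 : A ∩ f '' U = ⋃ k, A ∩ f '' D k := by
    rw [← Set.inter_iUnion, ← Set.image_iUnion, hDU]
  rw [e1, e2, measure_iUnion, measure_iUnion]
  · refine tsum_congr fun k => ?_
    rw [← Set.image_preimage_inter, riemannianVolume_image n fun a ha b hb =>
      hV (x k) a (hDsub k ha.2).2 b (hDsub k hb.2).2]
  · intro j k hjk
    have hd := hDd hjk
    refine Set.disjoint_left.2 ?_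
    rintro _ ⟨_, a, ha, rfl⟩ ⟨_, b, hb, hab⟩
    have : b = a := hinj (hDsub k hb).1 (hDsub j ha).1 hab
    subst this
    exact Set.disjoint_left.1 hd ha hb
  · exact fun k => hA.inter (hfDm k)
  · intro j k hjk
    exact (hDd hjk).mono Set.inter_subset_right Set.inter_subset_right
  · exact fun k => (hfc.measurable hA).inter (hDm k)

end Measure

end

section

/-! ### Strongly convergent sums of almost orthogonal operators -/

section OperatorSums

variable {H H' H'' H''' : Type*} [NormedAddCommGroup H] [InnerProductSpace ℂ H]
  [NormedAddCommGroup H'] [InnerProductSpace ℂ H']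
  [NormedAddCommGroup H''] [InnerProductSpace ℂ H''] [NormedAddCommGroup H''']
  [InnerProductSpace ℂ H''']

theorem norm_sum_sq_of_orthogonal {κ : Type*} (F : Finset κ) (x : κ → H)
    (hx : ∀ k ∈ F, ∀ l ∈ F, k ≠ l → ⟪x k, x l⟫_ℂ = 0) :
    ‖∑ k ∈ F, x k‖ ^ 2 = ∑ k ∈ F, ‖x k‖ ^ 2 := by
  classical
  induction F using Finset.induction_on with
  | empty => simp
  | insert a F ha ih =>
    rw [Finset.sum_insert ha, Finset.sum_insert ha,
      ← ih fun k hk l hl => hx k (Finset.mem_insert_of_mem hk) l (Finset.mem_insert_of_mem hl)]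
    have h0 : ⟪x a, ∑ k ∈ F, x k⟫_ℂ = 0 := by
      rw [inner_sum]
      refine Finset.sum_eq_zero fun l hl => hx a (Finset.mem_insert_self _ _) l
        (Finset.mem_insert_of_mem hl) ?_
      rintro rfl
      exact ha hl
    have := norm_add_sq_eq_norm_sq_add_norm_sq_of_inner_eq_zero _ _ h0
    simpa only [sq] using this

variable [CompleteSpace H] [CompleteSpace H'] [CompleteSpace H''] [CompleteSpace H''']

/-- A Bessel inequality for contractions with pairwise orthogonal ranges. -/
theorem sum_norm_adjoint_sq_le {κ : Type*} (F : Finset κ) (Z : κ → H →L[ℂ] H')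
    (hZ : ∀ k ∈ F, ∀ l ∈ F, k ≠ l → ∀ v w, ⟪Z k v, Z l w⟫_ℂ = 0)
    (hZ1 : ∀ k ∈ F, ∀ v, ‖Z k v‖ ≤ ‖v‖) (u : H') :
    ∑ k ∈ F, ‖(Z k).adjoint u‖ ^ 2 ≤ ‖u‖ ^ 2 := by
  set a := ∑ k ∈ F, ‖(Z k).adjoint u‖ ^ 2 with ha
  -- Testing `u` against `y` gives `a = ⟪u, y⟫ ≤ ‖u‖ ‖y‖`, while orthogonality gives `‖y‖² ≤ a`;
  -- hence `a² ≤ ‖u‖² a`.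
  set y := ∑ k ∈ F, Z k ((Z k).adjoint u) with hy
  have h1 : ‖y‖ ^ 2 ≤ a := by
    rw [hy, norm_sum_sq_of_orthogonal F _ fun k hk l hl hkl => hZ k hk l hl hkl _ _]
    refine Finset.sum_le_sum fun k hk => ?_
    gcongr
    exact hZ1 k hk _
  have h2 : (a : ℂ) = ⟪u, y⟫_ℂ := by
    rw [hy, inner_sum, ha, Complex.ofReal_sum]
    refine Finset.sum_congr rfl fun k _ => ?_
    rw [← ContinuousLinearMap.adjoint_inner_left, inner_self_eq_norm_sq_to_K]
    simp
  have ha0 : 0 ≤ a := Finset.sum_nonneg fun k _ => by positivity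
  have h3 : a ≤ ‖u‖ * ‖y‖ := by
    have := norm_inner_le_norm (𝕜 := ℂ) u y
    rwa [← h2, Complex.norm_real, Real.norm_of_nonneg ha0] at this
  have h4 : a ^ 2 ≤ ‖u‖ ^ 2 * a := by
    calc a ^ 2 ≤ (‖u‖ * ‖y‖) ^ 2 := by gcongr
      _ = ‖u‖ ^ 2 * ‖y‖ ^ 2 := by ring
      _ ≤ ‖u‖ ^ 2 * a := by gcongr
  rcases ha0.eq_or_lt with h | h
  · rw [← h]; positivity
  · rw [sq] at h4
    exact le_of_mul_le_mul_right h4 h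

/-- Pythagoras for the ranges of the `X k` on the left and Bessel for the `Z k` on the right: the
sum is block diagonal, so its norm is bounded by that of `T`, however many terms there are. This is
the source of all uniform bounds below. -/
theorem norm_sum_orthogonal_le {κ : Type*} (F : Finset κ) (X : κ → H →L[ℂ] H')
    (T : H'' →L[ℂ] H) (Z : κ → H'' →L[ℂ] H''')
    (hX : ∀ k ∈ F, ∀ l ∈ F, k ≠ l → ∀ v w, ⟪X k v, X l w⟫_ℂ = 0)
    (hX1 : ∀ k ∈ F, ∀ v, ‖X k v‖ ≤ ‖v‖)
    (hZ : ∀ k ∈ F, ∀ l ∈ F, k ≠ l → ∀ v w, ⟪Z k v, Z l w⟫_ℂ = 0)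
    (hZ1 : ∀ k ∈ F, ∀ v, ‖Z k v‖ ≤ ‖v‖) (u : H''') :
    ‖∑ k ∈ F, X k (T ((Z k).adjoint u))‖ ≤ ‖T‖ * ‖u‖ := by
  refine le_of_sq_le_sq ?_ (by positivity)
  rw [norm_sum_sq_of_orthogonal F _ fun k hk l hl hkl => hX k hk l hl hkl _ _]
  calc ∑ k ∈ F, ‖X k (T ((Z k).adjoint u))‖ ^ 2
      ≤ ∑ k ∈ F, ‖T‖ ^ 2 * ‖(Z k).adjoint u‖ ^ 2 := by
        refine Finset.sum_le_sum fun k hk => ?_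
        rw [← mul_pow]
        gcongr
        exact (hX1 k hk _).trans (T.le_opNorm _)
    _ ≤ ‖T‖ ^ 2 * ‖u‖ ^ 2 := by
        rw [← Finset.mul_sum]
        gcongr
        exact sum_norm_adjoint_sq_le F Z hZ hZ1 u
    _ = (‖T‖ * ‖u‖) ^ 2 := by ring

/-- A family of operators sums to an operator in the strong topology if it splits into finitely many
classes with uniformly bounded finite partial sums, and all but finitely many members vanish on any
given vector of a dense set. -/
theorem exists_hasSum_of_bounded {κ γ : Type*} (A : κ → H →L[ℂ] H') (χ : κ → γ) {c : Set γ}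
    (hc : c.Finite) (hχ : ∀ k v, A k v ≠ 0 → χ k ∈ c) {C : ℝ}
    (hC : ∀ b ∈ c, ∀ F : Finset κ, (∀ k ∈ F, χ k = b) → ∀ v, ‖∑ k ∈ F, A k v‖ ≤ C * ‖v‖)
    {D : Set H} (hD : Dense D) (hfin : ∀ v ∈ D, {k | A k v ≠ 0}.Finite) :
    ∃ B : H →L[ℂ] H', ∀ v, HasSum (fun k => A k v) (B v) := by
  classical
  rcases c.eq_empty_or_nonempty with rfl | ⟨b₀, hb₀⟩
  · refine ⟨0, fun v => ?_⟩
    have : (fun k => A k v) = fun _ => 0 := by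
      ext k
      by_contra h
      exact hχ k v h
    rw [this]
    exact hasSum_zero
  -- One bound for each class. The maximum with `0` is taken because no sign is assumed for `C`.
  set C' : ℝ := hc.toFinset.card * max C 0 with hC'
  have hC'0 : 0 ≤ C' := by positivity
  have hbound : ∀ (F : Finset κ) v, ‖∑ k ∈ F, A k v‖ ≤ C' * ‖v‖ := by
    intro F v
    have h1 : ∑ k ∈ F, A k v = ∑ b ∈ hc.toFinset, ∑ k ∈ F with χ k = b, A k v := by
      rw [← Finset.sum_filter_add_sum_filter_not F (fun k => χ k ∈ c)]
      rw [Finset.sum_eq_zero (s := F.filter fun k => χ k ∉ c), add_zero]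
      · rw [← Finset.sum_fiberwise_of_maps_to (t := hc.toFinset) (g := χ)]
        · refine Finset.sum_congr rfl fun b hb => Finset.sum_congr ?_ fun _ _ => rfl
          ext k
          simp only [Finset.mem_filter]
          constructor
          · rintro ⟨⟨h1, h2⟩, h3⟩; exact ⟨h1, h3⟩
          · rintro ⟨h1, h3⟩; exact ⟨⟨h1, by rw [h3]; simpa using hb⟩, h3⟩
        · intro k hk
          simpa using (Finset.mem_filter.1 hk).2
      · intro k hk
        by_contra h
        exact (Finset.mem_filter.1 hk).2 (hχ k v h)
    rw [h1]
    refine (norm_sum_le _ _).trans ?_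
    calc ∑ b ∈ hc.toFinset, ‖∑ k ∈ F with χ k = b, A k v‖
        ≤ ∑ b ∈ hc.toFinset, max C 0 * ‖v‖ := by
          refine Finset.sum_le_sum fun b hb => ?_
          refine (hC b (by simpa using hb) _ (fun k hk => (Finset.mem_filter.1 hk).2) v).trans ?_
          gcongr
          exact le_max_left _ _
      _ = C' * ‖v‖ := by rw [Finset.sum_const, nsmul_eq_mul, hC', mul_assoc]
  have hsum : ∀ v, Summable fun k => A k v := by
    intro v
    rw [summable_iff_vanishing_norm]
    intro ε hε
    -- Outside the finite set of indices that see `d`, a partial sum at `v` equals the one at `v -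
    -- d`, which is small by the uniform bound. Adding `1` to `C'` avoids division by zero.
    obtain ⟨d, hd, hvd⟩ := Metric.mem_closure_iff.1 (hD v) (ε / (C' + 1)) (by positivity)
    refine ⟨(hfin d hd).toFinset, fun t ht => ?_⟩
    have h1 : ∑ k ∈ t, A k v = ∑ k ∈ t, A k (v - d) := by
      refine Finset.sum_congr rfl fun k hk => ?_
      have h2 : A k d = 0 := by
        by_contra h
        exact Finset.disjoint_left.1 ht hk (by simpa using h)
      rw [map_sub, h2, sub_zero]
    rw [h1]
    rw [dist_eq_norm, lt_div_iff₀ (by positivity)] at hvd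
    refine (hbound t _).trans_lt ?_
    have := norm_nonneg (v - d)
    nlinarith
  let L : H →ₗ[ℂ] H' :=
    { toFun := fun v => ∑' k, A k v
      map_add' := fun v w => by
        simp only [map_add]
        exact (hsum v).tsum_add (hsum w)
      map_smul' := fun a v => by
        simp only [map_smul, RingHom.id_apply]
        exact (hsum v).tsum_const_smul a }
  refine ⟨L.mkContinuous C' fun v => ?_, fun v => (hsum v).hasSum⟩
  exact le_of_tendsto (hsum v).hasSum.norm (Filter.Eventually.of_forall fun F => hbound F v)

/-- If all but finitely many terms of a strongly convergent sum of operators are killed by `R` and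
the images of the others under `R` are compact, so is the image of the sum. -/
theorem isCompactOperator_comp_of_hasSum {κ : Type*} {A : κ → H →L[ℂ] H'} {B : H →L[ℂ] H'}
    (hB : ∀ v, HasSum (fun k => A k v) (B v)) (R : H' →L[ℂ] H'') (Q : H''' →L[ℂ] H)
    {s : Set κ} (hs : s.Finite) (hR : ∀ k ∉ s, ∀ v, R (A k (Q v)) = 0)
    (hc : ∀ k, IsCompactOperator (A k)) : IsCompactOperator (R ∘L B ∘L Q) := by
  have h : R ∘L B ∘L Q = ∑ k ∈ hs.toFinset, R ∘L A k ∘L Q := by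
    ext v
    have h1 := (hB (Q v)).mapL R
    have h2 : HasSum (fun k => R (A k (Q v))) (∑ k ∈ hs.toFinset, R (A k (Q v))) :=
      hasSum_sum_of_ne_finset_zero fun k hk => hR k (by simpa using hk) v
    rw [sum_apply]
    exact h1.unique h2
  rw [h]
  refine Submodule.sum_mem (compactOperator (RingHom.id ℂ) H''' H'') fun k _ => ?_
  exact ((hc k).comp_clm Q).clm_comp R

end OperatorSums

end

/-! ### Abstract folding systems: orthogonality and relative positions -/

section

/-- The operator-theoretic data of a folding map: the cut-offs `M i g` to the sets `Uᵢᵍ`, and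
the operators `P i g` that cut off to `Uᵢᵍ` and push down to the quotient. -/
structure FoldingSystem (ι : Type*) {Γ₁ Γ₂ : Type*} [Group Γ₁] [Group Γ₂] (quot : Γ₁ →* Γ₂)
    (H₁ H₂ : Type*) [NormedAddCommGroup H₁] [InnerProductSpace ℂ H₁] [CompleteSpace H₁]
    [NormedAddCommGroup H₂] [InnerProductSpace ℂ H₂] [CompleteSpace H₂] where
  U₁ : Γ₁ →* (H₁ ≃ₗᵢ[ℂ] H₁)
  U₂ : Γ₂ →* (H₂ ≃ₗᵢ[ℂ] H₂)
  M : ι → Γ₁ → H₁ →L[ℂ] H₁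
  P : ι → Γ₁ → H₁ →L[ℂ] H₂
  M_inner : ∀ i g v w, ⟪M i g v, w⟫_ℂ = ⟪v, M i g w⟫_ℂ
  M_norm : ∀ i g v, ‖M i g v‖ ≤ ‖v‖
  U_M : ∀ h i g v, U₁ h (M i g v) = M i (h * g) (U₁ h v)
  M_disj : ∀ i g g', g ≠ g' → ∀ v, M i g (M i g' v) = 0
  M_fin : ∀ i j, {g | ∃ v, M i 1 (M j g v) ≠ 0}.Finite
  U_P : ∀ h i g v, U₂ (quot h) (P i g v) = P i (h * g) (U₁ h v)
  -- Pushing down and lifting back produces the translates under the kernel. The interplay of the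
  -- two Hilbert spaces rests on this axiom.
  adjoint_P_P : ∀ i g j k v,
    HasSum (fun h : quot.ker => M i g (U₁ h (M j k v))) ((P i g).adjoint (P j k v))
  hasSum_M : ∀ v, {p : ι × Γ₁ | M p.1 p.2 v ≠ 0}.Finite → HasSum (fun p : ι × Γ₁ => M p.1 p.2 v) v
  dense_core : Dense {v | {p : ι × Γ₁ | M p.1 p.2 v ≠ 0}.Finite}
  -- This expresses that the images of the sets `Uᵢᵍ` cover the quotient.
  eq_zero : ∀ u, (∀ i g, (P i g).adjoint u = 0) → u = 0

namespace FoldingSystem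

variable {ι Γ₁ Γ₂ : Type*} [Group Γ₁] [Group Γ₂] {quot : Γ₁ →* Γ₂} {H₁ H₂ : Type*}
  [NormedAddCommGroup H₁] [InnerProductSpace ℂ H₁] [CompleteSpace H₁] [NormedAddCommGroup H₂]
  [InnerProductSpace ℂ H₂] [CompleteSpace H₂] (A : FoldingSystem ι quot H₁ H₂)

/-- The adjoint of `P i g`: lift to `Uᵢᵍ` and cut off. -/
abbrev Q (i : ι) (g : Γ₁) : H₂ →L[ℂ] H₁ := (A.P i g).adjoint

theorem inner_Q_left (i : ι) (g : Γ₁) (u : H₂) (v : H₁) : ⟪A.Q i g u, v⟫_ℂ = ⟪u, A.P i g v⟫_ℂ :=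
  ContinuousLinearMap.adjoint_inner_left _ _ _

theorem inner_Q_right (i : ι) (g : Γ₁) (u : H₂) (v : H₁) : ⟪v, A.Q i g u⟫_ℂ = ⟪A.P i g v, u⟫_ℂ :=
  ContinuousLinearMap.adjoint_inner_right _ _ _

/-- In `adjoint_P_P` with equal indices only `h = 1` contributes, as the other translates of `Uᵢᵍ`
are disjoint from it. Thus `P* P = M²`, and pushing down is isometric after the cut-off. -/
theorem norm_P (i : ι) (g : Γ₁) (v : H₁) : ‖A.P i g v‖ = ‖A.M i g v‖ := by
  have h1 : A.Q i g (A.P i g v) = A.M i g (A.M i g v) := by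
    refine (A.adjoint_P_P i g i g v).unique ?_
    have := hasSum_single (f := fun h : quot.ker => A.M i g (A.U₁ h (A.M i g v))) 1 fun h hh => ?_
    · simpa using this
    · rw [A.U_M]
      refine A.M_disj _ _ _ (fun e => hh ?_) _
      exact Subtype.ext (right_eq_mul.1 e)
  have h2 : ⟪A.P i g v, A.P i g v⟫_ℂ = ⟪A.M i g v, A.M i g v⟫_ℂ := by
    rw [← A.inner_Q_right, h1, ← A.M_inner]
  rw [inner_self_eq_norm_sq_to_K, inner_self_eq_norm_sq_to_K] at h2
  have h3 : ‖A.P i g v‖ ^ 2 = ‖A.M i g v‖ ^ 2 := by exact_mod_cast h2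
  exact (sq_eq_sq₀ (norm_nonneg _) (norm_nonneg _)).1 h3

theorem P_eq_zero_iff {i : ι} {g : Γ₁} {v : H₁} : A.P i g v = 0 ↔ A.M i g v = 0 := by
  rw [← norm_eq_zero, A.norm_P, norm_eq_zero]

theorem norm_P_le (i : ι) (g : Γ₁) (v : H₁) : ‖A.P i g v‖ ≤ ‖v‖ :=
  (A.norm_P i g v).trans_le (A.M_norm i g v)

theorem norm_Q_le (i : ι) (g : Γ₁) (u : H₂) : ‖A.Q i g u‖ ≤ ‖u‖ := by
  refine ((A.Q i g).le_opNorm u).trans (mul_le_of_le_one_left (norm_nonneg _) ?_)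
  rw [Q, LinearIsometryEquiv.norm_map]
  exact ContinuousLinearMap.opNorm_le_bound _ zero_le_one fun v => by
    simpa using A.norm_P_le i g v

theorem U_Q (h : Γ₁) (i : ι) (g : Γ₁) (u : H₂) :
    A.U₁ h (A.Q i g u) = A.Q i (h * g) (A.U₂ (quot h) u) := by
  refine ext_inner_right ℂ fun w => ?_
  obtain ⟨v, rfl⟩ := (A.U₁ h).surjective w
  rw [LinearIsometryEquiv.inner_map_map, A.inner_Q_left, A.inner_Q_left, ← A.U_P,
    LinearIsometryEquiv.inner_map_map]

theorem M_M_comm_zero {i j : ι} {g k : Γ₁} (h : ∀ v, A.M i g (A.M j k v) = 0) (v : H₁) :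
    A.M j k (A.M i g v) = 0 := by
  refine ext_inner_right ℂ fun w => ?_
  rw [A.M_inner, A.M_inner, h, inner_zero_right, inner_zero_left]

theorem M_Q_eq_zero {i j : ι} {g k : Γ₁} (h : ∀ v, A.M i g (A.M j k v) = 0) (u : H₂) :
    A.M i g (A.Q j k u) = 0 := by
  refine ext_inner_right ℂ fun w => ?_
  rw [A.M_inner, A.inner_Q_left, A.P_eq_zero_iff.2 (A.M_M_comm_zero h w), inner_zero_right,
    inner_zero_left]

/-- If `g` and `g'` have different classes, no kernel translate of `Uᵢ^{g'}` equals `Uᵢᵍ`, so every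
term of `adjoint_P_P` vanishes: the images downstairs are disjoint. -/
theorem P_orthogonal (i : ι) {g g' : Γ₁} (h : quot g ≠ quot g') (v w : H₁) :
    ⟪A.P i g v, A.P i g' w⟫_ℂ = 0 := by
  rw [← A.inner_Q_right]
  have : A.Q i g (A.P i g' w) = 0 := by
    refine (A.adjoint_P_P i g i g' w).unique ?_
    convert hasSum_zero with k
    rw [A.U_M]
    refine A.M_disj _ _ _ ?_ _
    rintro rfl
    apply h
    rw [map_mul, show quot k = 1 from k.2, one_mul]
  rw [this, inner_zero_right]

theorem Q_orthogonal (i : ι) {g g' : Γ₁} (h : g ≠ g') (u w : H₂) :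
    ⟪A.Q i g u, A.Q i g' w⟫_ℂ = 0 := by
  rw [A.inner_Q_left, A.P_eq_zero_iff.2, inner_zero_right]
  exact A.M_Q_eq_zero (A.M_disj i g g' h) w

theorem U_U_inv (g : Γ₁) (v : H₁) : A.U₁ g (A.U₁ g⁻¹ v) = v := by
  have : (A.U₁ g * A.U₁ g⁻¹) v = v := by rw [← map_mul, mul_inv_cancel, map_one]; rfl
  exact this

/-- The relative positions of the sets `Uᵢᵍ` that meet. -/
def near : Set Γ₁ := ⋃ p : ι × ι, {g | ∃ v, A.M p.1 1 (A.M p.2 g v) ≠ 0}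

theorem finite_near [Finite ι] : A.near.Finite := Set.finite_iUnion fun p => A.M_fin p.1 p.2

/-- Translating by `g⁻¹` moves the pair of sets to the normalised position used in `near`. -/
theorem mem_near {i j : ι} {g k : Γ₁} {v : H₁} (h : A.M i g (A.M j k v) ≠ 0) :
    g⁻¹ * k ∈ A.near := by
  refine Set.mem_iUnion.2 ⟨(i, j), A.U₁ g⁻¹ v, fun h0 => h ?_⟩
  have := congrArg (A.U₁ g) h0
  rwa [map_zero, A.U_M, A.U_M, mul_one, mul_inv_cancel_left, A.U_U_inv] at this

theorem mem_near_of_M_Q {i j : ι} {g k : Γ₁} {u : H₂} (h : A.M i g (A.Q j k u) ≠ 0) :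
    g⁻¹ * k ∈ A.near := by
  by_contra h'
  refine h (A.M_Q_eq_zero (fun v => ?_) u)
  by_contra hv
  exact h' (A.mem_near hv)

/-- Downstairs only the class of the relative position is controlled, since the overlap may come
from any kernel translate. -/
theorem mem_near_of_Q_P {i j : ι} {g k : Γ₁} {v : H₁} (h : A.Q i g (A.P j k v) ≠ 0) :
    (quot g)⁻¹ * quot k ∈ quot '' A.near := by
  obtain ⟨l, hl⟩ : ∃ l : quot.ker, A.M i g (A.U₁ l (A.M j k v)) ≠ 0 := by
    by_contra! h'
    refine h ((A.adjoint_P_P i g j k v).unique ?_)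
    simp only [h']
    exact hasSum_zero
  rw [A.U_M] at hl
  refine ⟨_, A.mem_near hl, ?_⟩
  rw [map_mul, map_mul, map_inv, show quot l = 1 from l.2, one_mul]

/-- The vectors supported in finitely many of the sets `Uᵢᵍ`. -/
def core : Submodule ℂ H₁ where
  carrier := {v | {p : ι × Γ₁ | A.M p.1 p.2 v ≠ 0}.Finite}
  zero_mem' := by simp
  add_mem' := fun {v w} hv hw => (hv.union hw).subset fun p hp => by
    by_contra h
    simp only [Set.mem_union, Set.mem_ofPred_eq, not_or, not_not] at h
    exact hp (by rw [map_add, h.1, h.2, add_zero])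
  smul_mem' := fun c v hv => hv.subset fun p hp h => hp (by rw [map_smul, h, smul_zero])

theorem U_mem_core {v : H₁} (hv : v ∈ A.core) (h : Γ₁) : A.U₁ h v ∈ A.core := by
  refine (Set.Finite.image (fun p : ι × Γ₁ => (p.1, h * p.2)) hv).subset ?_
  rintro ⟨i, g⟩ hg
  refine ⟨(i, h⁻¹ * g), fun h0 => hg ?_, by simp⟩
  have := congrArg (A.U₁ h) h0
  rwa [map_zero, A.U_M, mul_inv_cancel_left] at this

/-! ### Summation over the fibres on the core -/

section

variable [Finite ι]

theorem mem_core_of_near {v : H₁} {s : Set Γ₁} (hs : s.Finite)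
    (h : ∀ i g, A.M i g v ≠ 0 → g ∈ s) : v ∈ A.core :=
  (Set.finite_univ.prod hs).subset fun p hp => ⟨trivial, h p.1 p.2 hp⟩

theorem finite_inv_mul_mem {G : Type*} [Group G] {B : Set G} (hB : B.Finite) (k : G) :
    {g | g⁻¹ * k ∈ B}.Finite := by
  refine (hB.image fun b => k * b⁻¹).subset fun g hg => ⟨_, hg, by simp⟩

theorem M_mem_core (i : ι) (g : Γ₁) (v : H₁) : A.M i g v ∈ A.core :=
  A.mem_core_of_near (finite_inv_mul_mem A.finite_near g) fun _ _ h => A.mem_near h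

theorem Q_mem_core (i : ι) (g : Γ₁) (u : H₂) : A.Q i g u ∈ A.core :=
  A.mem_core_of_near (finite_inv_mul_mem A.finite_near g) fun _ _ h => A.mem_near_of_M_Q h

/-- Finite propagation of an operator on `H₁`, in terms of the sets `Uᵢᵍ`. -/
def FinProp (T : H₁ →L[ℂ] H₁) : Prop :=
  ∃ B : Set Γ₁, B.Finite ∧ ∀ i g j k v, A.M j k (T (A.M i g v)) ≠ 0 → g⁻¹ * k ∈ B

variable {A}

theorem FinProp.adjoint {T : H₁ →L[ℂ] H₁} (hT : A.FinProp T) : A.FinProp T.adjoint := by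
  obtain ⟨B, hB, h⟩ := hT
  refine ⟨B⁻¹, hB.inv, fun i g j k v hv => ?_⟩
  obtain ⟨w, hw⟩ : ∃ w, A.M i g (T (A.M j k w)) ≠ 0 := by
    by_contra! h0
    refine hv (ext_inner_right ℂ fun w => ?_)
    rw [A.M_inner, ContinuousLinearMap.adjoint_inner_left, A.M_inner, h0, inner_zero_right,
      inner_zero_left]
  have := h _ _ _ _ _ hw
  rw [Set.mem_inv]
  simpa using this

/-- A core vector is the finite sum of its cut-offs, to each of which the propagation bound applies.
-/
theorem FinProp.exists_of_mem_core {T : H₁ →L[ℂ] H₁} (hT : A.FinProp T) : ∃ B : Set Γ₁, B.Finite ∧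
    ∀ v ∈ A.core, ∀ j k, A.M j k (T v) ≠ 0 → ∃ i g, A.M i g v ≠ 0 ∧ g⁻¹ * k ∈ B := by
  obtain ⟨B, hB, h⟩ := hT
  refine ⟨B, hB, fun v hv j k hjk => ?_⟩
  by_contra! h'
  refine hjk ((((A.hasSum_M v hv).mapL T).mapL (A.M j k)).unique ?_)
  convert hasSum_zero with p
  by_contra hp
  refine h' p.1 p.2 (fun h0 => hp (by simp [h0])) (h _ _ _ _ _ hp)

theorem FinProp.mem_core {T : H₁ →L[ℂ] H₁} (hT : A.FinProp T) {v : H₁} (hv : v ∈ A.core) :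
    T v ∈ A.core := by
  obtain ⟨B, hB, h⟩ := hT.exists_of_mem_core
  refine A.mem_core_of_near (s := (Prod.snd '' {p : ι × Γ₁ | A.M p.1 p.2 v ≠ 0}) * B)
    ((Set.Finite.image _ hv).mul hB) fun j k hjk => ?_
  obtain ⟨i, g, h1, h2⟩ := h v hv j k hjk
  exact ⟨g, ⟨(i, g), h1, rfl⟩, _, h2, by simp⟩

variable (A)

/-- The sum over the fibres of the projection. -/
def push (w : H₁) : H₂ := ∑' p : ι × Γ₁, A.P p.1 p.2 w

/-- On the core the sum is finite. For other vectors `push` may be the default value of a divergent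
`tsum`, so all statements about it are restricted to the core. -/
theorem hasSum_push {w : H₁} (hw : w ∈ A.core) :
    HasSum (fun p : ι × Γ₁ => A.P p.1 p.2 w) (A.push w) := by
  refine Summable.hasSum (summable_of_hasFiniteSupport ?_)
  exact Set.Finite.subset hw fun p hp h => hp (A.P_eq_zero_iff.2 h)

theorem push_add {v w : H₁} (hv : v ∈ A.core) (hw : w ∈ A.core) :
    A.push (v + w) = A.push v + A.push w := by
  refine (A.hasSum_push (A.core.add_mem hv hw)).unique ?_
  simp only [map_add]
  exact (A.hasSum_push hv).add (A.hasSum_push hw)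

theorem push_smul (c : ℂ) {v : H₁} (hv : v ∈ A.core) : A.push (c • v) = c • A.push v := by
  refine (A.hasSum_push (A.core.smul_mem c hv)).unique ?_
  simp only [map_smul]
  exact (A.hasSum_push hv).const_smul c

theorem push_U {w : H₁} (hw : w ∈ A.core) (h : Γ₁) :
    A.push (A.U₁ h w) = A.U₂ (quot h) (A.push w) := by
  refine (A.hasSum_push (A.U_mem_core hw h)).unique ?_
  have h1 := (A.hasSum_push hw).mapL
    ((A.U₂ (quot h)).toContinuousLinearEquiv : H₂ →L[ℂ] H₂)
  refine ((Equiv.prodCongr (Equiv.refl ι) (Equiv.mulLeft h)).hasSum_iff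
    (f := fun p : ι × Γ₁ => A.P p.1 p.2 (A.U₁ h w)) (a := A.U₂ (quot h) (A.push w))).1 ?_
  have h2 : (fun p : ι × Γ₁ => A.P p.1 p.2 (A.U₁ h w)) ∘
      (Equiv.prodCongr (Equiv.refl ι) (Equiv.mulLeft h)) =
      fun p : ι × Γ₁ => A.U₂ (quot h) (A.P p.1 p.2 w) := by
    ext p
    exact (A.U_P h p.1 p.2 w).symm
  rw [h2]
  exact h1

/-- The inner product of a sum over fibres with a localized pushforward. -/
theorem hasSum_inner_P {a : H₁} (ha : a ∈ A.core) (j : ι) (k : Γ₁) (b : H₁) :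
    HasSum (fun h : quot.ker => ⟪a, A.U₁ h (A.M j k b)⟫_ℂ) ⟪A.push a, A.P j k b⟫_ℂ := by
  classical
  have ha' := A.hasSum_M a ha
  set F := Set.Finite.toFinset ha with hF
  have hMa : ∀ p ∉ F, A.M p.1 p.2 a = 0 := fun p hp => by
    by_contra h
    exact hp ((Set.Finite.mem_toFinset ha).2 h)
  have e1 : A.push a = ∑ p ∈ F, A.P p.1 p.2 a := (A.hasSum_push ha).unique
    (hasSum_sum_of_ne_finset_zero fun p hp => A.P_eq_zero_iff.2 (hMa p hp))
  have e2 : a = ∑ p ∈ F, A.M p.1 p.2 a := ha'.unique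
    (hasSum_sum_of_ne_finset_zero fun p hp => hMa p hp)
  rw [e1, sum_inner]
  have h1 : HasSum (fun h : quot.ker => ∑ p ∈ F, ⟪A.M p.1 p.2 a, A.U₁ h (A.M j k b)⟫_ℂ)
      (∑ p ∈ F, ⟪A.P p.1 p.2 a, A.P j k b⟫_ℂ) := by
    refine hasSum_sum fun p _ => ?_
    have := (A.adjoint_P_P p.1 p.2 j k b).mapL (innerSL ℂ a)
    simp only [innerSL_apply_apply, ← A.M_inner] at this
    rwa [A.inner_Q_right] at this
  simp only [← sum_inner, ← e2] at h1
  rw [← sum_inner]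
  exact h1

/-- Both sides have the same inner products with all vectors `P j k b`, and these separate points.
This identifies the summed pushforward of a localized vector with its pushforward through a single
set. -/
theorem push_M (i : ι) (g : Γ₁) (w : H₁) : A.push (A.M i g w) = A.P i g w := by
  rw [← sub_eq_zero]
  refine A.eq_zero _ fun j k => ext_inner_right ℂ fun b => ?_
  have h1 := A.hasSum_inner_P (A.M_mem_core i g w) j k b
  have h2 := (A.adjoint_P_P i g j k b).mapL (innerSL ℂ w)
  simp only [innerSL_apply_apply, ← A.M_inner] at h2
  rw [A.inner_Q_right] at h2
  rw [A.inner_Q_left, inner_sub_left, h1.unique h2, sub_self, inner_zero_left]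

/-- The central identity: expanding `b` into its finitely many cut-offs reduces it to
`hasSum_inner_P`. It transports adjoints through the summation over fibres. -/
theorem hasSum_inner_push {a b : H₁} (ha : a ∈ A.core) (hb : b ∈ A.core) :
    HasSum (fun h : quot.ker => ⟪a, A.U₁ h b⟫_ℂ) ⟪A.push a, A.push b⟫_ℂ := by
  have hb' := A.hasSum_M b hb
  set F := Set.Finite.toFinset hb with hF
  have hMb : ∀ p ∉ F, A.M p.1 p.2 b = 0 := fun p hp => by
    by_contra h
    exact hp ((Set.Finite.mem_toFinset hb).2 h)
  have e1 : A.push b = ∑ p ∈ F, A.P p.1 p.2 b := (A.hasSum_push hb).unique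
    (hasSum_sum_of_ne_finset_zero fun p hp => A.P_eq_zero_iff.2 (hMb p hp))
  have e2 : b = ∑ p ∈ F, A.M p.1 p.2 b := hb'.unique
    (hasSum_sum_of_ne_finset_zero fun p hp => hMb p hp)
  have h1 := hasSum_sum (s := F) fun p _ => A.hasSum_inner_P ha p.1 p.2 b
  simp only [← inner_sum, ← map_sum, ← e2] at h1
  rwa [← e1] at h1

/-- Every `P j k b` is a pushforward of a core vector, by `push_M`, so testing against pushforwards
suffices. -/
theorem eq_of_inner_push {x y : H₂} (h : ∀ b ∈ A.core, ⟪x, A.push b⟫_ℂ = ⟪y, A.push b⟫_ℂ) :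
    x = y := by
  rw [← sub_eq_zero]
  refine A.eq_zero _ fun j k => ext_inner_right ℂ fun b => ?_
  rw [A.inner_Q_left, ← A.push_M, inner_sub_left, h _ (A.M_mem_core j k b), sub_self,
    inner_zero_left]

/-- The sums over the fibres as a linear map. -/
def pushMap : A.core →ₗ[ℂ] H₂ where
  toFun w := A.push w
  map_add' v w := A.push_add v.2 w.2
  map_smul' c v := A.push_smul c v.2

theorem dense_range_push : Dense (A.push '' A.core) := by
  have h1 : A.push '' A.core = (LinearMap.range A.pushMap : Set H₂) := by
    ext x
    constructor
    · rintro ⟨w, hw, rfl⟩; exact ⟨⟨w, hw⟩, rfl⟩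
    · rintro ⟨w, rfl⟩; exact ⟨w, w.2, rfl⟩
  rw [h1, Submodule.dense_iff_topologicalClosure_eq_top,
    Submodule.topologicalClosure_eq_top_iff, Submodule.eq_bot_iff]
  intro u hu
  refine A.eq_of_inner_push fun b hb => ?_
  have h2 : ⟪A.push b, u⟫_ℂ = 0 := (Submodule.mem_orthogonal _ _).1 hu _ ⟨⟨b, hb⟩, rfl⟩
  rw [inner_zero_left, ← inner_conj_symm, h2, map_zero]

/-- By density an operator downstairs is determined on pushforwards. The algebraic properties of the
folding map are verified through this principle. -/
theorem ext_push {X Y : H₂ →L[ℂ] H₂} (h : ∀ w ∈ A.core, X (A.push w) = Y (A.push w)) : X = Y := by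
  refine ContinuousLinearMap.coeFn_injective (X.continuous.ext_on A.dense_range_push Y.continuous ?_)
  rintro _ ⟨w, hw, rfl⟩
  exact h w hw

end

/-! ### Convergence of the folding and unfolding sums, and intertwining -/

section Folding

variable {S : Set Γ₁}

/-- The decomposition of `Γ₁` into cosets, with translated representatives. -/
def cosetEquiv (hS : Set.BijOn quot S Set.univ) (g : Γ₁) : quot.ker × S ≃ Γ₁ :=
  Equiv.ofBijective (fun p => (p.1 : Γ₁)⁻¹ * (g * p.2)) (by
    constructor
    · rintro ⟨h, s⟩ ⟨h', s'⟩ e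
      simp only at e
      have e1 := congrArg quot e
      simp only [map_mul, map_inv, show quot h = 1 from h.2, show quot h' = 1 from h'.2, inv_one,
        one_mul, mul_right_inj] at e1
      have e2 : s = s' := Subtype.ext (hS.injOn s.2 s'.2 e1)
      subst e2
      have e3 : h = h' := Subtype.ext (inv_injective (mul_right_cancel e))
      rw [e3]
    · intro x
      obtain ⟨s, hs, hsx⟩ := hS.surjOn (Set.mem_univ (quot (g⁻¹ * x)))
      -- The representative `s` was chosen in the class of `g⁻¹ * x`, which is what puts `g * s *
      -- x⁻¹` into the kernel.
      refine ⟨(⟨g * s * x⁻¹, ?_⟩, ⟨s, hs⟩), by simp only; group⟩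
      rw [MonoidHom.mem_ker, map_mul, map_mul, hsx]
      simp)

theorem finite_representatives (hS : Set.BijOn quot S Set.univ) {C : Set Γ₂} (hC : C.Finite) :
    {s : S | quot s ∈ C}.Finite :=
  Set.Finite.preimage (fun s _ s' _ h => Subtype.ext (hS.injOn s.2 s'.2 h)) hC

/-- Moving the kernel element across the inner product turns each term into `⟪x, P j (h⁻¹ g s) b⟫`,
and `h⁻¹ g s` runs through `Γ₁` exactly once. Hence lifting along a full set of representatives is
dual to `push`, for every base point `g`: folding uses `g = 1`, unfolding all `g`. -/
theorem hasSum_inner_coset [Finite ι] (hS : Set.BijOn quot S Set.univ) (g : Γ₁) (x : H₂) {b : H₁}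
    (hb : b ∈ A.core) :
    HasSum (fun p : quot.ker × (S × ι) => ⟪A.Q p.2.2 (g * p.2.1) x, A.U₁ p.1 b⟫_ℂ)
      ⟪x, A.push b⟫_ℂ := by
  have h1 := (A.hasSum_push hb).mapL (innerSL ℂ x)
  simp only [innerSL_apply_apply] at h1
  let e : quot.ker × (S × ι) ≃ ι × Γ₁ :=
    (Equiv.prodAssoc _ _ _).symm.trans
      (((cosetEquiv hS g).prodCongr (Equiv.refl ι)).trans (Equiv.prodComm _ _))
  rw [← e.hasSum_iff] at h1
  have h2 : (fun p : quot.ker × (S × ι) => ⟪A.Q p.2.2 (g * p.2.1) x, A.U₁ p.1 b⟫_ℂ) =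
      (fun p : ι × Γ₁ => ⟪x, A.P p.1 p.2 b⟫_ℂ) ∘ e := by
    ext ⟨h, s, j⟩
    change ⟪A.Q j (g * s) x, A.U₁ h b⟫_ℂ = ⟪x, A.P j ((h : Γ₁)⁻¹ * (g * s)) b⟫_ℂ
    have h3 := A.U_P (h : Γ₁) j ((h : Γ₁)⁻¹ * (g * s)) b
    rw [show quot h = 1 from h.2, map_one, mul_inv_cancel_left] at h3
    rw [A.inner_Q_left, ← h3]
    rfl
  rwa [h2]

/-- The terms of the folding of `T`. -/
def foldTerm (S : Set Γ₁) (T : H₁ →L[ℂ] H₁) (u : H₂) : Γ₁ × S × ι × ι → H₂ :=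
  fun p => A.P p.2.2.1 p.1 (T (A.Q p.2.2.2 p.2.1 u))

/-- The terms of the preimage of `T` under folding. -/
def unfoldTerm (S : Set Γ₁) (T : H₂ →L[ℂ] H₂) (v : H₁) : Γ₁ × S × ι × ι → H₁ :=
  fun p => A.Q p.2.2.2 (p.1 * p.2.1) (T (A.P p.2.2.1 p.1 v))

variable [Finite ι]

variable {A} in
-- The vector `Q j k u` lives near position `k`, and `T` displaces it by an element of `B`; the two
-- displacements multiply.
theorem FinProp.exists_foldTerm {T : H₁ →L[ℂ] H₁} (hT : A.FinProp T) : ∃ B : Set Γ₁, B.Finite ∧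
    ∀ i g j k u, A.P i g (T (A.Q j k u)) ≠ 0 → k⁻¹ * g ∈ B := by
  obtain ⟨B, hB, h⟩ := hT.exists_of_mem_core
  refine ⟨A.near⁻¹ * B, A.finite_near.inv.mul hB, fun i g j k u hne => ?_⟩
  rw [Ne, A.P_eq_zero_iff] at hne
  obtain ⟨l, m, h1, h2⟩ := h _ (A.Q_mem_core j k u) i g hne
  exact ⟨k⁻¹ * m, by simpa using A.mem_near_of_M_Q h1, _, h2, by simp⟩

/-- Terms are sorted by `(s⁻¹ g, i, j)`, with finitely many classes by finite propagation. Inside a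
class `g = s b`, so distinct terms have distinct `s`, and their images in `Γ₂` differ.
`P_orthogonal` then gives orthogonality on both sides of `T`, and the bound `‖T‖` for each class. -/
theorem exists_hasSum_foldTerm (hS : Set.BijOn quot S Set.univ)
    {T : H₁ →L[ℂ] H₁} (hT : A.FinProp T) :
    ∃ X : H₂ →L[ℂ] H₂, ∀ u, HasSum (A.foldTerm S T u) (X u) := by
  obtain ⟨B, hB, hTB⟩ := hT.exists_foldTerm
  refine exists_hasSum_of_bounded
    (A := fun p : Γ₁ × S × ι × ι => A.P p.2.2.1 p.1 ∘L T ∘L A.Q p.2.2.2 p.2.1)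
    (χ := fun p : Γ₁ × S × ι × ι => ((p.2.1 : Γ₁)⁻¹ * p.1, p.2.2)) (c := B ×ˢ Set.univ)
    (hB.prod Set.finite_univ) (fun p u hp => ⟨hTB _ _ _ _ _ hp, trivial⟩) (C := ‖T‖) ?_
    A.dense_range_push ?_
  · rintro ⟨b, i, j⟩ - F hF u
    have hF' : ∀ p ∈ F, p.1 = p.2.1 * b ∧ p.2.2.1 = i ∧ p.2.2.2 = j := fun p hp => by
      have := hF p hp
      simp only [Prod.ext_iff] at this
      exact ⟨by rw [← this.1]; simp, this.2.1, this.2.2⟩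
    have hne : ∀ p ∈ F, ∀ q ∈ F, p ≠ q → quot p.2.1 ≠ quot q.2.1 := fun p hp q hq hpq e => by
      have h1 : p.2.1 = q.2.1 := Subtype.ext (hS.injOn p.2.1.2 q.2.1.2 e)
      obtain ⟨a1, a2, a3⟩ := hF' p hp
      obtain ⟨b1, b2, b3⟩ := hF' q hq
      refine hpq (Prod.ext ?_ (Prod.ext h1 (Prod.ext ?_ ?_)))
      · rw [a1, b1, h1]
      · rw [a2, b2]
      · rw [a3, b3]
    refine norm_sum_orthogonal_le F (fun p => A.P p.2.2.1 p.1) T (fun p => A.P p.2.2.2 p.2.1)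
      (fun p hp q hq hpq v w => ?_) (fun p _ => A.norm_P_le _ _)
      (fun p hp q hq hpq v w => ?_) (fun p _ => A.norm_P_le _ _) u
    · obtain ⟨a1, a2, a3⟩ := hF' p hp
      obtain ⟨b1, b2, b3⟩ := hF' q hq
      rw [a1, a2, b1, b2]
      refine A.P_orthogonal i (fun e => hne p hp q hq hpq ?_) v w
      simpa using e
    · obtain ⟨a1, a2, a3⟩ := hF' p hp
      obtain ⟨b1, b2, b3⟩ := hF' q hq
      rw [a3, b3]
      exact A.P_orthogonal j (hne p hp q hq hpq) v w
  · rintro _ ⟨w, hw, rfl⟩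
    -- A pushforward `push w` meets only finitely many classes in `Γ₂`, and each class has a single
    -- representative in `S`.
    have hfin : {s : S | ∃ j, A.Q j s (A.push w) ≠ 0}.Finite := by
      have hC : ((fun p : ι × Γ₁ => quot p.2) '' {p | A.M p.1 p.2 w ≠ 0} *
        (quot '' A.near)⁻¹).Finite := (Set.Finite.image _ hw).mul (A.finite_near.image _).inv
      refine (finite_representatives hS hC).subset ?_
      rintro s ⟨j, hj⟩
      obtain ⟨p, hp⟩ : ∃ p : ι × Γ₁, A.Q j s (A.P p.1 p.2 w) ≠ 0 := by
        by_contra! h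
        refine hj (((A.hasSum_push hw).mapL (A.Q j s)).unique ?_)
        simp only [h]
        exact hasSum_zero
      refine Set.mem_mul.2 ⟨quot p.2, ⟨p, fun h0 => hp ?_, rfl⟩, _,
        Set.inv_mem_inv.2 (A.mem_near_of_Q_P hp), by simp⟩
      rw [A.P_eq_zero_iff.2 h0, map_zero]
    refine ((hB.prod (hfin.prod (Set.finite_univ (α := ι × ι)))).image
      fun p : Γ₁ × S × ι × ι => ((p.2.1 : Γ₁) * p.1, p.2.1, p.2.2)).subset ?_
    rintro ⟨g, s, i, j⟩ hp
    refine ⟨((s : Γ₁)⁻¹ * g, s, i, j), ⟨hTB _ _ _ _ _ hp, ⟨j, fun h => hp ?_⟩, trivial⟩, by simp⟩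
    change A.P i g (T (A.Q j s (A.push w))) = 0
    rw [h, map_zero, map_zero]

/-- The folding of `T` intertwines the sums over the fibres. -/
theorem apply_push_of_hasSum_foldTerm (hS : Set.BijOn quot S Set.univ)
    {T : H₁ →L[ℂ] H₁} (hT : A.FinProp T)
    (hTU : ∀ g v, A.U₁ g (T v) = T (A.U₁ g v)) {X : H₂ →L[ℂ] H₂}
    (hX : ∀ u, HasSum (A.foldTerm S T u) (X u)) {w : H₁} (hw : w ∈ A.core) :
    X (A.push w) = A.push (T w) := by
  -- Equivariance lets `T` move past the translation before its adjoint is taken.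
  have hadj : ∀ g a b, ⟪T a, A.U₁ g b⟫_ℂ = ⟪a, A.U₁ g (T.adjoint b)⟫_ℂ := fun g a b => by
    obtain ⟨a', rfl⟩ := (A.U₁ g).surjective a
    rw [← hTU, LinearIsometryEquiv.inner_map_map, LinearIsometryEquiv.inner_map_map,
      ContinuousLinearMap.adjoint_inner_right]
  refine A.eq_of_inner_push fun b hb => ?_
  have hTb := hT.adjoint.mem_core hb
  -- This says that the adjoint of the folding is computed by the adjoint of `T`. For fixed `(s, j)`
  -- the sum over `(i, g)` is a `push`; pairing with `push b` opens it into a sum over the kernel,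
  -- and all these sums together run over `Γ₁`.
  have h1 : ∀ u, ⟪X u, A.push b⟫_ℂ = ⟪u, A.push (T.adjoint b)⟫_ℂ := by
    intro u
    have e1 : HasSum (fun p : (S × ι) × (ι × Γ₁) =>
        A.P p.2.1 p.2.2 (T (A.Q p.1.2 p.1.1 u))) (X u) := by
      let e : (S × ι) × (ι × Γ₁) ≃ Γ₁ × S × ι × ι :=
        { toFun := fun p => (p.2.2, p.1.1, p.2.1, p.1.2)
          invFun := fun p => ((p.2.1, p.2.2.2), (p.2.2.1, p.1))
          left_inv := fun _ => rfl
          right_inv := fun _ => rfl }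
      exact (e.hasSum_iff (f := A.foldTerm S T u)).2 (hX u)
    have e2 := e1.prod_fiberwise (g := fun q : S × ι => A.push (T (A.Q q.2 q.1 u)))
      fun q => A.hasSum_push (hT.mem_core (A.Q_mem_core q.2 q.1 u))
    have e3 := e2.mapL (innerSL ℂ (A.push b))
    simp only [innerSL_apply_apply] at e3
    -- The kernel and the representatives jointly enumerate `Γ₁`, so the double sum is a single
    -- pairing with `push`.
    have e4 : HasSum (fun p : (S × ι) × quot.ker =>
        ⟪A.Q p.1.2 p.1.1 u, A.U₁ p.2 (T.adjoint b)⟫_ℂ) ⟪u, A.push (T.adjoint b)⟫_ℂ := by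
      have := A.hasSum_inner_coset hS 1 u hTb
      simp only [one_mul] at this
      exact (Equiv.hasSum_iff (f := fun p : quot.ker × (S × ι) =>
        ⟪A.Q p.2.2 p.2.1 u, A.U₁ p.1 (T.adjoint b)⟫_ℂ) (Equiv.prodComm (S × ι) quot.ker)).2 this
    have e5 := e4.prod_fiberwise (g := fun q : S × ι =>
      ⟪A.push (T (A.Q q.2 q.1 u)), A.push b⟫_ℂ) fun q => by
        have := A.hasSum_inner_push (hT.mem_core (A.Q_mem_core q.2 q.1 u)) hb
        simpa only [hadj] using this
    have e6 := e5.star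
    simp only [RCLike.star_def, inner_conj_symm] at e6
    rw [← inner_conj_symm, e3.unique e6, inner_conj_symm]
  rw [h1]
  refine (A.hasSum_inner_push hw hTb).unique ?_
  have := A.hasSum_inner_push (hT.mem_core hw) hb
  simpa only [hadj] using this

/-- Finite propagation of an operator on `H₂`, in terms of the sets `Uᵢᵍ`. -/
def FinProp₂ (T : H₂ →L[ℂ] H₂) : Prop :=
  ∃ B : Set Γ₂, B.Finite ∧ ∀ i g j k v, A.Q j k (T (A.P i g v)) ≠ 0 → quot (g⁻¹ * k) ∈ B

/-- Here the class of a term is `(s, i, j)`, and finite propagation leaves finitely many `s`. Inside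
a class the terms are indexed by `g`, and the sets `Uᵢᵍ` and `Uⱼ^{gs}` upstairs are disjoint for
different `g`. -/
theorem exists_hasSum_unfoldTerm (hS : Set.BijOn quot S Set.univ)
    {T : H₂ →L[ℂ] H₂} (hT : A.FinProp₂ T) :
    ∃ X : H₁ →L[ℂ] H₁, ∀ v, HasSum (A.unfoldTerm S T v) (X v) := by
  obtain ⟨B, hB, hTB⟩ := hT
  have hTS : ∀ (p : Γ₁ × S × ι × ι) v, A.unfoldTerm S T v p ≠ 0 → quot p.2.1 ∈ B := by
    intro p v hp
    simpa using hTB _ _ _ _ _ hp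
  refine exists_hasSum_of_bounded
    (A := fun p : Γ₁ × S × ι × ι => A.Q p.2.2.2 (p.1 * p.2.1) ∘L T ∘L A.P p.2.2.1 p.1)
    (χ := fun p : Γ₁ × S × ι × ι => p.2) (c := {s : S | quot s ∈ B} ×ˢ Set.univ)
    ((finite_representatives hS hB).prod Set.finite_univ) (fun p v hp => ⟨hTS p v hp, trivial⟩)
    (C := ‖T‖) ?_ A.dense_core ?_
  · rintro ⟨s, i, j⟩ - F hF v
    have hne : ∀ p ∈ F, ∀ q ∈ F, p ≠ q → p.1 ≠ q.1 := fun p hp q hq hpq e =>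
      hpq (Prod.ext e ((hF p hp).trans (hF q hq).symm))
    -- The operators `P` on the right appear as adjoints of the `Q`, whose ranges are orthogonal for
    -- distinct group elements.
    have := norm_sum_orthogonal_le F (fun p => A.Q p.2.2.2 (p.1 * p.2.1)) T
      (fun p => A.Q p.2.2.1 p.1) (fun p hp q hq hpq v w => ?_) (fun p _ => A.norm_Q_le _ _)
      (fun p hp q hq hpq v w => ?_) (fun p _ => A.norm_Q_le _ _) v
    · simpa [Q] using this
    · rw [hF p hp, hF q hq]
      refine A.Q_orthogonal j (fun e => hne p hp q hq hpq ?_) v w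
      simpa using e
    · rw [hF p hp, hF q hq]
      exact A.Q_orthogonal i (hne p hp q hq hpq) v w
  · intro v hv
    refine ((Set.Finite.image Prod.snd hv).prod
      ((finite_representatives hS hB).prod (Set.finite_univ (α := ι × ι)))).subset ?_
    rintro ⟨g, s, i, j⟩ hp
    refine ⟨⟨(i, g), fun h0 => hp ?_, rfl⟩, hTS _ v hp, trivial⟩
    change A.Q j (g * s) (T (A.P i g v)) = 0
    rw [A.P_eq_zero_iff.2 h0, map_zero, map_zero]

/-- On a core vector the sum splits into finitely many lifts `y p`, one for each piece `P p w`. Each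
lift is spread over the representatives based at the position of the piece, so pushing it down
returns `T (P p w)`. -/
theorem push_of_hasSum_unfoldTerm (hS : Set.BijOn quot S Set.univ)
    {T : H₂ →L[ℂ] H₂} (hT : A.FinProp₂ T) {X : H₁ →L[ℂ] H₁}
    (hX : ∀ v, HasSum (A.unfoldTerm S T v) (X v)) {w : H₁} (hw : w ∈ A.core) :
    X w ∈ A.core ∧ A.push (X w) = T (A.push w) := by
  classical
  obtain ⟨B, hB, hTB⟩ := hT
  set F := Set.Finite.toFinset hw with hF
  have hF0 : ∀ p ∉ F, A.P p.1 p.2 w = 0 := fun p hp => by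
    by_contra h
    exact hp ((Set.Finite.mem_toFinset hw).2 (fun h0 => h (A.P_eq_zero_iff.2 h0)))
  have hBS : ({s : S | quot s ∈ B} ×ˢ (Set.univ : Set ι)).Finite :=
    (finite_representatives hS hB).prod Set.finite_univ
  let y : ι × Γ₁ → H₁ := fun p =>
    ∑ q ∈ hBS.toFinset, A.Q q.2 (p.2 * q.1) (T (A.P p.1 p.2 w))
  have hy : ∀ p, HasSum (fun q : S × ι => A.Q q.2 (p.2 * q.1) (T (A.P p.1 p.2 w))) (y p) :=
    fun p => hasSum_sum_of_ne_finset_zero fun q hq => by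
      by_contra h
      refine hq (hBS.mem_toFinset.2 ⟨?_, trivial⟩)
      simpa using hTB _ _ _ _ _ h
  have hyc : ∀ p, y p ∈ A.core := fun p => A.core.sum_mem fun q _ => A.Q_mem_core _ _ _
  -- By `hasSum_inner_coset`, the lift `y p` and the vector `T (P p w)` pair equally with all
  -- pushforwards.
  have hyT : ∀ p, A.push (y p) = T (A.P p.1 p.2 w) := fun p => by
    refine A.eq_of_inner_push fun b hb => ?_
    refine (A.hasSum_inner_push (hyc p) hb).unique ?_
    refine (A.hasSum_inner_coset hS p.2 (T (A.P p.1 p.2 w)) hb).prod_fiberwise fun h => ?_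
    have := ((hy p).mapL (innerSL ℂ (A.U₁ h b))).star
    simpa only [innerSL_apply_apply, RCLike.star_def, inner_conj_symm] using this
  have hXy : X w = ∑ p ∈ F, y p := by
    have e1 : HasSum (fun p : (ι × Γ₁) × (S × ι) =>
        A.Q p.2.2 (p.1.2 * p.2.1) (T (A.P p.1.1 p.1.2 w))) (X w) := by
      let e : (ι × Γ₁) × (S × ι) ≃ Γ₁ × S × ι × ι :=
        { toFun := fun p => (p.1.2, p.2.1, p.1.1, p.2.2)
          invFun := fun p => ((p.2.2.1, p.1), (p.2.1, p.2.2.2))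
          left_inv := fun _ => rfl
          right_inv := fun _ => rfl }
      exact (e.hasSum_iff (f := A.unfoldTerm S T w)).2 (hX w)
    refine (e1.prod_fiberwise hy).unique (hasSum_sum_of_ne_finset_zero fun p hp => ?_)
    simp only [y, hF0 p hp, map_zero, Finset.sum_const_zero]
  have hpush : A.push w = ∑ p ∈ F, A.P p.1 p.2 w :=
    (A.hasSum_push hw).unique (hasSum_sum_of_ne_finset_zero hF0)
  have hXc : X w ∈ A.core := hXy ▸ A.core.sum_mem fun p _ => hyc p
  refine ⟨hXc, ?_⟩
  have : A.push (X w) = A.pushMap (∑ p ∈ F, ⟨y p, hyc p⟩) := by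
    change _ = A.push _
    rw [hXy]
    congr 1
    simp
  rw [this, map_sum, hpush, map_sum]
  exact Finset.sum_congr rfl fun p _ => hyT p

/-- The base point `g` runs over the whole group, so a translation merely reindexes the sum. -/
theorem unfold_equivariant {T : H₂ →L[ℂ] H₂} (hTU : ∀ g v, A.U₂ g (T v) = T (A.U₂ g v))
    {X : H₁ →L[ℂ] H₁} (hX : ∀ v, HasSum (A.unfoldTerm S T v) (X v)) (k : Γ₁) (v : H₁) :
    A.U₁ k (X v) = X (A.U₁ k v) := by
  have h1 := (hX v).mapL ((A.U₁ k).toContinuousLinearEquiv : H₁ →L[ℂ] H₁)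
  have h2 := ((Equiv.prodCongr (Equiv.mulLeft k) (Equiv.refl (S × ι × ι))).hasSum_iff
    (f := A.unfoldTerm S T (A.U₁ k v))).2 (hX _)
  have h3 : A.unfoldTerm S T (A.U₁ k v) ∘
      (Equiv.prodCongr (Equiv.mulLeft k) (Equiv.refl (S × ι × ι))) =
      fun p => A.U₁ k (A.unfoldTerm S T v p) := by
    ext ⟨g, s, i, j⟩
    change A.Q j (k * g * s) (T (A.P i (k * g) (A.U₁ k v))) = A.U₁ k (A.Q j (g * s) (T (A.P i g v)))
    rw [A.U_Q, hTU, A.U_P, mul_assoc]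
  rw [h3] at h2
  exact h1.unique h2

end Folding

end FoldingSystem

end

/-! ### Intermediate coverings -/

section

section Covers

variable {Γ₁ Γ₂ M₁ M₂ N : Type*} [Group Γ₁] [Group Γ₂] [TopologicalSpace M₁] [TopologicalSpace M₂]
  [TopologicalSpace N] [MulAction Γ₁ M₁] [MulAction Γ₂ M₂] {quot : Γ₁ →* Γ₂} {p₁ : C(M₁, N)}
  {p₂ : C(M₂, N)} {pr : C(M₁, M₂)}

theorem eq_one_of_smul_eq {G X Y : Type*} [Group G] [TopologicalSpace X]
    [TopologicalSpace Y] [MulAction G X] {p : X → Y} (hp : IsQuotientCoveringMap p G) {g : G}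
    {x : X} (h : g • x = x) : g = 1 := by
  have := hp.isCancelSMul
  exact IsCancelSMul.right_cancel g 1 x (by rw [h, one_smul])

namespace IsCoverProjection

theorem isLocalHomeomorph (hpr : IsCoverProjection quot p₁ p₂ pr)
    (h₁ : IsQuotientCoveringMap p₁ Γ₁) (h₂ : IsQuotientCoveringMap p₂ Γ₂) :
    IsLocalHomeomorph pr := by
  refine IsLocalHomeomorph.of_comp (g := p₂) ?_ h₂.isCoveringMap.isLocalHomeomorph pr.continuous
  have : p₂ ∘ pr = p₁ := funext hpr.map_proj
  rw [this]
  exact h₁.isCoveringMap.isLocalHomeomorph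

theorem proj_surjective (hpr : IsCoverProjection quot p₁ p₂ pr)
    (h₁ : IsQuotientCoveringMap p₁ Γ₁) (h₂ : IsQuotientCoveringMap p₂ Γ₂) :
    Function.Surjective pr := by
  intro x
  obtain ⟨y, hy⟩ := h₁.surjective (p₂ x)
  rw [← hpr.map_proj] at hy
  obtain ⟨γ, hγ⟩ := h₂.apply_eq_iff_mem_orbit.1 hy.symm
  obtain ⟨g, rfl⟩ := hpr.surjective γ
  exact ⟨g • y, by rw [hpr.map_smul]; exact hγ⟩

/-- The fibres of the projection are the orbits of the kernel. -/
theorem exists_ker_smul_eq (hpr : IsCoverProjection quot p₁ p₂ pr)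
    (h₁ : IsQuotientCoveringMap p₁ Γ₁) (h₂ : IsQuotientCoveringMap p₂ Γ₂) {y y' : M₁}
    (h : pr y = pr y') : ∃ k : quot.ker, (k : Γ₁) • y' = y := by
  have h3 : p₁ y = p₁ y' := by rw [← hpr.map_proj, h, hpr.map_proj]
  obtain ⟨g, hg⟩ := h₁.apply_eq_iff_mem_orbit.1 h3
  simp only at hg
  refine ⟨⟨g, ?_⟩, hg⟩
  rw [← hg, hpr.map_smul] at h
  exact eq_one_of_smul_eq h₂ h

theorem map_ker_smul (hpr : IsCoverProjection quot p₁ p₂ pr) (k : quot.ker) (y : M₁) :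
    pr ((k : Γ₁) • y) = pr y := by
  rw [hpr.map_smul, show quot k = 1 from k.2, one_smul]

end IsCoverProjection

end Covers

/-! ### The lifted partition of unity -/

namespace FoldingData

variable {ι Γ₁ Γ₂ M₁ M₂ N : Type*} [Group Γ₁] [Group Γ₂] [TopologicalSpace M₁] [MulAction Γ₁ M₁]
  [TopologicalSpace N] {quot : Γ₁ →* Γ₂} {p₁ : C(M₁, N)} (D : FoldingData ι quot p₁)

/-- The open set `Uᵢᵍ`. -/
def Ug (i : ι) (g : Γ₁) : Set M₁ := {y | g⁻¹ • y ∈ D.Ue i}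

/-- The support of the lift of `φᵢ` to `Uᵢᵉ`. -/
def core (i : ι) : Set M₁ := D.Ue i ∩ p₁ ⁻¹' tsupport (D.φ i)

theorem mem_Ug {i : ι} {g : Γ₁} {y : M₁} : y ∈ D.Ug i g ↔ g⁻¹ • y ∈ D.Ue i := Iff.rfl

theorem bump_of_mem {i : ι} {g : Γ₁} {y : M₁} (h : y ∈ D.Ug i g) :
    D.bump i g y = D.φ i (p₁ y) := Set.indicator_of_mem (s := {y | g⁻¹ • y ∈ D.Ue i}) h _

theorem bump_of_notMem {i : ι} {g : Γ₁} {y : M₁} (h : y ∉ D.Ug i g) : D.bump i g y = 0 :=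
  Set.indicator_of_notMem (s := {y | g⁻¹ • y ∈ D.Ue i}) h _

theorem mem_Ug_of_bump {i : ι} {g : Γ₁} {y : M₁} (h : D.bump i g y ≠ 0) : y ∈ D.Ug i g :=
  not_imp_comm.1 D.bump_of_notMem h

theorem bump_nonneg (i : ι) (g : Γ₁) (y : M₁) : 0 ≤ D.bump i g y :=
  Set.indicator_nonneg (fun _ _ => D.φ.nonneg i _) _

theorem bump_le_one (i : ι) (g : Γ₁) (y : M₁) : D.bump i g y ≤ 1 := by
  by_cases h : y ∈ D.Ug i g
  · rw [D.bump_of_mem h]; exact D.φ.le_one i _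
  · rw [D.bump_of_notMem h]; exact zero_le_one

theorem isOpen_Ug (h₁ : IsQuotientCoveringMap p₁ Γ₁) (i : ι) (g : Γ₁) : IsOpen (D.Ug i g) :=
  (D.isOpen_Ue i).preimage (h₁.continuous_const_smul g⁻¹)

theorem injOn_Ug (h₁ : IsQuotientCoveringMap p₁ Γ₁) (i : ι) (g : Γ₁) : Set.InjOn p₁ (D.Ug i g) := by
  intro y hy y' hy' h
  have := (D.bijOn_Ue i).injOn hy hy' (by rw [h₁.map_smul, h₁.map_smul, h])
  exact smul_left_cancel _ this

/-- The points `g⁻¹ y` and `g'⁻¹ y` of `Uᵢᵉ` lie over the same point, hence coincide; the action is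
free. -/
theorem eq_of_mem_Ug (h₁ : IsQuotientCoveringMap p₁ Γ₁) {i : ι} {g g' : Γ₁} {y : M₁}
    (h : y ∈ D.Ug i g) (h' : y ∈ D.Ug i g') : g = g' := by
  have h3 := (D.bijOn_Ue i).injOn h h' (by rw [h₁.map_smul, h₁.map_smul])
  have := eq_one_of_smul_eq h₁ (g := g * g'⁻¹) (x := y) (by
    rw [mul_smul, ← h3, smul_inv_smul])
  exact mul_inv_eq_one.1 this

theorem smul_mem_Ug {i : ι} {g h : Γ₁} {y : M₁} : h • y ∈ D.Ug i (h * g) ↔ y ∈ D.Ug i g := by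
  rw [mem_Ug, mem_Ug, mul_inv_rev, mul_smul, inv_smul_smul]

theorem bump_smul (h₁ : IsQuotientCoveringMap p₁ Γ₁) (i : ι) (g h : Γ₁) (y : M₁) :
    D.bump i (h * g) (h • y) = D.bump i g y := by
  by_cases hy : y ∈ D.Ug i g
  · rw [D.bump_of_mem hy, D.bump_of_mem (D.smul_mem_Ug.2 hy), h₁.map_smul]
  · rw [D.bump_of_notMem hy, D.bump_of_notMem (mt D.smul_mem_Ug.1 hy)]

theorem smul_mem_core_of_bump (h₁ : IsQuotientCoveringMap p₁ Γ₁) {i : ι} {g : Γ₁} {y : M₁}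
    (h : D.bump i g y ≠ 0) : g⁻¹ • y ∈ D.core i := by
  have hy := D.mem_Ug_of_bump h
  refine ⟨hy, ?_⟩
  rw [Set.mem_preimage, h₁.map_smul]
  refine subset_tsupport _ ?_
  rwa [D.bump_of_mem hy] at h

/-- The covering restricts to a homeomorphism of `Uᵢᵉ` onto `Uᵢ`, and the support of `φᵢ` is a
compact subset of `Uᵢ`. -/
theorem isCompact_core [CompactSpace N] (h₁ : IsQuotientCoveringMap p₁ Γ₁) (i : ι) :
    IsCompact (D.core i) := by
  have ho : IsOpenMap p₁ := h₁.isCoveringMap.isLocalHomeomorph.isOpenMap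
  let f : D.Ue i → N := fun y => p₁ y
  have hf : Topology.IsOpenEmbedding f := by
    refine Topology.IsOpenEmbedding.of_continuous_injective_isOpenMap
      (p₁.continuous.comp continuous_subtype_val)
      (fun a b h => Subtype.ext ((D.bijOn_Ue i).injOn a.2 b.2 h))
      (ho.comp (D.isOpen_Ue i).isOpenMap_subtype_val)
  have h1 : IsCompact (f ⁻¹' tsupport (D.φ i)) := by
    refine hf.isInducing.isCompact_preimage_iff ?_ |>.2 (isClosed_tsupport _).isCompact
    intro x hx
    obtain ⟨y, hy, rfl⟩ := (D.bijOn_Ue i).surjOn (D.isSubordinate i hx)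
    exact ⟨⟨y, hy⟩, rfl⟩
  have h2 : D.core i = Subtype.val '' (f ⁻¹' tsupport (D.φ i)) := by
    ext y
    constructor
    · rintro ⟨h, h'⟩; exact ⟨⟨y, h⟩, h', rfl⟩
    · rintro ⟨z, h, rfl⟩; exact ⟨z.2, h⟩
  rw [h2]
  exact h1.image continuous_subtype_val

/-- Inside `Uᵢᵍ` the function is `φᵢ ∘ p₁`. Extension by zero is continuous because the translate of
the core is closed, being compact, and contained in `Uᵢᵍ`. -/
theorem continuous_bump [T2Space M₁] [CompactSpace N] (h₁ : IsQuotientCoveringMap p₁ Γ₁) (i : ι)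
    (g : Γ₁) : Continuous (D.bump i g) := by
  rw [continuous_iff_continuousAt]
  intro y
  by_cases hy : y ∈ D.Ug i g
  · refine ContinuousAt.congr (f := fun y => D.φ i (p₁ y)) (by fun_prop) ?_
    filter_upwards [(D.isOpen_Ug h₁ i g).mem_nhds hy] with z hz
    exact (D.bump_of_mem hz).symm
  · have hc : IsClosed {z | g⁻¹ • z ∈ D.core i} :=
      (D.isCompact_core h₁ i).isClosed.preimage (h₁.continuous_const_smul g⁻¹)
    refine ContinuousAt.congr (f := fun _ => (0 : ℝ)) continuousAt_const ?_
    filter_upwards [hc.isOpen_compl.mem_nhds (fun h : g⁻¹ • y ∈ D.core i => hy h.1)] with z hz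
    by_contra h
    exact hz (D.smul_mem_core_of_bump h₁ (Ne.symm h))

/-- For each `i` with `φᵢ (p₁ y) ≠ 0` exactly one translate `Uᵢᵍ` contains `y`, so the sum upstairs
is the one on `N`. The finite set is left free, so that it can be chosen uniformly on compact sets.
-/
theorem sum_bump (h₁ : IsQuotientCoveringMap p₁ Γ₁) (y : M₁) (F : Finset (ι × Γ₁))
    (hF : ∀ i g, D.bump i g y ≠ 0 → (i, g) ∈ F) : ∑ p ∈ F, D.bump p.1 p.2 y = 1 := by
  classical
  have := D.finite
  have := Fintype.ofFinite ι
  have h1 : ∑ i, D.φ i (p₁ y) = 1 := by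
    have := D.φ.sum_eq_one (Set.mem_univ (p₁ y))
    rwa [finsum_eq_sum_of_fintype] at this
  rw [← h1, ← Finset.sum_fiberwise_of_maps_to (t := Finset.univ) (g := Prod.fst)
    (fun _ _ => Finset.mem_univ _)]
  refine Finset.sum_congr rfl fun i _ => ?_
  by_cases hi : D.φ i (p₁ y) = 0
  · rw [hi]
    refine Finset.sum_eq_zero fun p hp => ?_
    rw [(Finset.mem_filter.1 hp).2]
    by_cases hy : y ∈ D.Ug i p.2
    · rw [D.bump_of_mem hy, hi]
    · exact D.bump_of_notMem hy
  · obtain ⟨z, hz, hzy⟩ := (D.bijOn_Ue i).surjOn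
      (D.isSubordinate i (subset_tsupport _ hi))
    obtain ⟨g, hg⟩ := h₁.apply_eq_iff_mem_orbit.1 hzy.symm
    simp only at hg
    have hyg : y ∈ D.Ug i g := by rw [mem_Ug, ← hg, inv_smul_smul]; exact hz
    rw [Finset.sum_eq_single (i, g)]
    · exact D.bump_of_mem hyg
    · rintro ⟨j, k⟩ hp hne
      obtain rfl : j = i := (Finset.mem_filter.1 hp).2
      refine D.bump_of_notMem fun h => hne ?_
      exact Prod.ext rfl (D.eq_of_mem_Ug h₁ h hyg)
    · intro hn
      by_contra h
      exact hn (Finset.mem_filter.2 ⟨hF i g h, rfl⟩)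

theorem exists_bump_ne_zero (h₁ : IsQuotientCoveringMap p₁ Γ₁) (y : M₁) :
    ∃ i g, D.bump i g y ≠ 0 := by
  by_contra! h
  have := D.sum_bump h₁ y ∅ fun i g hne => absurd (h i g) hne
  simp at this

/-- The function `φᵢᵍ` as an element of `C₀(M₁)`. -/
def bumpC₀ [T2Space M₁] [CompactSpace N] (h₁ : IsQuotientCoveringMap p₁ Γ₁) (i : ι) (g : Γ₁) :
    C₀(M₁, ℂ) where
  toFun y := (D.bump i g y : ℂ)
  continuous_toFun := Complex.continuous_ofReal.comp (D.continuous_bump h₁ i g)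
  zero_at_infty' := by
    refine HasCompactSupport.is_zero_at_infty (f := fun y => (D.bump i g y : ℂ)) ?_
    have := h₁.continuous_const_smul g
    refine HasCompactSupport.intro ((D.isCompact_core h₁ i).image this) fun y hy => ?_
    by_contra h
    refine hy ⟨g⁻¹ • y, D.smul_mem_core_of_bump h₁ (by simpa using h), by simp⟩

theorem bumpC₀_apply [T2Space M₁] [CompactSpace N] (h₁ : IsQuotientCoveringMap p₁ Γ₁) (i : ι)
    (g : Γ₁) (y : M₁) : D.bumpC₀ h₁ i g y = (D.bump i g y : ℂ) := rfl

end FoldingData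

end

/-! ### Pulling back and pushing forward square integrable sections -/

section

variable {N : Type*} [MetricSpace N] [CompactSpace N]
  {F : Type*} [NormedAddCommGroup F] [NormedSpace ℂ F] [FiniteDimensional ℂ F]
  {E : N → Type*} [∀ x, NormedAddCommGroup (E x)] [∀ x, InnerProductSpace ℂ (E x)]
  [TopologicalSpace (TotalSpace F E)] [FiberBundle F E] [VectorBundle ℂ F E]
  [IsHermitianBundle F E]

/-- The operator on classes induced by a bounded operator on sections. -/
def L2.map {X Y : Type*} [TopologicalSpace X] [MeasurableSpace X] [BorelSpace X]
    [TopologicalSpace Y] [MeasurableSpace Y] [BorelSpace Y] {q : C(X, N)} {μ : Measure X}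
    {q' : C(Y, N)} {μ' : Measure Y} (A : L2Section F E q μ →L[ℂ] L2Section F E q' μ') :
    L2 F E q μ →L[ℂ] L2 F E q' μ' :=
  SeparationQuotient.liftCLM ((SeparationQuotient.mkCLM ℂ _).comp A) fun x y h => by
    exact SeparationQuotient.mk_eq_mk.2 (h.map A.continuous)

theorem L2.map_mk {X Y : Type*} [TopologicalSpace X] [MeasurableSpace X] [BorelSpace X]
    [TopologicalSpace Y] [MeasurableSpace Y] [BorelSpace Y] {q : C(X, N)} {μ : Measure X}
    {q' : C(Y, N)} {μ' : Measure Y} (A : L2Section F E q μ →L[ℂ] L2Section F E q' μ')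
    (s : L2Section F E q μ) :
    L2.map A (SeparationQuotient.mk s) = SeparationQuotient.mk (A s) := rfl

theorem L2Section.norm_le_of_eLpNorm_le {X Y : Type*} [TopologicalSpace X] [MeasurableSpace X]
    [BorelSpace X] [TopologicalSpace Y] [MeasurableSpace Y] [BorelSpace Y] {q : C(X, N)}
    {μ : Measure X} {q' : C(Y, N)} {μ' : Measure Y} {s : L2Section F E q μ}
    {t : L2Section F E q' μ'}
    (h : eLpNorm (fun x => ‖s.val x‖) 2 μ ≤ eLpNorm (fun x => ‖t.val x‖) 2 μ') : ‖s‖ ≤ ‖t‖ := by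
  rw [← L2Section.ofReal_norm, ← L2Section.ofReal_norm] at h
  exact (ENNReal.ofReal_le_ofReal_iff (norm_nonneg _)).1 h

variable {ι Γ₁ Γ₂ M₁ M₂ : Type*} [Group Γ₁] [Group Γ₂]
  [MetricSpace M₁] [MeasurableSpace M₁] [BorelSpace M₁] [MulAction Γ₁ M₁]
  [MetricSpace M₂] [MeasurableSpace M₂] [BorelSpace M₂] [MulAction Γ₂ M₂]
  {quot : Γ₁ →* Γ₂} {p₁ : C(M₁, N)} {p₂ : C(M₂, N)} {pr : C(M₁, M₂)}
  {μ₁ : Measure M₁} {μ₂ : Measure M₂}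

/-- A projection between Galois coverings that locally preserves the measures. -/
structure IsMeasuredCoverProjection (quot : Γ₁ →* Γ₂) (p₁ : C(M₁, N)) (p₂ : C(M₂, N))
    (pr : C(M₁, M₂)) (μ₁ : Measure M₁) (μ₂ : Measure M₂) : Prop
    extends IsCoverProjection quot p₁ p₂ pr where
  cover₁ : IsQuotientCoveringMap p₁ Γ₁
  cover₂ : IsQuotientCoveringMap p₂ Γ₂
  measurePreserving : ∀ U : Set M₁, IsOpen U → Set.InjOn pr U →
    MeasurePreserving pr (μ₁.restrict U) (μ₂.restrict (pr '' U))

namespace FoldingData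

variable (D : FoldingData ι quot p₁)

theorem injOn_proj_Ug (hc : IsMeasuredCoverProjection quot p₁ p₂ pr μ₁ μ₂) (i : ι) (g : Γ₁) :
    Set.InjOn pr (D.Ug i g) := fun y hy y' hy' h =>
  D.injOn_Ug hc.cover₁ i g hy hy' (by rw [← hc.map_proj, h, hc.map_proj])

theorem measurePreserving_Ug (hc : IsMeasuredCoverProjection quot p₁ p₂ pr μ₁ μ₂) (i : ι) (g : Γ₁) :
    MeasurePreserving pr (μ₁.restrict (D.Ug i g)) (μ₂.restrict (pr '' D.Ug i g)) :=
  hc.measurePreserving _ (D.isOpen_Ug hc.cover₁ i g) (D.injOn_proj_Ug hc i g)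

theorem isOpenMap_proj (hc : IsMeasuredCoverProjection quot p₁ p₂ pr μ₁ μ₂) : IsOpenMap pr :=
  (hc.isLocalHomeomorph hc.cover₁ hc.cover₂).isOpenMap

theorem isOpen_image_Ug (hc : IsMeasuredCoverProjection quot p₁ p₂ pr μ₁ μ₂) (i : ι) (g : Γ₁) :
    IsOpen (pr '' D.Ug i g) :=
  isOpenMap_proj hc _ (D.isOpen_Ug hc.cover₁ i g)

/-- The section `y ↦ φⱼᵍ(y) u(pr y)` of `E₁`. -/
def pullFun (hpr : IsCoverProjection quot p₁ p₂ pr) (j : ι) (g : Γ₁) (u : ∀ x, E (p₂ x)) (y : M₁) :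
    E (p₁ y) :=
  (D.bump j g y : ℂ) • fiberCast (hpr.map_proj y) (u (pr y))

/-- The section of `E₂` over `pr(Uᵢᵍ)` that corresponds to `φᵢᵍ v`. -/
def pushFun (hpr : IsCoverProjection quot p₁ p₂ pr) (i : ι) (g : Γ₁) (v : ∀ y, E (p₁ y)) (x : M₂) :
    E (p₂ x) :=
  ∑ᶠ y : {y : M₁ // pr y = x},
    (D.bump i g y : ℂ) • fiberCast (((hpr.map_proj y).symm.trans (congrArg p₂ y.2))) (v y)

/-- Injectivity of the projection on `Uᵢᵍ` leaves a single point of the fibre in the sum. -/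
theorem pushFun_proj (hc : IsMeasuredCoverProjection quot p₁ p₂ pr μ₁ μ₂) (i : ι) (g : Γ₁)
    (v : ∀ y, E (p₁ y)) {y : M₁} (hy : y ∈ D.Ug i g) :
    D.pushFun hc.toIsCoverProjection i g v (pr y)
      = (D.bump i g y : ℂ) • fiberCast (hc.map_proj y).symm (v y) := by
  rw [pushFun, finsum_eq_single _ (⟨y, rfl⟩ : {z : M₁ // pr z = pr y})]
  rintro ⟨z, hz⟩ hne
  have : D.bump i g z = 0 := D.bump_of_notMem fun hz' =>
    hne (Subtype.ext (D.injOn_proj_Ug hc i g hz' hy hz))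
  simp [this]

theorem pushFun_of_notMem (hpr : IsCoverProjection quot p₁ p₂ pr) (i : ι) (g : Γ₁)
    (v : ∀ y, E (p₁ y)) {x : M₂} (hx : x ∉ pr '' D.Ug i g) : D.pushFun hpr i g v x = 0 := by
  rw [pushFun]
  refine finsum_eq_zero_of_forall_eq_zero ?_
  rintro ⟨y, rfl⟩
  rw [D.bump_of_notMem fun hy => hx ⟨y, hy, rfl⟩]
  simp

theorem norm_pullFun (hpr : IsCoverProjection quot p₁ p₂ pr) (j : ι) (g : Γ₁) (u : ∀ x, E (p₂ x))
    (y : M₁) : ‖D.pullFun hpr j g u y‖ = D.bump j g y * ‖u (pr y)‖ := by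
  rw [pullFun, norm_smul, LinearIsometryEquiv.norm_map, Complex.norm_real,
    Real.norm_of_nonneg (D.bump_nonneg _ _ _)]

theorem norm_pushFun_proj (hc : IsMeasuredCoverProjection quot p₁ p₂ pr μ₁ μ₂) (i : ι) (g : Γ₁)
    (v : ∀ y, E (p₁ y)) {y : M₁} (hy : y ∈ D.Ug i g) :
    ‖D.pushFun hc.toIsCoverProjection i g v (pr y)‖ = D.bump i g y * ‖v y‖ := by
  rw [D.pushFun_proj hc i g v hy, norm_smul, LinearIsometryEquiv.norm_map, Complex.norm_real,
    Real.norm_of_nonneg (D.bump_nonneg _ _ _)]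

theorem isMeasurableSection_pullFun (hc : IsMeasuredCoverProjection quot p₁ p₂ pr μ₁ μ₂) (j : ι)
    (g : Γ₁) {u : ∀ x, E (p₂ x)} (hu : IsMeasurableSection F E p₂ u) :
    IsMeasurableSection F E p₁ (D.pullFun hc.toIsCoverProjection j g u) := by
  intro b
  simp only [pullFun, map_smul, linearMapAt_fiberCast]
  exact (D.bumpC₀ hc.cover₁ j g).continuous.stronglyMeasurable.smul
    ((hu b).comp_measurable pr.continuous.measurable)

theorem isMeasurableSection_pushFun (hc : IsMeasuredCoverProjection quot p₁ p₂ pr μ₁ μ₂) (i : ι)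
    (g : Γ₁) {v : ∀ y, E (p₁ y)} (hv : IsMeasurableSection F E p₁ v) :
    IsMeasurableSection F E p₂ (D.pushFun hc.toIsCoverProjection i g v) := by
  classical
  intro b
  -- A point of `M₁` is needed as a default value for the inverse of the projection off the image of
  -- `Uᵢᵍ`.
  rcases isEmpty_or_nonempty M₁ with hM | hM
  · have : IsEmpty M₂ := (hc.proj_surjective hc.cover₁ hc.cover₂).isEmpty
    rw [show (fun x => (trivializationAt F E b).linearMapAt ℂ (p₂ x)
      (D.pushFun hc.toIsCoverProjection i g v x)) = fun _ => 0 from funext fun x => isEmptyElim x]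
    exact stronglyMeasurable_const
  set U := D.Ug i g with hU
  let y₀ : M₁ := Classical.arbitrary M₁
  -- The inverse of the projection is continuous on the open image of `Uᵢᵍ`, so its extension by a
  -- constant is Borel, and the pushforward is a composition with it cut off to the image.
  let τ : M₂ → M₁ := (pr '' U).piecewise (Function.invFunOn pr U) fun _ => y₀
  have hleft : Set.LeftInvOn (Function.invFunOn pr U) pr U :=
    (D.injOn_proj_Ug hc i g).leftInvOn_invFunOn
  have hτ : Measurable τ := by
    refine ContinuousOn.measurable_piecewise ?_ continuousOn_const
      (D.isOpen_image_Ug hc i g).measurableSet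
    refine IsOpenMap.continuousOn_image_of_leftInvOn ?_ hleft
    exact (isOpenMap_proj hc).domRestrict (D.isOpen_Ug hc.cover₁ i g)
  set w : M₁ → F := fun y => (D.bump i g y : ℂ) •
    (trivializationAt F E b).linearMapAt ℂ (p₁ y) (v y) with hw
  have hwm : StronglyMeasurable w :=
    (D.bumpC₀ hc.cover₁ i g).continuous.stronglyMeasurable.smul (hv b)
  have : (fun x => (trivializationAt F E b).linearMapAt ℂ (p₂ x)
      (D.pushFun hc.toIsCoverProjection i g v x)) = (pr '' U).indicator (w ∘ τ) := by
    ext x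
    by_cases hx : x ∈ pr '' U
    · rw [Set.indicator_of_mem hx]
      obtain ⟨y, hy, rfl⟩ := hx
      have hτy : τ (pr y) = y := by
        simp only [τ]
        rw [Set.piecewise_eq_of_mem _ _ _ (Set.mem_image_of_mem pr hy)]
        exact hleft hy
      rw [Function.comp_apply, hτy, D.pushFun_proj hc i g v hy, map_smul, linearMapAt_fiberCast]
    · rw [Set.indicator_of_notMem hx, D.pushFun_of_notMem _ i g v hx, map_zero]
  rw [this]
  exact (hwm.comp_measurable hτ).indicator (D.isOpen_image_Ug hc i g).measurableSet

/-- The cut-off is at most `1` and the projection preserves measure on `Uᵢᵍ`; without the cut-off,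
each fibre would be counted repeatedly. -/
theorem eLpNorm_pullFun_le (hc : IsMeasuredCoverProjection quot p₁ p₂ pr μ₁ μ₂) (j : ι)
    (g : Γ₁) {u : ∀ x, E (p₂ x)} (hu : IsMeasurableSection F E p₂ u) :
    eLpNorm (fun y => ‖D.pullFun hc.toIsCoverProjection j g u y‖) 2 μ₁ ≤
      eLpNorm (fun x => ‖u x‖) 2 μ₂ := by
  have h1 : ∀ y, ‖‖D.pullFun hc.toIsCoverProjection j g u y‖‖ ≤
      ‖(D.Ug j g).indicator (fun y => ‖u (pr y)‖) y‖ := by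
    intro y
    rw [norm_norm, D.norm_pullFun]
    by_cases hy : y ∈ D.Ug j g
    · rw [Set.indicator_of_mem hy, norm_norm]
      exact mul_le_of_le_one_left (norm_nonneg _) (D.bump_le_one _ _ _)
    · rw [D.bump_of_notMem hy, zero_mul]
      exact norm_nonneg _
  refine (eLpNorm_mono h1).trans ?_
  rw [eLpNorm_indicator_eq_eLpNorm_restrict (D.isOpen_Ug hc.cover₁ j g).measurableSet]
  rw [show (fun y => ‖u (pr y)‖) = (fun x => ‖u x‖) ∘ pr from rfl,
    eLpNorm_comp_measurePreserving hu.norm.aestronglyMeasurable (D.measurePreserving_Ug hc j g)]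
  exact eLpNorm_mono_measure _ Measure.restrict_le_self

theorem eLpNorm_pushFun_le (hc : IsMeasuredCoverProjection quot p₁ p₂ pr μ₁ μ₂) (i : ι)
    (g : Γ₁) {v : ∀ y, E (p₁ y)} (hv : IsMeasurableSection F E p₁ v) :
    eLpNorm (fun x => ‖D.pushFun hc.toIsCoverProjection i g v x‖) 2 μ₂ ≤
      eLpNorm (fun y => ‖v y‖) 2 μ₁ := by
  have hm := (D.isMeasurableSection_pushFun hc i g hv).norm
  have h1 : (fun x => ‖D.pushFun hc.toIsCoverProjection i g v x‖) =
      (pr '' D.Ug i g).indicator fun x => ‖D.pushFun hc.toIsCoverProjection i g v x‖ := by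
    ext x
    by_cases hx : x ∈ pr '' D.Ug i g
    · rw [Set.indicator_of_mem hx]
    · rw [Set.indicator_of_notMem hx, D.pushFun_of_notMem _ i g v hx, norm_zero]
  rw [h1, eLpNorm_indicator_eq_eLpNorm_restrict (D.isOpen_image_Ug hc i g).measurableSet,
    ← eLpNorm_comp_measurePreserving hm.aestronglyMeasurable (D.measurePreserving_Ug hc i g)]
  refine (eLpNorm_mono_ae (g := fun y => ‖v y‖) ?_).trans
    (eLpNorm_mono_measure _ Measure.restrict_le_self)
  filter_upwards [ae_restrict_mem (D.isOpen_Ug hc.cover₁ i g).measurableSet] with y hy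
  rw [Function.comp_apply, norm_norm, norm_norm, D.norm_pushFun_proj hc i g v hy]
  exact mul_le_of_le_one_left (norm_nonneg _) (D.bump_le_one _ _ _)

theorem isSquareIntegrable_pullFun (hc : IsMeasuredCoverProjection quot p₁ p₂ pr μ₁ μ₂) (j : ι)
    (g : Γ₁) {u : ∀ x, E (p₂ x)} (hu : IsSquareIntegrable F E p₂ μ₂ u) :
    IsSquareIntegrable F E p₁ μ₁ (D.pullFun hc.toIsCoverProjection j g u) :=
  ⟨D.isMeasurableSection_pullFun hc j g hu.1,
    (D.isMeasurableSection_pullFun hc j g hu.1).norm.aestronglyMeasurable,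
    (D.eLpNorm_pullFun_le hc j g hu.1).trans_lt hu.2.2⟩

theorem isSquareIntegrable_pushFun (hc : IsMeasuredCoverProjection quot p₁ p₂ pr μ₁ μ₂) (i : ι)
    (g : Γ₁) {v : ∀ y, E (p₁ y)} (hv : IsSquareIntegrable F E p₁ μ₁ v) :
    IsSquareIntegrable F E p₂ μ₂ (D.pushFun hc.toIsCoverProjection i g v) :=
  ⟨D.isMeasurableSection_pushFun hc i g hv.1,
    (D.isMeasurableSection_pushFun hc i g hv.1).norm.aestronglyMeasurable,
    (D.eLpNorm_pushFun_le hc i g hv.1).trans_lt hv.2.2⟩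

theorem pushFun_add (hc : IsMeasuredCoverProjection quot p₁ p₂ pr μ₁ μ₂) (i : ι) (g : Γ₁)
    (v w : ∀ y, E (p₁ y)) (x : M₂) : D.pushFun hc.toIsCoverProjection i g (v + w) x =
      D.pushFun hc.toIsCoverProjection i g v x + D.pushFun hc.toIsCoverProjection i g w x := by
  by_cases hx : x ∈ pr '' D.Ug i g
  · obtain ⟨y, hy, rfl⟩ := hx
    simp only [D.pushFun_proj hc i g _ hy, Pi.add_apply, map_add, smul_add]
  · simp only [D.pushFun_of_notMem _ i g _ hx, add_zero]

theorem pushFun_smul (hc : IsMeasuredCoverProjection quot p₁ p₂ pr μ₁ μ₂) (i : ι) (g : Γ₁)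
    (c : ℂ) (v : ∀ y, E (p₁ y)) (x : M₂) : D.pushFun hc.toIsCoverProjection i g (c • v) x =
      c • D.pushFun hc.toIsCoverProjection i g v x := by
  by_cases hx : x ∈ pr '' D.Ug i g
  · obtain ⟨y, hy, rfl⟩ := hx
    simp only [D.pushFun_proj hc i g _ hy, Pi.smul_apply, map_smul, smul_comm c]
  · simp only [D.pushFun_of_notMem _ i g _ hx, smul_zero]

/-- The operator `u ↦ φⱼᵍ u` from sections of `E₂` to sections of `E₁`. -/
def pullSection (hc : IsMeasuredCoverProjection quot p₁ p₂ pr μ₁ μ₂) (j : ι) (g : Γ₁) :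
    L2Section F E p₂ μ₂ →L[ℂ] L2Section F E p₁ μ₁ :=
  LinearMap.mkContinuous
    { toFun := fun u => L2Section.mk _ (D.isSquareIntegrable_pullFun hc j g u.prop)
      map_add' := fun u v => by ext y; simp [pullFun]
      map_smul' := fun c u => by ext y; simp [pullFun, smul_comm c] }
    1 fun u => by
      rw [one_mul]
      exact L2Section.norm_le_of_eLpNorm_le (D.eLpNorm_pullFun_le hc j g u.prop.1)

/-- The operator `v ↦ pr_*(φᵢᵍ v)` from sections of `E₁` to sections of `E₂`. -/
def pushSection (hc : IsMeasuredCoverProjection quot p₁ p₂ pr μ₁ μ₂) (i : ι) (g : Γ₁) :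
    L2Section F E p₁ μ₁ →L[ℂ] L2Section F E p₂ μ₂ :=
  LinearMap.mkContinuous
    { toFun := fun v => L2Section.mk _ (D.isSquareIntegrable_pushFun hc i g v.prop)
      map_add' := fun u v => by
        ext x
        exact D.pushFun_add hc i g _ _ x
      map_smul' := fun c v => by
        ext x
        exact D.pushFun_smul hc i g c _ x }
    1 fun v => by
      rw [one_mul]
      exact L2Section.norm_le_of_eLpNorm_le (D.eLpNorm_pushFun_le hc i g v.prop.1)

theorem pullSection_val (hc : IsMeasuredCoverProjection quot p₁ p₂ pr μ₁ μ₂) (j : ι) (g : Γ₁)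
    (u : L2Section F E p₂ μ₂) (y : M₁) : (D.pullSection hc j g u).val y
      = (D.bump j g y : ℂ) • fiberCast (hc.map_proj y) (u.val (pr y)) := rfl

theorem pushSection_val (hc : IsMeasuredCoverProjection quot p₁ p₂ pr μ₁ μ₂) (i : ι) (g : Γ₁)
    (v : L2Section F E p₁ μ₁) (x : M₂) : (D.pushSection hc i g v).val x
      = D.pushFun hc.toIsCoverProjection i g v.val x := rfl

/-- Although `pull` is computed from a chosen representative, the result is square integrable, so it
agrees with the bounded operator induced on classes. -/
theorem pull_eq_map (hc : IsMeasuredCoverProjection quot p₁ p₂ pr μ₁ μ₂) (j : ι) (g : Γ₁)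
    (u : L2 F E p₂ μ₂) :
    D.pull hc.toIsCoverProjection j g u = L2.map (D.pullSection hc j g) u := by
  have h : L2.map (D.pullSection hc j g) u =
      L2.map (D.pullSection hc j g) (SeparationQuotient.mk (Quotient.out u)) :=
    congrArg _ (Quotient.out_eq u).symm
  rw [h, L2.map_mk]
  exact dif_pos (D.isSquareIntegrable_pullFun hc j g (Quotient.out u : L2Section F E p₂ μ₂).prop)

theorem push_eq_map (hc : IsMeasuredCoverProjection quot p₁ p₂ pr μ₁ μ₂) (i : ι) (g : Γ₁)
    (v : L2 F E p₁ μ₁) :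
    D.push hc.toIsCoverProjection i g v = L2.map (D.pushSection hc i g) v := by
  have h : L2.map (D.pushSection hc i g) v =
      L2.map (D.pushSection hc i g) (SeparationQuotient.mk (Quotient.out v)) :=
    congrArg _ (Quotient.out_eq v).symm
  rw [h, L2.map_mk]
  exact dif_pos (D.isSquareIntegrable_pushFun hc i g (Quotient.out v : L2Section F E p₁ μ₁).prop)

theorem fiberCast_inner {a b : N} (h : a = b) (v : E a) (w : E b) :
    ⟪fiberCast h v, w⟫_ℂ = ⟪v, fiberCast h.symm w⟫_ℂ := by
  subst h; rfl

/-- Both integrals live on a single sheet, over `pr(Uᵢᵍ)` and `Uᵢᵍ`, and agree by the change of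
variables along the projection. -/
theorem inner_pushSection (hc : IsMeasuredCoverProjection quot p₁ p₂ pr μ₁ μ₂) (i : ι) (g : Γ₁)
    (v : L2Section F E p₁ μ₁) (u : L2Section F E p₂ μ₂) :
    ⟪D.pushSection hc i g v, u⟫_ℂ = ⟪v, D.pullSection hc i g u⟫_ℂ := by
  rw [L2Section.inner_def, L2Section.inner_def,
    ← setIntegral_eq_integral_of_forall_compl_eq_zero (s := pr '' D.Ug i g),
    ← setIntegral_eq_integral_of_forall_compl_eq_zero (s := D.Ug i g)
      (f := fun y => ⟪v.val y, (D.pullSection hc i g u).val y⟫_ℂ),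
    ← (D.measurePreserving_Ug hc i g).map_eq, integral_map]
  · refine setIntegral_congr_fun (D.isOpen_Ug hc.cover₁ i g).measurableSet fun y hy => ?_
    rw [pushSection_val, D.pushFun_proj hc i g _ hy, pullSection_val, inner_smul_left,
      inner_smul_right, Complex.conj_ofReal, fiberCast_inner]
  · exact (D.measurePreserving_Ug hc i g).measurable.aemeasurable
  · rw [(D.measurePreserving_Ug hc i g).map_eq]
    exact (L2Section.integrable_inner _ _).aestronglyMeasurable.restrict
  · intro y hy
    rw [pullSection_val, D.bump_of_notMem hy]
    simp
  · intro x hx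
    rw [pushSection_val, D.pushFun_of_notMem _ i g _ hx, inner_zero_left]

theorem adjoint_map_pushSection (hc : IsMeasuredCoverProjection quot p₁ p₂ pr μ₁ μ₂) (i : ι)
    (g : Γ₁) : (L2.map (F := F) (E := E) (D.pushSection hc i g)).adjoint =
      L2.map (D.pullSection hc i g) := by
  symm
  rw [ContinuousLinearMap.eq_adjoint_iff]
  intro u v
  obtain ⟨s, rfl⟩ := SeparationQuotient.surjective_mk u
  obtain ⟨t, rfl⟩ := SeparationQuotient.surjective_mk v
  rw [L2.map_mk, L2.map_mk, SeparationQuotient.inner_mk_mk, SeparationQuotient.inner_mk_mk,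
    ← inner_conj_symm, ← D.inner_pushSection, inner_conj_symm]

end FoldingData

end

/-! ### Local finiteness, equivariance and the composite of push and pull -/

section

theorem EquivariantModule.norm_rep_apply_le {X G H : Type*} [MetricSpace X] [Group G]
    [MulAction G X] [NormedAddCommGroup H] [InnerProductSpace ℂ H] [CompleteSpace H]
    (A : EquivariantModule X G H) {f : C₀(X, ℂ)} (hf : ∀ x, ‖f x‖ ≤ 1) (v : H) :
    ‖A.rep f v‖ ≤ ‖v‖ := by
  have h1 : ‖f‖ ≤ 1 := by
    rw [← ZeroAtInftyContinuousMap.norm_toBCF_eq_norm]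
    exact (BoundedContinuousFunction.norm_le zero_le_one).2 hf
  exact ((A.rep f).le_opNorm v).trans (mul_le_of_le_one_left (norm_nonneg _)
    ((NonUnitalStarAlgHom.norm_apply_le A.rep f).trans h1))

theorem EquivariantModule.eq_zero_of_rep {X G H : Type*} [MetricSpace X] [LocallyCompactSpace X]
    [Group G] [MulAction G X] [NormedAddCommGroup H] [InnerProductSpace ℂ H] [CompleteSpace H]
    (A : EquivariantModule X G H) {v : H}
    (h : ∀ f : C₀(X, ℂ), HasCompactSupport f → A.rep f v = 0) : v = 0 := by
  have := closure_minimal (t := {0}) ?_ isClosed_singleton (A.mem_closure_rep v)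
  · exact this
  · rintro _ ⟨f, hf, rfl⟩
    exact h f hf

variable {N : Type*} [MetricSpace N] [CompactSpace N]
  {F : Type*} [NormedAddCommGroup F] [NormedSpace ℂ F] [FiniteDimensional ℂ F]
  {E : N → Type*} [∀ x, NormedAddCommGroup (E x)] [∀ x, InnerProductSpace ℂ (E x)]
  [TopologicalSpace (TotalSpace F E)] [FiberBundle F E] [VectorBundle ℂ F E]
  [IsHermitianBundle F E]

variable {ι Γ₁ Γ₂ M₁ M₂ : Type*} [Group Γ₁] [Group Γ₂]
  [MetricSpace M₁] [MeasurableSpace M₁] [BorelSpace M₁] [MulAction Γ₁ M₁]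
  [MetricSpace M₂] [MeasurableSpace M₂] [BorelSpace M₂] [MulAction Γ₂ M₂]
  {quot : Γ₁ →* Γ₂} {p₁ : C(M₁, N)} {p₂ : C(M₂, N)} {pr : C(M₁, M₂)}
  {μ₁ : Measure M₁} {μ₂ : Measure M₂}

namespace FoldingData

variable (D : FoldingData ι quot p₁)

/-- Proper discontinuity, applied to the compact cores and `K`, for each of the finitely many `i`.
-/
theorem finite_bump_meets [LocallyCompactSpace M₁] (h₁ : IsQuotientCoveringMap p₁ Γ₁) {K : Set M₁}
    (hK : IsCompact K) : {p : ι × Γ₁ | ∃ y ∈ K, D.bump p.1 p.2 y ≠ 0}.Finite := by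
  have := D.finite
  have h2 : ∀ i, {g : Γ₁ | ∃ x ∈ D.core i, g • x ∈ K}.Finite := fun i =>
    finite_smul_inter_nonempty h₁ (D.isCompact_core h₁ i) hK
  refine (Set.Finite.biUnion (Set.finite_univ (α := ι)) fun i _ =>
    (h2 i).image (Prod.mk i)).subset ?_
  rintro ⟨i, g⟩ ⟨y, hy, hne⟩
  exact Set.mem_biUnion (Set.mem_univ i) ⟨g, ⟨g⁻¹ • y, D.smul_mem_core_of_bump h₁ hne, by
    simpa using hy⟩, rfl⟩

theorem exists_finset_bump [LocallyCompactSpace M₁] (h₁ : IsQuotientCoveringMap p₁ Γ₁)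
    {f : C₀(M₁, ℂ)} (hf : HasCompactSupport f) : ∃ s : Finset (ι × Γ₁),
      (∀ p ∉ s, D.bumpC₀ h₁ p.1 p.2 * f = 0) ∧ ∑ p ∈ s, D.bumpC₀ h₁ p.1 p.2 * f = f := by
  refine ⟨(D.finite_bump_meets h₁ hf).toFinset, fun p hp => ?_, ?_⟩
  · ext y
    simp only [Set.Finite.mem_toFinset, Set.mem_ofPred_eq, not_exists, not_and, not_not] at hp
    by_cases hy : y ∈ tsupport f
    · simp [bumpC₀_apply, hp y hy]
    · simp [image_eq_zero_of_notMem_tsupport hy]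
  · ext y
    rw [← Finset.sum_mul, ZeroAtInftyContinuousMap.mul_apply]
    by_cases hy : y ∈ tsupport f
    · have h2 := D.sum_bump h₁ y (D.finite_bump_meets h₁ hf).toFinset
        fun i g h => (Set.Finite.mem_toFinset _).2 ⟨y, hy, h⟩
      have h3 : (∑ p ∈ (D.finite_bump_meets h₁ hf).toFinset, D.bumpC₀ h₁ p.1 p.2) y
          = ∑ p ∈ (D.finite_bump_meets h₁ hf).toFinset, D.bumpC₀ h₁ p.1 p.2 y :=
        map_sum (⟨⟨fun f : C₀(M₁, ℂ) => f y, rfl⟩, fun _ _ => rfl⟩ : C₀(M₁, ℂ) →+ ℂ) _ _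
      rw [h3]
      simp only [bumpC₀_apply, ← Complex.ofReal_sum, h2, Complex.ofReal_one, one_mul]
    · rw [image_eq_zero_of_notMem_tsupport hy, mul_zero]

theorem bumpC₀_mul_eq_zero (h₁ : IsQuotientCoveringMap p₁ Γ₁) (i : ι) {g g' : Γ₁} (h : g ≠ g') :
    D.bumpC₀ h₁ i g * D.bumpC₀ h₁ i g' = 0 := by
  ext y
  by_contra hne
  simp only [ZeroAtInftyContinuousMap.mul_apply, bumpC₀_apply, ZeroAtInftyContinuousMap.zero_apply,
    mul_eq_zero, Complex.ofReal_eq_zero, not_or] at hne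
  exact h (D.eq_of_mem_Ug h₁ (D.mem_Ug_of_bump hne.1) (D.mem_Ug_of_bump hne.2))

theorem star_bumpC₀ (h₁ : IsQuotientCoveringMap p₁ Γ₁) (i : ι) (g : Γ₁) :
    star (D.bumpC₀ h₁ i g) = D.bumpC₀ h₁ i g := by
  ext y
  rw [ZeroAtInftyContinuousMap.star_apply, bumpC₀_apply]
  exact Complex.conj_ofReal _

theorem norm_bumpC₀_le (h₁ : IsQuotientCoveringMap p₁ Γ₁) (i : ι) (g : Γ₁) (y : M₁) :
    ‖D.bumpC₀ h₁ i g y‖ ≤ 1 := by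
  rw [bumpC₀_apply, Complex.norm_real, Real.norm_of_nonneg (D.bump_nonneg _ _ _)]
  exact D.bump_le_one _ _ _

theorem finite_bump_mul_bump [LocallyCompactSpace M₁] (h₁ : IsQuotientCoveringMap p₁ Γ₁) (i j : ι)
    (g : Γ₁) : {k : Γ₁ | ∃ y, D.bump i g y ≠ 0 ∧ D.bump j k y ≠ 0}.Finite := by
  refine ((D.finite_bump_meets h₁ (K := (g • ·) '' D.core i)
    ((D.isCompact_core h₁ i).image (h₁.continuous_const_smul g))).preimage
    (f := Prod.mk j) (Prod.mk_right_injective j).injOn).subset ?_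
  rintro k ⟨y, h, h'⟩
  exact ⟨y, ⟨g⁻¹ • y, D.smul_mem_core_of_bump h₁ h, by simp⟩, h'⟩

section Equivariance

variable [MeasurableConstSMul Γ₁ M₁] [SMulInvariantMeasure Γ₁ M₁ μ₁]
  [MeasurableConstSMul Γ₂ M₂] [SMulInvariantMeasure Γ₂ M₂ μ₂]

theorem actSection_pushSection (hc : IsMeasuredCoverProjection quot p₁ p₂ pr μ₁ μ₂)
    (hq₁ : ∀ (g : Γ₁) (x : M₁), p₁ (g • x) = p₁ x) (hq₂ : ∀ (g : Γ₂) (x : M₂), p₂ (g • x) = p₂ x)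
    (h : Γ₁) (i : ι) (g : Γ₁) (v : L2Section F E p₁ μ₁) :
    actSection hq₂ (quot h) (D.pushSection hc i g v)
      = D.pushSection hc i (h * g) (actSection hq₁ h v) := by
  ext x
  rw [actSection_val, pushSection_val, pushSection_val]
  by_cases hx : x ∈ pr '' D.Ug i (h * g)
  · obtain ⟨y, hy, rfl⟩ := hx
    have hy' : h⁻¹ • y ∈ D.Ug i g := by
      rw [← D.smul_mem_Ug (h := h), smul_inv_smul]; exact hy
    have e : pr (h⁻¹ • y) = (quot h)⁻¹ • pr y := by rw [hc.map_smul, map_inv]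
    rw [← fiberCast_eq (D.pushFun hc.toIsCoverProjection i g v.val) e (congrArg p₂ e),
      D.pushFun_proj hc i g _ hy', D.pushFun_proj hc i _ _ hy, actSection_val]
    have hb : D.bump i (h * g) y = D.bump i g (h⁻¹ • y) := by
      rw [← D.bump_smul hc.cover₁ i g h, smul_inv_smul]
    simp only [_root_.map_smul, fiberCast_trans, hb]
  · rw [D.pushFun_of_notMem _ i _ _ hx, D.pushFun_of_notMem, map_zero]
    rintro ⟨y, hy, hyx⟩
    refine hx ⟨h • y, D.smul_mem_Ug.2 hy, ?_⟩
    rw [hc.map_smul, hyx, smul_inv_smul]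

/-- If the fibre of `y` meets `Uⱼᵏ`, it does so in a single point `h⁻¹ y` with `h` in the kernel,
and only that `h` contributes. The finite set may be larger, so that one set can serve for all `y`.
-/
theorem pull_push_apply (hc : IsMeasuredCoverProjection quot p₁ p₂ pr μ₁ μ₂)
    (hq₁ : ∀ (g : Γ₁) (x : M₁), p₁ (g • x) = p₁ x) (i : ι) (g : Γ₁) (j : ι) (k : Γ₁)
    (v : L2Section F E p₁ μ₁) (y : M₁) (s : Finset quot.ker)
    (hs : ∀ h : quot.ker, D.bump i g y ≠ 0 → D.bump j k ((h : Γ₁)⁻¹ • y) ≠ 0 → h ∈ s) :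
    (D.pullSection hc i g (D.pushSection hc j k v)).val y =
      ∑ h ∈ s, (mulSection (D.bumpC₀ hc.cover₁ i g)
        (actSection hq₁ (h : Γ₁) (mulSection (D.bumpC₀ hc.cover₁ j k) v))).val y := by
  rw [pullSection_val, pushSection_val]
  simp only [mulSection_val, actSection_val, bumpC₀_apply]
  by_cases hy : D.bump i g y = 0
  · simp [hy]
  by_cases hx : pr y ∈ pr '' D.Ug j k
  · obtain ⟨y', hy', e⟩ := hx
    obtain ⟨h, rfl⟩ := hc.exists_ker_smul_eq hc.cover₁ hc.cover₂ e.symm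
    rw [← fiberCast_eq (D.pushFun hc.toIsCoverProjection j k v.val) e (congrArg p₂ e),
      D.pushFun_proj hc j k _ hy', Finset.sum_eq_single h]
    · rw [← fiberCast_eq (f := p₁) (fun z => (D.bump j k z : ℂ) • v.val z)
        (inv_smul_smul (h : Γ₁) y').symm (by rw [inv_smul_smul])]
      simp only [map_smul, fiberCast_trans]
    · intro h' _ hne
      rw [D.bump_of_notMem (i := j) (g := k), Complex.ofReal_zero, zero_smul, map_zero, smul_zero]
      intro hmem
      have e2 : (h' : Γ₁)⁻¹ • (h : Γ₁) • y' = y' := by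
        refine D.injOn_proj_Ug hc j k hmem hy' ?_
        rw [hc.map_smul, map_inv, show quot h' = 1 from h'.2, inv_one, one_smul,
          hc.map_ker_smul]
      rw [← mul_smul] at e2
      have := eq_one_of_smul_eq hc.cover₁ e2
      exact hne (Subtype.ext (inv_mul_eq_one.1 this))
    · intro hns
      have := not_imp_comm.1 (hs h hy) hns
      rw [this, Complex.ofReal_zero, zero_smul, map_zero, smul_zero]
  · rw [D.pushFun_of_notMem _ j k _ hx, map_zero, smul_zero]
    refine (Finset.sum_eq_zero fun h _ => ?_).symm
    rw [D.bump_of_notMem (i := j) (g := k), Complex.ofReal_zero, zero_smul, map_zero, smul_zero]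
    intro hmem
    refine hx ⟨_, hmem, ?_⟩
    rw [hc.map_smul, map_inv, show quot h = 1 from h.2, inv_one, one_smul]

/-- The images of the sets where some φᵢᵍ is nonzero form an open cover of `M₂`. On each of them `u`
vanishes almost everywhere because the projection preserves measure there, and in a second countable
space locally null sets are null. -/
theorem eq_zero_of_pull (hc : IsMeasuredCoverProjection quot p₁ p₂ pr μ₁ μ₂)
    [SecondCountableTopology M₂] (u : L2 F E p₂ μ₂)
    (hu : ∀ i g, L2.map (D.pullSection hc i g) u = 0) : u = 0 := by
  obtain ⟨s, rfl⟩ := SeparationQuotient.surjective_mk u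
  have hs : ∀ i g, ∀ᵐ y ∂μ₁, (D.pullSection hc i g s).val y = 0 := fun i g =>
    L2.mk_eq_mk_iff.1 (show _ = SeparationQuotient.mk (0 : L2Section F E p₁ μ₁) from hu i g)
  change _ = SeparationQuotient.mk (0 : L2Section F E p₂ μ₂)
  rw [L2.mk_eq_mk_iff]
  rw [ae_iff]
  refine measure_null_of_locally_null _ fun x _ => ?_
  obtain ⟨y, rfl⟩ := hc.proj_surjective hc.cover₁ hc.cover₂ x
  obtain ⟨i, g, hy⟩ := D.exists_bump_ne_zero hc.cover₁ y
  set U := {z | D.bump i g z ≠ 0} with hU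
  have hUo : IsOpen U := isOpen_ne_fun (D.continuous_bump hc.cover₁ i g) continuous_const
  have hUi : Set.InjOn pr U := (D.injOn_proj_Ug hc i g).mono fun z hz => D.mem_Ug_of_bump hz
  have hVo : IsOpen (pr '' U) := isOpenMap_proj hc _ hUo
  set B : Set M₂ := {x | s.val x ≠ 0} with hB
  have hBm : MeasurableSet B := by
    have : B = {x | ‖s.val x‖ ≠ 0} := by ext x; simp [hB]
    rw [this]
    exact (s.prop.1.norm (measurableSet_singleton 0)).compl
  refine ⟨B ∩ pr '' U, ?_, ?_⟩
  · exact Filter.inter_mem self_mem_nhdsWithin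
      (mem_nhdsWithin_of_mem_nhds (hVo.mem_nhds ⟨y, hy, rfl⟩))
  · rw [← Measure.restrict_apply hBm, ← (hc.measurePreserving U hUo hUi).map_eq,
      Measure.map_apply pr.continuous.measurable hBm,
      Measure.restrict_apply (pr.continuous.measurable hBm)]
    refine measure_mono_null ?_ (ae_iff.1 (hs i g))
    rintro z ⟨hz, hzU⟩
    simp only [Set.mem_ofPred_eq, pullSection_val]
    refine smul_ne_zero (by exact_mod_cast hzU) ?_
    rw [Ne, LinearIsometryEquiv.map_eq_zero_iff]
    exact hz

end Equivariance

end FoldingData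

end

/-! ### The folding system of a covering projection -/

section

variable {N : Type*} [MetricSpace N] [CompactSpace N]
  {F : Type*} [NormedAddCommGroup F] [NormedSpace ℂ F] [FiniteDimensional ℂ F]
  {E : N → Type*} [∀ x, NormedAddCommGroup (E x)] [∀ x, InnerProductSpace ℂ (E x)]
  [TopologicalSpace (TotalSpace F E)] [FiberBundle F E] [VectorBundle ℂ F E]
  [IsHermitianBundle F E]

variable {ι Γ₁ Γ₂ M₁ M₂ : Type*} [Group Γ₁] [Group Γ₂]
  [MetricSpace M₁] [MeasurableSpace M₁] [BorelSpace M₁] [MulAction Γ₁ M₁]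
  [MetricSpace M₂] [MeasurableSpace M₂] [BorelSpace M₂] [MulAction Γ₂ M₂]
  {quot : Γ₁ →* Γ₂} {p₁ : C(M₁, N)} {p₂ : C(M₂, N)} {pr : C(M₁, M₂)}
  {μ₁ : Measure M₁} {μ₂ : Measure M₂}

theorem mulRep_mk {X : Type*} [TopologicalSpace X] [MeasurableSpace X] [BorelSpace X] {q : C(X, N)}
    {μ : Measure X} (f : C₀(X, ℂ)) (s : L2Section F E q μ) :
    mulRep F E q μ f (SeparationQuotient.mk s) = SeparationQuotient.mk (mulSection f s) := rfl

theorem L2Section.sum_val {X α : Type*} [TopologicalSpace X] [MeasurableSpace X] [BorelSpace X]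
    {q : C(X, N)} {μ : Measure X} (t : Finset α) (f : α → L2Section F E q μ) (x : X) :
    (∑ a ∈ t, f a).val x = ∑ a ∈ t, (f a).val x := by
  classical
  induction t using Finset.induction_on with
  | empty => simp
  | insert a t ha ih => simp [Finset.sum_insert ha, ih]

theorem EquivariantModule.inner_rep_left {X G H : Type*} [MetricSpace X] [Group G]
    [MulAction G X] [NormedAddCommGroup H] [InnerProductSpace ℂ H] [CompleteSpace H]
    (A : EquivariantModule X G H) (f : C₀(X, ℂ)) (v w : H) :
    ⟪A.rep f v, w⟫_ℂ = ⟪v, A.rep (star f) w⟫_ℂ := by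
  rw [map_star, ContinuousLinearMap.star_eq_adjoint, ContinuousLinearMap.adjoint_inner_right]

theorem EquivariantModule.rep_rep {X G H : Type*} [MetricSpace X] [Group G]
    [MulAction G X] [NormedAddCommGroup H] [InnerProductSpace ℂ H] [CompleteSpace H]
    (A : EquivariantModule X G H) (f g : C₀(X, ℂ)) (v : H) :
    A.rep f (A.rep g v) = A.rep (f * g) v := by
  rw [map_mul]; rfl

namespace FoldingData

variable (D : FoldingData ι quot p₁)

section Module

variable {H : Type*} [NormedAddCommGroup H] [InnerProductSpace ℂ H] [CompleteSpace H]
  (A : EquivariantModule M₁ Γ₁ H)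

theorem unitary_rep_bump (h₁ : IsQuotientCoveringMap p₁ Γ₁) (h : Γ₁) (i : ι) (g : Γ₁) (v : H) :
    A.unitary h (A.rep (D.bumpC₀ h₁ i g) v) = A.rep (D.bumpC₀ h₁ i (h * g)) (A.unitary h v) := by
  have := A.covariant h (D.bumpC₀ h₁ i g) (D.bumpC₀ h₁ i (h * g)) (fun x => by
    rw [bumpC₀_apply, bumpC₀_apply, ← D.bump_smul h₁ i g h, smul_inv_smul]) (A.unitary h v)
  rwa [LinearIsometryEquiv.symm_apply_apply] at this

/-- Equality of the finite sum with `v` is tested after multiplication by compactly supported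
functions, for which the partition of unity is finite. -/
theorem hasSum_rep_bump [LocallyCompactSpace M₁] (h₁ : IsQuotientCoveringMap p₁ Γ₁) {v : H}
    (hv : {p : ι × Γ₁ | A.rep (D.bumpC₀ h₁ p.1 p.2) v ≠ 0}.Finite) :
    HasSum (fun p : ι × Γ₁ => A.rep (D.bumpC₀ h₁ p.1 p.2) v) v := by
  classical
  have key : ∑ p ∈ hv.toFinset, A.rep (D.bumpC₀ h₁ p.1 p.2) v = v := by
    rw [← sub_eq_zero]
    refine A.eq_zero_of_rep fun f hf => ?_
    obtain ⟨s, hs, hsf⟩ := D.exists_finset_bump h₁ hf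
    have e1 : A.rep f v = ∑ p ∈ s, A.rep f (A.rep (D.bumpC₀ h₁ p.1 p.2) v) := by
      conv_lhs => rw [← hsf, map_sum, sum_apply]
      refine Finset.sum_congr rfl fun p _ => ?_
      rw [A.rep_rep, mul_comm]
    -- The finite set attached to `v` and the one attached to `f` differ; both sums equal the same
    -- `finsum`, as each set contains its support.
    have e2 : ∀ t : Finset (ι × Γ₁), (∀ p ∉ t, A.rep f (A.rep (D.bumpC₀ h₁ p.1 p.2) v) = 0) →
        ∑ p ∈ t, A.rep f (A.rep (D.bumpC₀ h₁ p.1 p.2) v) =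
          ∑ᶠ p : ι × Γ₁, A.rep f (A.rep (D.bumpC₀ h₁ p.1 p.2) v) := fun t ht =>
      (finsum_eq_sum_of_support_subset _ fun p hp => by
        by_contra h
        exact hp (ht p h)).symm
    rw [map_sub, map_sum, e1, e2 s fun p hp => by rw [A.rep_rep, mul_comm, hs p hp, map_zero]; rfl,
      e2 hv.toFinset fun p hp => ?_, sub_self]
    rw [Set.Finite.mem_toFinset, Set.mem_ofPred_eq, not_not] at hp
    rw [hp, map_zero]
  rw [← hasSum_subtype_iff_of_support_subset (s := (hv.toFinset : Set (ι × Γ₁)))]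
  · have := Finset.hasSum hv.toFinset fun p : ι × Γ₁ => A.rep (D.bumpC₀ h₁ p.1 p.2) v
    rwa [key] at this
  · intro p hp
    simpa using hp

theorem dense_finite_rep_bump [LocallyCompactSpace M₁] (h₁ : IsQuotientCoveringMap p₁ Γ₁) :
    Dense {v : H | {p : ι × Γ₁ | A.rep (D.bumpC₀ h₁ p.1 p.2) v ≠ 0}.Finite} := by
  intro v
  refine closure_mono ?_ (A.mem_closure_rep v)
  rintro _ ⟨f, hf, rfl⟩
  obtain ⟨s, hs, -⟩ := D.exists_finset_bump h₁ hf
  refine s.finite_toSet.subset fun p hp => ?_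
  by_contra h
  refine hp ?_
  rw [A.rep_rep, hs p h, map_zero]
  rfl

end Module

variable [LocallyCompactSpace M₁] [SecondCountableTopology M₁]
  [MeasurableConstSMul Γ₁ M₁] [SMulInvariantMeasure Γ₁ M₁ μ₁]
  [LocallyCompactSpace M₂] [SecondCountableTopology M₂]
  [MeasurableConstSMul Γ₂ M₂] [SMulInvariantMeasure Γ₂ M₂ μ₂]

/-- By proper discontinuity only finitely many kernel elements make the two supports meet, and this
finite set serves all points in `pull_push_apply`. -/
theorem hasSum_pull_push (hc : IsMeasuredCoverProjection quot p₁ p₂ pr μ₁ μ₂)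
    (hq₁ : ∀ (g : Γ₁) (x : M₁), p₁ (g • x) = p₁ x) (i : ι) (g : Γ₁) (j : ι) (k : Γ₁)
    (v : L2 F E p₁ μ₁) :
    HasSum (fun h : quot.ker => mulRep F E p₁ μ₁ (D.bumpC₀ hc.cover₁ i g)
        (unitaryRep F E μ₁ hq₁ h (mulRep F E p₁ μ₁ (D.bumpC₀ hc.cover₁ j k) v)))
      (L2.map (D.pullSection hc i g) (L2.map (D.pushSection hc j k) v)) := by
  obtain ⟨v, rfl⟩ := SeparationQuotient.surjective_mk v
  have hfin : {h : quot.ker | ∃ y, D.bump i g y ≠ 0 ∧ D.bump j ((h : Γ₁) * k) y ≠ 0}.Finite :=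
    (D.finite_bump_mul_bump hc.cover₁ i j g).preimage (f := fun h : quot.ker => (h : Γ₁) * k)
      fun a _ b _ e => Subtype.ext (mul_right_cancel e)
  have h1 : L2.map (D.pullSection hc i g) (L2.map (D.pushSection hc j k)
      (SeparationQuotient.mk v)) = ∑ h ∈ hfin.toFinset, mulRep F E p₁ μ₁ (D.bumpC₀ hc.cover₁ i g)
        (unitaryRep F E μ₁ hq₁ h (mulRep F E p₁ μ₁ (D.bumpC₀ hc.cover₁ j k)
          (SeparationQuotient.mk v))) := by
    simp only [mulRep_mk, unitaryRep_mk, L2.map_mk]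
    rw [← SeparationQuotient.mkCLM_apply ℂ]
    simp only [← SeparationQuotient.mkCLM_apply ℂ]
    rw [← map_sum]
    refine congrArg _ (L2Section.ext fun y => ?_)
    rw [D.pull_push_apply hc hq₁ i g j k v y hfin.toFinset]
    · exact (L2Section.sum_val _ _ _).symm
    · intro h h2 h3
      rw [Set.Finite.mem_toFinset]
      exact ⟨y, h2, by rwa [← D.bump_smul hc.cover₁ j k h, smul_inv_smul] at h3⟩
  rw [h1]
  refine hasSum_sum_of_ne_finset_zero fun h hh => ?_
  have := D.unitary_rep_bump (l2Module F E μ₁ hq₁) hc.cover₁ h j k (SeparationQuotient.mk v)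
  change unitaryRep F E μ₁ hq₁ h _ = mulRep F E p₁ μ₁ _ _ at this
  change mulRep F E p₁ μ₁ _ (unitaryRep F E μ₁ hq₁ h (mulRep F E p₁ μ₁ _ _)) = 0
  erw [this]
  rw [← mul_apply_eq_comp, ← map_mul]
  have h0 : D.bumpC₀ hc.cover₁ i g * D.bumpC₀ hc.cover₁ j (h * k) = 0 := by
    ext y
    by_contra hne
    simp only [ZeroAtInftyContinuousMap.mul_apply, bumpC₀_apply,
      ZeroAtInftyContinuousMap.zero_apply, mul_eq_zero, Complex.ofReal_eq_zero, not_or] at hne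
    exact hh ((Set.Finite.mem_toFinset _).2 ⟨y, hne⟩)
  rw [h0, map_zero]
  rfl

variable (F E) in
/-- The folding system of the projection between two Galois coverings. -/
def system (hc : IsMeasuredCoverProjection quot p₁ p₂ pr μ₁ μ₂)
    (hq₁ : ∀ (g : Γ₁) (x : M₁), p₁ (g • x) = p₁ x) (hq₂ : ∀ (g : Γ₂) (x : M₂), p₂ (g • x) = p₂ x) :
    FoldingSystem ι quot (L2 F E p₁ μ₁) (L2 F E p₂ μ₂) where
  U₁ := (l2Module F E μ₁ hq₁).unitary
  U₂ := (l2Module F E μ₂ hq₂).unitary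
  M i g := (l2Module F E μ₁ hq₁).rep (D.bumpC₀ hc.cover₁ i g)
  P i g := L2.map (D.pushSection hc i g)
  M_inner i g v w := by rw [EquivariantModule.inner_rep_left, star_bumpC₀]
  M_norm i g v := (l2Module F E μ₁ hq₁).norm_rep_apply_le (D.norm_bumpC₀_le hc.cover₁ i g) v
  U_M h i g v := D.unitary_rep_bump (l2Module F E μ₁ hq₁) hc.cover₁ h i g v
  M_disj i g g' h v := by
    rw [EquivariantModule.rep_rep, D.bumpC₀_mul_eq_zero hc.cover₁ i h, map_zero]
    rfl
  M_fin i j := by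
    refine (D.finite_bump_mul_bump hc.cover₁ i j 1).subset ?_
    rintro g ⟨v, hv⟩
    by_contra hne
    refine hv ?_
    rw [EquivariantModule.rep_rep]
    have h0 : D.bumpC₀ hc.cover₁ i 1 * D.bumpC₀ hc.cover₁ j g = 0 := by
      ext y
      by_contra h
      simp only [ZeroAtInftyContinuousMap.mul_apply, bumpC₀_apply,
        ZeroAtInftyContinuousMap.zero_apply, mul_eq_zero, Complex.ofReal_eq_zero, not_or] at h
      exact hne ⟨y, h⟩
    rw [h0, map_zero]
    rfl
  U_P h i g v := by
    obtain ⟨v, rfl⟩ := SeparationQuotient.surjective_mk v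
    exact congrArg SeparationQuotient.mk (D.actSection_pushSection hc hq₁ hq₂ h i g v)
  adjoint_P_P i g j k v := by
    rw [adjoint_map_pushSection]
    exact D.hasSum_pull_push hc hq₁ i g j k v
  hasSum_M v hv := D.hasSum_rep_bump (l2Module F E μ₁ hq₁) hc.cover₁ hv
  dense_core := D.dense_finite_rep_bump (l2Module F E μ₁ hq₁) hc.cover₁
  eq_zero u hu := D.eq_zero_of_pull hc u fun i g => by
    rw [← adjoint_map_pushSection]
    exact hu i g

end FoldingData

end

/-! ### Supports of operators, propagation and local compactness -/

section

namespace EquivariantModule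

variable {X G H K K' : Type*} [MetricSpace X] [Group G] [MulAction G X]
  [NormedAddCommGroup H] [InnerProductSpace ℂ H] [CompleteSpace H]
  [NormedAddCommGroup K] [InnerProductSpace ℂ K] [CompleteSpace K]
  [NormedAddCommGroup K'] [InnerProductSpace ℂ K'] [CompleteSpace K']
  (A : EquivariantModule X G H)

/-- The operator `V` only depends on the restriction of its argument to `C`. -/
def DomSupported (V : H →L[ℂ] K) (C : Set X) : Prop :=
  ∀ f : C₀(X, ℂ), (∀ x ∈ C, f x = 0) → ∀ v, V (A.rep f v) = 0

/-- The range of the operator `W` is supported in `C`. -/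
def RanSupported (W : K →L[ℂ] H) (C : Set X) : Prop :=
  ∀ f : C₀(X, ℂ), (∀ x ∈ C, f x = 0) → ∀ v, A.rep f (W v) = 0

variable {A}

theorem DomSupported.adjoint {V : H →L[ℂ] K} {C : Set X} (hV : A.DomSupported V C) :
    A.RanSupported V.adjoint C := fun f hf v => by
  refine ext_inner_right ℂ fun w => ?_
  rw [A.inner_rep_left, ContinuousLinearMap.adjoint_inner_left, hV, inner_zero_right,
    inner_zero_left]
  intro x hx
  rw [ZeroAtInftyContinuousMap.star_apply, hf x hx, star_zero]

theorem RanSupported.adjoint {W : K →L[ℂ] H} {C : Set X} (hW : A.RanSupported W C) :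
    A.DomSupported W.adjoint C := fun f hf v => by
  refine ext_inner_right ℂ fun w => ?_
  rw [ContinuousLinearMap.adjoint_inner_left, A.inner_rep_left, hW, inner_zero_right,
    inner_zero_left]
  intro x hx
  rw [ZeroAtInftyContinuousMap.star_apply, hf x hx, star_zero]

theorem DomSupported.comp {V : H →L[ℂ] K} {C : Set X} (hV : A.DomSupported V C) (W : K →L[ℂ] K') :
    A.DomSupported (W ∘L V) C := fun f hf v => by
  rw [ContinuousLinearMap.comp_apply, hV f hf, map_zero]

theorem RanSupported.comp {W : K →L[ℂ] H} {C : Set X} (hW : A.RanSupported W C) (V : K' →L[ℂ] K) :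
    A.RanSupported (W ∘L V) C := fun f hf v => hW f hf (V v)

theorem domSupported_rep {f : C₀(X, ℂ)} {C : Set X} (h : ∀ x ∉ C, f x = 0) :
    A.DomSupported (A.rep f) C := fun g hg v => by
  rw [A.rep_rep, show f * g = 0 from ?_, map_zero]
  · rfl
  · ext x
    by_cases hx : x ∈ C
    · simp [hg x hx]
    · simp [h x hx]

theorem ranSupported_rep {f : C₀(X, ℂ)} {C : Set X} (h : ∀ x ∉ C, f x = 0) :
    A.RanSupported (A.rep f) C := fun g hg v => by
  rw [A.rep_rep, mul_comm, ← A.rep_rep]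
  exact domSupported_rep h g hg v

variable [LocallyCompactSpace X]

/-- The function `f g - g` vanishes on `C`, so the claim holds on truncations of `v`; these have `v`
in their closure. -/
theorem DomSupported.apply_rep {V : H →L[ℂ] K} {C : Set X} (hV : A.DomSupported V C)
    {f : C₀(X, ℂ)} (hf : ∀ x ∈ C, f x = 1) (v : H) : V (A.rep f v) = V v := by
  have hcl : IsClosed {w : H | V (A.rep f w) = V w} :=
    isClosed_eq (V.continuous.comp (A.rep f).continuous) V.continuous
  refine closure_minimal ?_ hcl (A.mem_closure_rep v)
  rintro _ ⟨g, -, rfl⟩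
  have h1 := hV (f * g - g) (fun x hx => by simp [hf x hx]) v
  rwa [map_sub, sub_apply, map_sub, ← A.rep_rep, sub_eq_zero] at h1

theorem RanSupported.rep_apply {W : K →L[ℂ] H} {C : Set X} (hW : A.RanSupported W C)
    {f : C₀(X, ℂ)} (hf : ∀ x ∈ C, f x = 1) (v : K) : A.rep f (W v) = W v := by
  rw [← sub_eq_zero]
  refine A.eq_zero_of_rep fun g _ => ?_
  have h1 := hW (g * f - g) (fun x hx => by simp [hf x hx]) v
  rwa [map_sub, sub_apply, ← A.rep_rep, ← map_sub] at h1

theorem exists_rep_one {C : Set X} (hC : IsCompact C) {δ : ℝ} (hδ : 0 < δ) :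
    ∃ f : C₀(X, ℂ), (∀ x ∈ C, f x = 1) ∧ HasCompactSupport f ∧
      ∀ x ∈ tsupport f, ∃ c ∈ C, dist x c ≤ δ := by
  obtain ⟨f, h1, h0, hc, -⟩ := exists_bump hC (Metric.isOpen_thickening (δ := δ) (E := C))
    (Metric.self_subset_thickening hδ C)
  refine ⟨f, h1, hc, fun x hx => ?_⟩
  have : tsupport f ⊆ Metric.cthickening δ C := by
    refine closure_minimal (fun z hz => ?_) Metric.isClosed_cthickening
    by_contra h
    exact hz (h0 z fun h' => h (Metric.thickening_subset_cthickening _ _ h'))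
  have := this hx
  rw [hC.cthickening_eq_biUnion_closedBall hδ.le] at this
  obtain ⟨c, hc, hxc⟩ := Set.mem_iUnion₂.1 this
  exact ⟨c, hc, hxc⟩

/-- An operator of finite propagation is zero between distant compact sets. -/
theorem exists_dist_le_of_ne_zero {T : H →L[ℂ] H} {R : ℝ} (hT : A.propagation T ≤ ENNReal.ofReal R)
    {V : H →L[ℂ] K} {W : K' →L[ℂ] H} {C C' : Set X} (hC : IsCompact C) (hC' : IsCompact C')
    (hV : A.DomSupported V C) (hW : A.RanSupported W C') {v : K'} (hv : V (T (W v)) ≠ 0) :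
    ∃ x ∈ C, ∃ y ∈ C', dist x y ≤ max R 0 + 1 := by
  by_contra! h
  -- Each cut-off enlarges its set by `1/2`, which together costs the `1` in the bound. The maximum
  -- with `0` covers negative `R`, where `ENNReal.ofReal R` is zero.
  obtain ⟨f, hf, hfc, hfd⟩ := exists_rep_one hC (δ := 1 / 2) (by norm_num)
  obtain ⟨g, hg, hgc, hgd⟩ := exists_rep_one hC' (δ := 1 / 2) (by norm_num)
  refine hv ?_
  rw [← hV.apply_rep hf, ← hW.rep_apply hg]
  have := A.rep_mul_rep_eq_zero (T := T) hfc hgc (fun x hx y hy hxy => ?_)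
    (fun x hx => image_eq_zero_of_notMem_tsupport hx)
    (fun x hx => image_eq_zero_of_notMem_tsupport hx)
  · have h1 := DFunLike.congr_fun this (W v)
    change A.rep f (T (A.rep g (W v))) = 0 at h1
    rw [h1, map_zero]
  · obtain ⟨c, hc, hxc⟩ := hfd x hx
    obtain ⟨c', hc', hyc⟩ := hgd y hy
    have h1 := A.propagation_le_iff.1 hT _ hxy
    rw [edist_dist, ENNReal.ofReal_le_ofReal_iff'] at h1
    have h2 := h c hc c' hc'
    have h3 := dist_triangle4 c x y c'
    rw [dist_comm c x] at h3
    have h4 : dist x y ≤ max R 0 := by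
      rcases h1 with h1 | h1
      · exact h1.trans (le_max_left _ _)
      · exact h1.trans (le_max_right _ _)
    linarith

/-- A sum of operators that are supported near the diagonal has finite propagation. -/
theorem propagation_le_of_hasSum {κ : Type*} {B : κ → H →L[ℂ] H} {T : H →L[ℂ] H}
    (hT : ∀ v, HasSum (fun k => B k v) (T v)) {C C' : κ → Set X} {R : ℝ}
    (hC : ∀ k, A.RanSupported (B k) (C k)) (hC' : ∀ k, A.DomSupported (B k) (C' k))
    (hB : ∀ k v, B k v ≠ 0 → ∀ x ∈ C k, ∀ y ∈ C' k, dist x y ≤ R) :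
    A.propagation T ≤ ENNReal.ofReal R := by
  refine A.propagation_le_iff.2 fun p hp => ?_
  rw [edist_dist]
  refine ENNReal.ofReal_le_ofReal ?_
  by_contra! hlt
  -- Half the excess: points within `δ` of the two components of `p` are still more than `R` apart,
  -- so every term vanishes between the two bumps.
  set δ := (dist p.1 p.2 - R) / 2 with hδ
  have hδpos : 0 < δ := by rw [hδ]; linarith
  obtain ⟨f₁, K₁, -, h1, z1, k1⟩ := exists_bump_at p.1 hδpos
  obtain ⟨f₂, K₂, -, h2, z2, k2⟩ := exists_bump_at p.2 hδpos
  refine A.notMem_support.2 ⟨f₁, f₂, by simp [h1], by simp [h2], ?_⟩ hp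
  ext v
  have h3 := (hT (A.rep f₂ v)).mapL (A.rep f₁)
  refine h3.unique ?_
  change HasSum _ (0 : H)
  convert hasSum_zero with k
  by_contra hne
  have hx : ∃ x ∈ C k, f₁ x ≠ 0 := by
    by_contra! h
    exact hne (hC k f₁ h _)
  have hy : ∃ y ∈ C' k, f₂ y ≠ 0 := by
    by_contra! h
    exact hne (by rw [hC' k f₂ h, map_zero])
  obtain ⟨x, hx, hfx⟩ := hx
  obtain ⟨y, hy, hfy⟩ := hy
  have h4 := hB k _ (fun h0 => hne (by rw [h0, map_zero])) x hx y hy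
  have h5 := k1 x (not_imp_comm.1 (z1 x) hfx)
  have h6 := k2 y (not_imp_comm.1 (z2 y) hfy)
  have h7 := dist_triangle4 p.1 x y p.2
  rw [dist_comm p.1 x] at h7
  linarith

theorem dense_hasCompactSupport {Y : Type*} [MetricSpace Y] [LocallyCompactSpace Y] :
    Dense {f : C₀(Y, ℂ) | HasCompactSupport f} := by
  intro f
  rw [Metric.mem_closure_iff]
  intro ε hε
  have hev : ∀ᶠ x in Filter.cocompact Y, ‖f x‖ < ε / 4 := by
    have := (zero_at_infty f).norm
    rw [norm_zero] at this
    exact this.eventually_lt_const (by positivity)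
  obtain ⟨L, hL, hLf⟩ := Filter.mem_cocompact.1 hev
  obtain ⟨e, he1, -, hec, he2⟩ := exists_bump hL isOpen_univ (Set.subset_univ L)
  refine ⟨e * f, hec.mul_right, ?_⟩
  rw [dist_eq_norm, ← ZeroAtInftyContinuousMap.norm_toBCF_eq_norm]
  refine lt_of_le_of_lt ((BoundedContinuousFunction.norm_le (C := ε / 2) (by positivity)).2
    fun x => ?_) (half_lt_self hε)
  change ‖f x - e x * f x‖ ≤ ε / 2
  by_cases hx : x ∈ L
  · rw [he1 x hx, one_mul, sub_self, norm_zero]; positivity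
  · have h3 : ‖f x‖ < ε / 4 := hLf hx
    have h4 : ‖e x * f x‖ ≤ ‖f x‖ := by
      rw [norm_mul]
      exact mul_le_of_le_one_left (norm_nonneg _) (he2 x)
    linarith [norm_sub_le (f x) (e x * f x)]

/-- Local compactness may be tested on compactly supported functions. -/
theorem isLocallyCompact_of_hasCompactSupport {T : H →L[ℂ] H}
    (h : ∀ f : C₀(X, ℂ), HasCompactSupport f →
      IsCompactOperator (A.rep f * T) ∧ IsCompactOperator (T * A.rep f)) :
    A.IsLocallyCompact T := by
  have hrep : Continuous A.rep := by
    refine AddMonoidHomClass.continuous_of_bound A.rep 1 fun f => ?_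
    rw [one_mul]
    exact NonUnitalStarAlgHom.norm_apply_le A.rep f
  have hcl : IsClosed {S : H →L[ℂ] H | IsCompactOperator S} := isClosed_setOfPred_isCompactOperator
  intro f
  exact ⟨closure_minimal (fun f hf => (h f hf).1)
      (hcl.preimage (hrep.mul continuous_const)) (dense_hasCompactSupport f),
    closure_minimal (fun f hf => (h f hf).2)
      (hcl.preimage (continuous_const.mul hrep)) (dense_hasCompactSupport f)⟩

/-- A bump function equal to `1` on `C` can be inserted between `T` and `W` without changing the
product. -/
theorem IsLocallyCompact.comp_ranSupported {T : H →L[ℂ] H} (hT : A.IsLocallyCompact T)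
    {W : K →L[ℂ] H} {C : Set X} (hC : IsCompact C) (hW : A.RanSupported W C) :
    IsCompactOperator (T ∘L W) := by
  obtain ⟨f, hf, -, -⟩ := exists_rep_one hC one_pos
  have : T ∘L W = (T * A.rep f) ∘L W := by
    ext v
    change T (W v) = T (A.rep f (W v))
    rw [hW.rep_apply hf]
  rw [this]
  exact (hT f).2.comp_clm W

end EquivariantModule

end

/-! ### Propagation and local compactness of folded and unfolded operators -/

section

variable {N : Type*} [MetricSpace N] [CompactSpace N]
  {F : Type*} [NormedAddCommGroup F] [NormedSpace ℂ F] [FiniteDimensional ℂ F]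
  {E : N → Type*} [∀ x, NormedAddCommGroup (E x)] [∀ x, InnerProductSpace ℂ (E x)]
  [TopologicalSpace (TotalSpace F E)] [FiberBundle F E] [VectorBundle ℂ F E]
  [IsHermitianBundle F E]

variable {ι Γ₁ Γ₂ M₁ M₂ : Type*} [Group Γ₁] [Group Γ₂]
  [MetricSpace M₁] [MeasurableSpace M₁] [BorelSpace M₁] [MulAction Γ₁ M₁]
  [MetricSpace M₂] [MeasurableSpace M₂] [BorelSpace M₂] [MulAction Γ₂ M₂]
  {quot : Γ₁ →* Γ₂} {p₁ : C(M₁, N)} {p₂ : C(M₂, N)} {pr : C(M₁, M₂)}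
  {μ₁ : Measure M₁} {μ₂ : Measure M₂}

theorem exists_dist_smul_le {G X : Type*} [Group G] [MetricSpace X] [MulAction G X]
    (hG : ∀ g : G, Continuous (g • · : X → X)) {K L : Set X} (hK : IsCompact K) (hL : IsCompact L)
    {B : Set G} (hB : B.Finite) :
    ∃ R : ℝ, ∀ b ∈ B, ∀ x ∈ K, ∀ y ∈ L, dist (b • x) y ≤ R := by
  have h1 : IsCompact ((⋃ b ∈ B, (b • ·) '' K) ∪ L) :=
    (hB.isCompact_biUnion fun b _ => hK.image (hG b)).union hL
  obtain ⟨R, hR⟩ := Metric.isBounded_iff.1 h1.isBounded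
  exact ⟨R, fun b hb x hx y hy => hR (Or.inl (Set.mem_biUnion hb ⟨x, hx, rfl⟩)) (Or.inr hy)⟩

theorem dist_smul_smul_eq {G X : Type*} [Group G] [MetricSpace X] [MulAction G X]
    [IsIsometricSMul G X] (g h : G) (x y : X) :
    dist (g • x) (h • y) = dist ((h⁻¹ * g) • x) y := by
  rw [← dist_smul h⁻¹, inv_smul_smul, mul_smul]

namespace FoldingData

variable (D : FoldingData ι quot p₁)

/-- The translates `g • core i`. -/
def coreG (i : ι) (g : Γ₁) : Set M₁ := (g • ·) '' D.core i

theorem isCompact_coreG (h₁ : IsQuotientCoveringMap p₁ Γ₁) (i : ι) (g : Γ₁) :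
    IsCompact (D.coreG i g) := (D.isCompact_core h₁ i).image (h₁.continuous_const_smul g)

theorem mem_coreG_of_bump (h₁ : IsQuotientCoveringMap p₁ Γ₁) {i : ι} {g : Γ₁} {y : M₁}
    (h : D.bump i g y ≠ 0) : y ∈ D.coreG i g :=
  ⟨g⁻¹ • y, D.smul_mem_core_of_bump h₁ h, by simp⟩

/-- The union of the supports of the lifted partition of unity. -/
def fundamentalSet : Set M₁ := ⋃ i, D.core i

theorem isCompact_fundamentalSet (h₁ : IsQuotientCoveringMap p₁ Γ₁) :
    IsCompact D.fundamentalSet := by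
  have := D.finite
  exact isCompact_iUnion fun i => D.isCompact_core h₁ i

theorem exists_smul_mem_fundamentalSet (h₁ : IsQuotientCoveringMap p₁ Γ₁) (y : M₁) :
    ∃ g : Γ₁, g • y ∈ D.fundamentalSet := by
  obtain ⟨i, g, h⟩ := D.exists_bump_ne_zero h₁ y
  exact ⟨g⁻¹, Set.mem_iUnion.2 ⟨i, D.smul_mem_core_of_bump h₁ h⟩⟩

section LocallyCompact

variable {H₁ H₂ : Type*} [NormedAddCommGroup H₁] [InnerProductSpace ℂ H₁] [CompleteSpace H₁]
  [NormedAddCommGroup H₂] [InnerProductSpace ℂ H₂] [CompleteSpace H₂]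
  {A₁ : EquivariantModule M₁ Γ₁ H₁} {A₂ : EquivariantModule M₂ Γ₂ H₂}
  {A : FoldingSystem ι quot H₁ H₂} [LocallyCompactSpace M₁] [LocallyCompactSpace M₂]

theorem quot_mem_of_unfoldTerm_ne_zero {A : FoldingSystem ι quot H₁ H₂}
    {T : H₂ →L[ℂ] H₂} {B : Set Γ₂}
    (hB : ∀ i g j k v, A.Q j k (T (A.P i g v)) ≠ 0 → quot (g⁻¹ * k) ∈ B) {i j : ι} {g s : Γ₁}
    {v : H₁} (hv : A.Q j (g * s) (T (A.P i g v)) ≠ 0) : quot s ∈ B := by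
  have := hB i g j (g * s) v hv
  rwa [inv_mul_cancel_left] at this

/-- Each term contains `T ∘ Q` with `Q` ranging in a compact set, hence is compact. A compactly
supported `f` downstairs meets finitely many classes in `Γ₂`, and finite propagation together with
unique representatives leaves finitely many terms. -/
theorem isLocallyCompact_fold (h₁ : IsQuotientCoveringMap p₁ Γ₁)
    (h₂ : IsQuotientCoveringMap p₂ Γ₂) (hpr : IsCoverProjection quot p₁ p₂ pr)
    (hPd : ∀ i g, A₁.DomSupported (A.P i g) (D.coreG i g))
    (hPr : ∀ i g, A₂.RanSupported (A.P i g) (pr '' D.coreG i g)) {T : H₁ →L[ℂ] H₁}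
    (hT : A.FinProp T) {X : H₂ →L[ℂ] H₂}
    (hX : ∀ u, HasSum (A.foldTerm D.S T u) (X u))
    (hlc : A₁.IsLocallyCompact T) :
    A₂.IsLocallyCompact X := by
  have := D.finite
  obtain ⟨B, hB, hTB⟩ := hT.exists_foldTerm
  have hQr : ∀ i g, A₁.RanSupported (A.Q i g) (D.coreG i g) := fun i g => (hPd i g).adjoint
  have hQd : ∀ i g, A₂.DomSupported (A.Q i g) (pr '' D.coreG i g) := fun i g => (hPr i g).adjoint
  have hK := (D.isCompact_fundamentalSet h₁).image pr.continuous
  have hcomp : ∀ p : Γ₁ × D.S × ι × ι,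
      IsCompactOperator (A.P p.2.2.1 p.1 ∘L (T ∘L A.Q p.2.2.2 p.2.1)) := fun p => by
    exact (hlc.comp_ranSupported (D.isCompact_coreG h₁ _ _) (hQr p.2.2.2 p.2.1)).clm_comp
      (A.P p.2.2.1 p.1)
  have hX' : ∀ u, HasSum (fun p : Γ₁ × D.S × ι × ι =>
    (A.P p.2.2.1 p.1 ∘L (T ∘L A.Q p.2.2.2 p.2.1)) u) (X u) := hX
  have hfin : ∀ C : Set Γ₂, C.Finite →
      {p : Γ₁ × D.S × ι × ι | quot p.2.1 ∈ C ∧ (p.2.1 : Γ₁)⁻¹ * p.1 ∈ B}.Finite := fun C hC => by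
    have hS := FoldingSystem.finite_representatives D.bijOn_S hC
    refine ((((hS.prod hB).image fun q => (q.1 : Γ₁) * q.2)).prod (hS.prod Set.finite_univ)).subset ?_
    rintro ⟨g, s, i, j⟩ ⟨hs, hg⟩
    exact ⟨⟨(s, (s : Γ₁)⁻¹ * g), ⟨hs, hg⟩, by simp⟩, hs, trivial⟩
  refine EquivariantModule.isLocallyCompact_of_hasCompactSupport fun f hf => ?_
  have hC := finite_smul_inter_nonempty h₂ hK hf
  set C := {g : Γ₂ | ∃ x ∈ pr '' D.fundamentalSet, g • x ∈ tsupport f} with hCdef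
  have hzero : ∀ i g, quot g ∉ C → ∀ x ∈ pr '' D.coreG i g, f x = 0 := by
    rintro i g hg _ ⟨_, ⟨x, hx, rfl⟩, rfl⟩
    refine image_eq_zero_of_notMem_tsupport fun h => hg ?_
    exact ⟨pr x, ⟨x, Set.mem_iUnion_of_mem i hx, rfl⟩, by rwa [← hpr.map_smul]⟩
  -- Identity factors bring both products into the two-sided form of
  -- `isCompactOperator_comp_of_hasSum`.
  rw [← ContinuousLinearMap.comp_id (A₂.rep f * X), ← ContinuousLinearMap.id_comp (X * A₂.rep f)]
  constructor
  -- On the left, `f` restricts the class of `g`; since `s⁻¹ g` lies in `B`, the class of `s` is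
  -- that of `g` times the inverse of one from `B`.
  · have hC' : (Set.image2 (fun c b => c * (quot b)⁻¹) C B).Finite := hC.image2 _ hB
    refine isCompactOperator_comp_of_hasSum hX' (A₂.rep f) (ContinuousLinearMap.id ℂ _)
      (hfin _ hC') ?_ hcomp
    rintro ⟨g, s, i, j⟩ hp v
    change A₂.rep f (A.P i g (T (A.Q j s v))) = 0
    by_contra hne
    have hgC : quot g ∈ C := by
      by_contra h
      exact hne (hPr i g f (hzero i g h) _)
    have hgB := hTB i g j s v fun h0 => hne (by rw [h0, map_zero])
    exact hp ⟨⟨_, hgC, _, hgB, by simp⟩, hgB⟩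
  · refine isCompactOperator_comp_of_hasSum hX' (ContinuousLinearMap.id ℂ _) (A₂.rep f)
      (hfin _ hC) ?_ hcomp
    rintro ⟨g, s, i, j⟩ hp v
    change A.P i g (T (A.Q j s (A₂.rep f v))) = 0
    by_contra hne
    have hsC : quot s ∈ C := by
      by_contra h
      exact hne (by rw [hQd j s f (hzero j s h), map_zero, map_zero])
    exact hp ⟨hsC, hTB i g j s _ hne⟩

/-- The counting now takes place in `Γ₁`: finite propagation confines `s`, while `f` confines `g s`
when it stands on the left and `g` when it stands on the right. -/
theorem isLocallyCompact_unfold (h₁ : IsQuotientCoveringMap p₁ Γ₁)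
    (hPd : ∀ i g, A₁.DomSupported (A.P i g) (D.coreG i g))
    (hPr : ∀ i g, A₂.RanSupported (A.P i g) (pr '' D.coreG i g)) {T : H₂ →L[ℂ] H₂}
    (hT : A.FinProp₂ T) {X : H₁ →L[ℂ] H₁}
    (hX : ∀ v, HasSum (A.unfoldTerm D.S T v) (X v))
    (hlc : A₂.IsLocallyCompact T) :
    A₁.IsLocallyCompact X := by
  have := D.finite
  obtain ⟨B, hB, hTB⟩ := hT
  have hQr : ∀ i g, A₁.RanSupported (A.Q i g) (D.coreG i g) := fun i g => (hPd i g).adjoint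
  have hS := FoldingSystem.finite_representatives D.bijOn_S hB
  have hcomp : ∀ p : Γ₁ × D.S × ι × ι,
      IsCompactOperator (A.Q p.2.2.2 (p.1 * p.2.1) ∘L (T ∘L A.P p.2.2.1 p.1)) := fun p => by
    exact (hlc.comp_ranSupported ((D.isCompact_coreG h₁ _ _).image pr.continuous)
      (hPr p.2.2.1 p.1)).clm_comp (A.Q p.2.2.2 (p.1 * p.2.1))
  have hX' : ∀ v, HasSum (fun p : Γ₁ × D.S × ι × ι =>
    (A.Q p.2.2.2 (p.1 * p.2.1) ∘L (T ∘L A.P p.2.2.1 p.1)) v) (X v) := hX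
  refine EquivariantModule.isLocallyCompact_of_hasCompactSupport fun f hf => ?_
  have hC := finite_smul_inter_nonempty h₁ (D.isCompact_fundamentalSet h₁) hf
  set C := {g : Γ₁ | ∃ x ∈ D.fundamentalSet, g • x ∈ tsupport f} with hCdef
  have hzero : ∀ i g, g ∉ C → ∀ x ∈ D.coreG i g, f x = 0 := by
    rintro i g hg _ ⟨x, hx, rfl⟩
    exact image_eq_zero_of_notMem_tsupport fun h => hg ⟨x, Set.mem_iUnion_of_mem i hx, h⟩
  rw [← ContinuousLinearMap.comp_id (A₁.rep f * X), ← ContinuousLinearMap.id_comp (X * A₁.rep f)]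
  constructor
  · have hC' : (Set.image2 (fun c (s : D.S) => c * (s : Γ₁)⁻¹) C {s | quot s ∈ B}).Finite :=
      hC.image2 _ hS
    refine isCompactOperator_comp_of_hasSum hX' (A₁.rep f) (ContinuousLinearMap.id ℂ _)
      (hC'.prod (hS.prod Set.finite_univ)) ?_ hcomp
    rintro ⟨g, s, i, j⟩ hp v
    change A₁.rep f (A.Q j (g * s) (T (A.P i g v))) = 0
    by_contra hne
    have hgC : g * s ∈ C := by
      by_contra h
      exact hne (hQr j (g * s) f (hzero j (g * s) h) _)
    have hsB : quot s ∈ B := quot_mem_of_unfoldTerm_ne_zero (A := A) hTB (i := i) (j := j) (g := g)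
      (v := v) fun h0 => hne (by rw [h0, map_zero])
    exact hp ⟨⟨_, hgC, s, hsB, by simp⟩, hsB, trivial⟩
  · refine isCompactOperator_comp_of_hasSum hX' (ContinuousLinearMap.id ℂ _) (A₁.rep f)
      (hC.prod (hS.prod Set.finite_univ)) ?_ hcomp
    rintro ⟨g, s, i, j⟩ hp v
    change A.Q j (g * s) (T (A.P i g (A₁.rep f v))) = 0
    by_contra hne
    have hgC : g ∈ C := by
      by_contra h
      exact hne (by rw [hPd i g f (hzero i g h), map_zero, map_zero])
    exact hp ⟨hgC, quot_mem_of_unfoldTerm_ne_zero (A := A) hTB hne, trivial⟩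

end LocallyCompact

variable [LocallyCompactSpace M₁] [SecondCountableTopology M₁]
  [IsIsometricSMul Γ₁ M₁] [SMulInvariantMeasure Γ₁ M₁ μ₁]
  [LocallyCompactSpace M₂] [SecondCountableTopology M₂]
  [IsIsometricSMul Γ₂ M₂] [SMulInvariantMeasure Γ₂ M₂ μ₂]
  (hc : IsMeasuredCoverProjection quot p₁ p₂ pr μ₁ μ₂)
  (hq₁ : ∀ (g : Γ₁) (x : M₁), p₁ (g • x) = p₁ x) (hq₂ : ∀ (g : Γ₂) (x : M₂), p₂ (g • x) = p₂ x)

theorem domSupported_M (i : ι) (g : Γ₁) :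
    (l2Module F E μ₁ hq₁).DomSupported ((D.system F E hc hq₁ hq₂).M i g) (D.coreG i g) :=
  EquivariantModule.domSupported_rep fun y hy => by
    rw [bumpC₀_apply, Complex.ofReal_eq_zero]
    by_contra h
    exact hy (D.mem_coreG_of_bump hc.cover₁ h)

theorem ranSupported_M (i : ι) (g : Γ₁) :
    (l2Module F E μ₁ hq₁).RanSupported ((D.system F E hc hq₁ hq₂).M i g) (D.coreG i g) :=
  EquivariantModule.ranSupported_rep fun y hy => by
    rw [bumpC₀_apply, Complex.ofReal_eq_zero]
    by_contra h
    exact hy (D.mem_coreG_of_bump hc.cover₁ h)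

theorem domSupported_P (i : ι) (g : Γ₁) :
    (l2Module F E μ₁ hq₁).DomSupported ((D.system F E hc hq₁ hq₂).P i g) (D.coreG i g) := by
  intro f hf v
  rw [FoldingSystem.P_eq_zero_iff]
  exact D.domSupported_M hc hq₁ hq₂ i g f hf v

theorem ranSupported_Q (i : ι) (g : Γ₁) :
    (l2Module F E μ₁ hq₁).RanSupported ((D.system F E hc hq₁ hq₂).Q i g) (D.coreG i g) :=
  (D.domSupported_P hc hq₁ hq₂ i g).adjoint

theorem domSupported_Q (i : ι) (g : Γ₁) :
    (l2Module F E μ₂ hq₂).DomSupported ((D.system F E hc hq₁ hq₂).Q i g) (pr '' D.coreG i g) := by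
  intro f hf u
  obtain ⟨s, rfl⟩ := SeparationQuotient.surjective_mk u
  change (L2.map (D.pushSection hc i g)).adjoint _ = 0
  rw [adjoint_map_pushSection]
  change SeparationQuotient.mk (D.pullSection hc i g (mulSection f s)) = SeparationQuotient.mk 0
  refine congrArg _ (L2Section.ext fun y => ?_)
  rw [pullSection_val, mulSection_val]
  by_cases hy : D.bump i g y = 0
  · simp [hy]
  · rw [hf _ ⟨y, D.mem_coreG_of_bump hc.cover₁ hy, rfl⟩]
    simp

/-- Obtained by duality, because the adjoint `Q` has a pointwise formula. -/
theorem ranSupported_P (i : ι) (g : Γ₁) :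
    (l2Module F E μ₂ hq₂).RanSupported ((D.system F E hc hq₁ hq₂).P i g) (pr '' D.coreG i g) := by
  have := (D.domSupported_Q (F := F) (E := E) hc hq₁ hq₂ i g).adjoint
  rwa [FoldingSystem.Q, ContinuousLinearMap.adjoint_adjoint] at this

/-- A nonzero entry of `T` forces translates by `k` and `g` of the fundamental set to be at bounded
distance. The action is isometric, so only `g⁻¹ k` matters, and properness with proper discontinuity
leaves finitely many such elements. -/
theorem finProp_of_propagation [ProperSpace M₁] {T : L2 F E p₁ μ₁ →L[ℂ] L2 F E p₁ μ₁}
    (hT : (l2Module F E μ₁ hq₁).propagation T < ⊤) : (D.system F E hc hq₁ hq₂).FinProp T := by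
  have := D.finite
  set R := ((l2Module F E μ₁ hq₁).propagation T).toReal
  have hR : (l2Module F E μ₁ hq₁).propagation T ≤ ENNReal.ofReal R :=
    (ENNReal.ofReal_toReal hT.ne).ge
  refine ⟨_, finite_dist_smul_le hc.cover₁ (D.isCompact_fundamentalSet hc.cover₁)
    (D.isCompact_fundamentalSet hc.cover₁) (max R 0 + 1), fun i g j k v hv => ?_⟩
  obtain ⟨_, ⟨x, hx, rfl⟩, _, ⟨y, hy, rfl⟩, h⟩ := EquivariantModule.exists_dist_le_of_ne_zero hR
    (D.isCompact_coreG hc.cover₁ j k) (D.isCompact_coreG hc.cover₁ i g)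
    (D.domSupported_M hc hq₁ hq₂ j k) (D.ranSupported_M hc hq₁ hq₂ i g) hv
  simp only [dist_smul_smul_eq] at h
  exact ⟨x, Set.mem_iUnion_of_mem j hx, y, Set.mem_iUnion_of_mem i hy, h⟩

theorem finProp₂_of_propagation [ProperSpace M₂] {T : L2 F E p₂ μ₂ →L[ℂ] L2 F E p₂ μ₂}
    (hT : (l2Module F E μ₂ hq₂).propagation T < ⊤) : (D.system F E hc hq₁ hq₂).FinProp₂ T := by
  set R := ((l2Module F E μ₂ hq₂).propagation T).toReal
  have hR : (l2Module F E μ₂ hq₂).propagation T ≤ ENNReal.ofReal R :=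
    (ENNReal.ofReal_toReal hT.ne).ge
  have hK := (D.isCompact_fundamentalSet hc.cover₁).image pr.continuous
  refine ⟨_, finite_dist_smul_le hc.cover₂ hK hK (max R 0 + 1), fun i g j k v hv => ?_⟩
  obtain ⟨_, ⟨_, ⟨x, hx, rfl⟩, rfl⟩, _, ⟨_, ⟨y, hy, rfl⟩, rfl⟩, h⟩ :=
    EquivariantModule.exists_dist_le_of_ne_zero hR
    ((D.isCompact_coreG hc.cover₁ j k).image pr.continuous)
    ((D.isCompact_coreG hc.cover₁ i g).image pr.continuous)
    (D.domSupported_Q hc hq₁ hq₂ j k) (D.ranSupported_P hc hq₁ hq₂ i g) hv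
  simp only [hc.map_smul, dist_smul_smul_eq] at h
  rw [map_mul, map_inv]
  exact ⟨pr x, ⟨x, Set.mem_iUnion_of_mem j hx, rfl⟩, pr y, ⟨y, Set.mem_iUnion_of_mem i hy, rfl⟩, h⟩

/-- A nonzero term relates positions whose quotient lies in a finite set. Finitely many translates
of a compact set have bounded diameter, and by isometric invariance this one bound serves all terms.
-/
theorem propagation_fold_lt_top {T : L2 F E p₁ μ₁ →L[ℂ] L2 F E p₁ μ₁}
    (hT : (D.system F E hc hq₁ hq₂).FinProp T) {X : L2 F E p₂ μ₂ →L[ℂ] L2 F E p₂ μ₂}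
    (hX : ∀ u, HasSum ((D.system F E hc hq₁ hq₂).foldTerm D.S T u) (X u)) :
    (l2Module F E μ₂ hq₂).propagation X < ⊤ := by
  have := D.finite
  obtain ⟨B, hB, hTB⟩ := hT.exists_foldTerm
  have hK := (D.isCompact_fundamentalSet hc.cover₁).image pr.continuous
  obtain ⟨R, hR⟩ := exists_dist_smul_le hc.cover₂.continuous_const_smul hK hK (hB.image quot)
  let A := D.system F E hc hq₁ hq₂
  refine (EquivariantModule.propagation_le_of_hasSum (R := R)
    (B := fun p : Γ₁ × D.S × ι × ι => A.P p.2.2.1 p.1 ∘L T ∘L A.Q p.2.2.2 p.2.1) hX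
    (fun p => (D.ranSupported_P hc hq₁ hq₂ p.2.2.1 p.1).comp _)
    (fun p => ((D.domSupported_Q hc hq₁ hq₂ p.2.2.2 p.2.1).comp T).comp _) ?_).trans_lt
    ENNReal.ofReal_lt_top
  rintro ⟨g, s, i, j⟩ v hv _ ⟨_, ⟨x, hx, rfl⟩, rfl⟩ _ ⟨_, ⟨y, hy, rfl⟩, rfl⟩
  simp only [hc.map_smul, dist_smul_smul_eq]
  rw [← map_inv, ← map_mul]
  exact hR _ ⟨_, hTB i g j s v hv, rfl⟩ _ ⟨x, Set.mem_iUnion_of_mem i hx, rfl⟩ _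
    ⟨y, Set.mem_iUnion_of_mem j hy, rfl⟩

theorem propagation_unfold_lt_top {T : L2 F E p₂ μ₂ →L[ℂ] L2 F E p₂ μ₂}
    (hT : (D.system F E hc hq₁ hq₂).FinProp₂ T) {X : L2 F E p₁ μ₁ →L[ℂ] L2 F E p₁ μ₁}
    (hX : ∀ v, HasSum ((D.system F E hc hq₁ hq₂).unfoldTerm D.S T v) (X v)) :
    (l2Module F E μ₁ hq₁).propagation X < ⊤ := by
  obtain ⟨B, hB, hTB⟩ := hT
  have hK := D.isCompact_fundamentalSet hc.cover₁
  have hBS := FoldingSystem.finite_representatives D.bijOn_S hB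
  obtain ⟨R, hR⟩ := exists_dist_smul_le hc.cover₁.continuous_const_smul hK hK
    (hBS.image Subtype.val)
  let A := D.system F E hc hq₁ hq₂
  refine (EquivariantModule.propagation_le_of_hasSum (R := R)
    (B := fun p : Γ₁ × D.S × ι × ι => A.Q p.2.2.2 (p.1 * p.2.1) ∘L T ∘L A.P p.2.2.1 p.1) hX
    (fun p => (D.ranSupported_Q hc hq₁ hq₂ p.2.2.2 (p.1 * p.2.1)).comp _)
    (fun p => ((D.domSupported_P hc hq₁ hq₂ p.2.2.1 p.1).comp T).comp _) ?_).trans_lt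
    ENNReal.ofReal_lt_top
  rintro ⟨g, s, i, j⟩ v hv _ ⟨x, hx, rfl⟩ _ ⟨y, hy, rfl⟩
  simp only [dist_smul_smul_eq, inv_mul_cancel_left]
  exact hR _ ⟨s, quot_mem_of_unfoldTerm_ne_zero hTB hv, rfl⟩ _ (Set.mem_iUnion_of_mem j hx) _
    (Set.mem_iUnion_of_mem i hy)

end FoldingData

end

/-! ### The folding homomorphism and its surjectivity -/

section

namespace FoldingSystem

variable {ι Γ₁ Γ₂ X₁ X₂ H₁ H₂ : Type*} [Group Γ₁] [Group Γ₂] {quot : Γ₁ →* Γ₂}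
  [MetricSpace X₁] [MetricSpace X₂] [MulAction Γ₁ X₁] [MulAction Γ₂ X₂]
  [NormedAddCommGroup H₁] [InnerProductSpace ℂ H₁] [CompleteSpace H₁]
  [NormedAddCommGroup H₂] [InnerProductSpace ℂ H₂] [CompleteSpace H₂]
  (A : FoldingSystem ι quot H₁ H₂) [Finite ι] {S : Set Γ₁}

/-- `A` is the folding system of the modules `A₁` and `A₂`, and finite propagation and local
compactness for `A₁` and `A₂` can be expressed in terms of `A`. -/
structure IsCompatible (S : Set Γ₁) (A₁ : EquivariantModule X₁ Γ₁ H₁)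
    (A₂ : EquivariantModule X₂ Γ₂ H₂) : Prop where
  U₁_eq : A.U₁ = A₁.unitary
  U₂_eq : A.U₂ = A₂.unitary
  bijOn : Set.BijOn quot S Set.univ
  finProp : ∀ T, A₁.propagation T < ⊤ → A.FinProp T
  finProp₂ : ∀ T, A₂.propagation T < ⊤ → A.FinProp₂ T
  propagation_fold : ∀ T X, A.FinProp T → (∀ u, HasSum (A.foldTerm S T u) (X u)) →
    A₂.propagation X < ⊤
  propagation_unfold : ∀ T X, A.FinProp₂ T → (∀ v, HasSum (A.unfoldTerm S T v) (X v)) →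
    A₁.propagation X < ⊤
  isLocallyCompact_fold : ∀ T X, A.FinProp T → (∀ u, HasSum (A.foldTerm S T u) (X u)) →
    A₁.IsLocallyCompact T → A₂.IsLocallyCompact X
  isLocallyCompact_unfold : ∀ T X, A.FinProp₂ T → (∀ v, HasSum (A.unfoldTerm S T v) (X v)) →
    A₂.IsLocallyCompact T → A₁.IsLocallyCompact X

namespace IsCompatible

variable {A} {A₁ : EquivariantModule X₁ Γ₁ H₁} {A₂ : EquivariantModule X₂ Γ₂ H₂}
  [LocallyCompactSpace X₁] [LocallyCompactSpace X₂]

theorem U₁_comm (hA : A.IsCompatible S A₁ A₂) {T : H₁ →L[ℂ] H₁} (hT : A₁.IsEquivariant T) (g : Γ₁)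
    (v : H₁) : A.U₁ g (T v) = T (A.U₁ g v) := by
  rw [hA.U₁_eq]
  exact hT.apply A₁ g v

theorem U₂_comm (hA : A.IsCompatible S A₁ A₂) {T : H₂ →L[ℂ] H₂} (hT : A₂.IsEquivariant T) (g : Γ₂)
    (v : H₂) : A.U₂ g (T v) = T (A.U₂ g v) := by
  rw [hA.U₂_eq]
  exact hT.apply A₂ g v

theorem finProp_of_mem (hA : A.IsCompatible S A₁ A₂) (T : A₁.finitePropagationAlgebra) :
    A.FinProp T.1 := hA.finProp _ T.2.2

/-- The folding of an operator. -/
def fold (hA : A.IsCompatible S A₁ A₂) (T : A₁.finitePropagationAlgebra) : H₂ →L[ℂ] H₂ :=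
  (A.exists_hasSum_foldTerm hA.bijOn (hA.finProp_of_mem T)).choose

theorem hasSum_fold (hA : A.IsCompatible S A₁ A₂) (T : A₁.finitePropagationAlgebra) (u : H₂) :
    HasSum (A.foldTerm S T.1 u) (hA.fold T u) :=
  (A.exists_hasSum_foldTerm hA.bijOn (hA.finProp_of_mem T)).choose_spec u

theorem fold_push (hA : A.IsCompatible S A₁ A₂) (T : A₁.finitePropagationAlgebra) {w : H₁}
    (hw : w ∈ A.core) : hA.fold T (A.push w) = A.push (T.1 w) :=
  A.apply_push_of_hasSum_foldTerm hA.bijOn (hA.finProp_of_mem T) (hA.U₁_comm T.2.1)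
    (hA.hasSum_fold T) hw

/-- For equivariance it suffices to compare on pushforwards, where the action of `quot g` lifts to
that of `g` and `T` commutes with the latter. -/
theorem fold_mem (hA : A.IsCompatible S A₁ A₂) (T : A₁.finitePropagationAlgebra) :
    hA.fold T ∈ A₂.finitePropagationAlgebra := by
  refine ⟨A₂.isEquivariant_of_apply fun γ u => ?_,
    hA.propagation_fold _ _ (hA.finProp_of_mem T) (hA.hasSum_fold T)⟩
  obtain ⟨g, -, rfl⟩ := hA.bijOn.surjOn (Set.mem_univ γ)
  rw [← hA.U₂_eq]
  have h : ((A.U₂ (quot g)).toContinuousLinearEquiv : H₂ →L[ℂ] H₂) ∘L hA.fold T =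
      hA.fold T ∘L ((A.U₂ (quot g)).toContinuousLinearEquiv : H₂ →L[ℂ] H₂) := by
    refine A.ext_push fun w hw => ?_
    change A.U₂ (quot g) (hA.fold T (A.push w)) = hA.fold T (A.U₂ (quot g) (A.push w))
    rw [← A.push_U hw, hA.fold_push T hw, hA.fold_push T (A.U_mem_core hw g),
      ← A.push_U ((hA.finProp_of_mem T).mem_core hw), hA.U₁_comm T.2.1]
  exact DFunLike.congr_fun h u

/-- Both sides, paired with pushforwards, become sums over the kernel; these agree termwise because
`T` commutes with translations. -/
theorem fold_star (hA : A.IsCompatible S A₁ A₂) (T : A₁.finitePropagationAlgebra) :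
    hA.fold (star T) = star (hA.fold T) := by
  refine A.ext_push fun a ha => A.eq_of_inner_push fun b hb => ?_
  rw [hA.fold_push _ ha, ContinuousLinearMap.star_eq_adjoint,
    ContinuousLinearMap.adjoint_inner_left, hA.fold_push T hb]
  refine (A.hasSum_inner_push ((hA.finProp_of_mem (star T)).mem_core ha) hb).unique ?_
  convert A.hasSum_inner_push ha ((hA.finProp_of_mem T).mem_core hb) using 2 with h
  rw [hA.U₁_comm T.2.1]
  change ⟪T.1.adjoint a, _⟫_ℂ = _
  rw [ContinuousLinearMap.adjoint_inner_left]

/-- The folding map. -/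
def foldHom (hA : A.IsCompatible S A₁ A₂) :
    A₁.finitePropagationAlgebra →⋆ₐ[ℂ] A₂.finitePropagationAlgebra where
  toFun T := ⟨hA.fold T, hA.fold_mem T⟩
  map_one' := Subtype.ext <| A.ext_push fun w hw => hA.fold_push 1 hw
  map_mul' T T' := Subtype.ext <| A.ext_push fun w hw => by
    change hA.fold (T * T') (A.push w) = hA.fold T (hA.fold T' (A.push w))
    rw [hA.fold_push _ hw, hA.fold_push _ hw, hA.fold_push _ ((hA.finProp_of_mem T').mem_core hw)]
    rfl
  map_zero' := Subtype.ext <| A.ext_push fun w hw => by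
    refine (hA.fold_push 0 hw).trans ?_
    have := A.push_smul 0 A.core.zero_mem
    rw [zero_smul, zero_smul] at this
    exact this
  map_add' T T' := Subtype.ext <| A.ext_push fun w hw => by
    change hA.fold (T + T') (A.push w) = hA.fold T (A.push w) + hA.fold T' (A.push w)
    rw [hA.fold_push _ hw, hA.fold_push _ hw, hA.fold_push _ hw, ← A.push_add
      ((hA.finProp_of_mem T).mem_core hw) ((hA.finProp_of_mem T').mem_core hw)]
    rfl
  commutes' c := Subtype.ext <| A.ext_push fun w hw => by
    refine (hA.fold_push _ hw).trans ?_
    exact A.push_smul c hw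
  map_star' T := Subtype.ext (hA.fold_star T)

/-- The unfolded operator intertwines `push` with `T₂`, and its folding does the same; density of
the pushforwards makes the two operators downstairs equal. -/
theorem exists_preimage (hA : A.IsCompatible S A₁ A₂) (T₂ : A₂.finitePropagationAlgebra) :
    ∃ T₁ : A₁.finitePropagationAlgebra, (∀ v, HasSum (A.unfoldTerm S T₂.1 v) (T₁.1 v)) ∧
      hA.foldHom T₁ = T₂ ∧ (A₂.IsLocallyCompact T₂.1 → A₁.IsLocallyCompact T₁.1) := by
  have hT := hA.finProp₂ _ T₂.2.2
  obtain ⟨X, hX⟩ := A.exists_hasSum_unfoldTerm hA.bijOn hT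
  have hXU := A.unfold_equivariant (hA.U₂_comm T₂.2.1) hX
  rw [hA.U₁_eq] at hXU
  refine ⟨⟨X, A₁.isEquivariant_of_apply hXU, hA.propagation_unfold _ _ hT hX⟩, hX,
    Subtype.ext <| A.ext_push fun w hw => ?_, hA.isLocallyCompact_unfold _ _ hT hX⟩
  exact (hA.fold_push _ hw).trans (A.push_of_hasSum_unfoldTerm hA.bijOn hT hX hw).2

theorem isLocallyCompact_foldHom (hA : A.IsCompatible S A₁ A₂) (T : A₁.finitePropagationAlgebra)
    (hT : A₁.IsLocallyCompact T.1) : A₂.IsLocallyCompact (hA.foldHom T).1 :=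
  hA.isLocallyCompact_fold _ _ (hA.finProp_of_mem T) (hA.hasSum_fold T) hT

/-- The folding map on the equivariant algebraic Roe algebras. -/
def foldRoeHom (hA : A.IsCompatible S A₁ A₂) : A₁.roeAlgebra →⋆ₙₐ[ℂ] A₂.roeAlgebra where
  toFun T := ⟨(hA.foldHom ⟨T.1, A₁.roeAlgebra_le T.2⟩).1,
    (hA.foldHom _).2.1, hA.isLocallyCompact_foldHom _ T.2.2.1, (hA.foldHom _).2.2⟩
  map_smul' c T := by
    have h := congrArg (fun T => T.1) (map_smul hA.foldHom c ⟨T.1, A₁.roeAlgebra_le T.2⟩)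
    exact Subtype.ext h
  map_zero' := by
    have h := congrArg (fun T => T.1) (map_zero hA.foldHom)
    exact Subtype.ext h
  map_add' T T' := by
    have h := congrArg (fun T => T.1) (map_add hA.foldHom ⟨T.1, A₁.roeAlgebra_le T.2⟩ ⟨T'.1, A₁.roeAlgebra_le T'.2⟩)
    exact Subtype.ext h
  map_mul' T T' := by
    have h := congrArg (fun T => T.1) (map_mul hA.foldHom ⟨T.1, A₁.roeAlgebra_le T.2⟩ ⟨T'.1, A₁.roeAlgebra_le T'.2⟩)
    exact Subtype.ext h
  map_star' T := by
    have h := congrArg (fun T => T.1) (map_star hA.foldHom ⟨T.1, A₁.roeAlgebra_le T.2⟩)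
    exact Subtype.ext h

theorem foldRoeHom_surjective (hA : A.IsCompatible S A₁ A₂) :
    Function.Surjective hA.foldRoeHom := by
  intro T₂
  obtain ⟨T₁, -, h, hlc⟩ := hA.exists_preimage ⟨T₂.1, A₂.roeAlgebra_le T₂.2⟩
  exact ⟨⟨T₁.1, T₁.2.1, hlc T₂.2.2.1, T₁.2.2⟩, Subtype.ext (by have h' := congrArg (fun T => T.1) h; exact h')⟩

end IsCompatible

end FoldingSystem

variable {N : Type*} [MetricSpace N] [CompactSpace N]
  {F : Type*} [NormedAddCommGroup F] [NormedSpace ℂ F] [FiniteDimensional ℂ F]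
  {E : N → Type*} [∀ x, NormedAddCommGroup (E x)] [∀ x, InnerProductSpace ℂ (E x)]
  [TopologicalSpace (TotalSpace F E)] [FiberBundle F E] [VectorBundle ℂ F E]
  [IsHermitianBundle F E]

variable {ι Γ₁ Γ₂ M₁ M₂ : Type*} [Group Γ₁] [Group Γ₂]
  [MetricSpace M₁] [MeasurableSpace M₁] [BorelSpace M₁] [MulAction Γ₁ M₁]
  [MetricSpace M₂] [MeasurableSpace M₂] [BorelSpace M₂] [MulAction Γ₂ M₂]
  {quot : Γ₁ →* Γ₂} {p₁ : C(M₁, N)} {p₂ : C(M₂, N)} {pr : C(M₁, M₂)}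
  {μ₁ : Measure M₁} {μ₂ : Measure M₂}

namespace FoldingData

variable (D : FoldingData ι quot p₁) [ProperSpace M₁] [SecondCountableTopology M₁]
  [IsIsometricSMul Γ₁ M₁] [SMulInvariantMeasure Γ₁ M₁ μ₁]
  [ProperSpace M₂] [SecondCountableTopology M₂]
  [IsIsometricSMul Γ₂ M₂] [SMulInvariantMeasure Γ₂ M₂ μ₂]
  (hc : IsMeasuredCoverProjection quot p₁ p₂ pr μ₁ μ₂)
  (hq₁ : ∀ (g : Γ₁) (x : M₁), p₁ (g • x) = p₁ x) (hq₂ : ∀ (g : Γ₂) (x : M₂), p₂ (g • x) = p₂ x)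

theorem system_isCompatible : (D.system F E hc hq₁ hq₂).IsCompatible D.S (l2Module F E μ₁ hq₁)
    (l2Module F E μ₂ hq₂) where
  U₁_eq := rfl
  U₂_eq := rfl
  bijOn := D.bijOn_S
  finProp _ h := D.finProp_of_propagation hc hq₁ hq₂ h
  finProp₂ _ h := D.finProp₂_of_propagation hc hq₁ hq₂ h
  propagation_fold _ _ hT hX := D.propagation_fold_lt_top hc hq₁ hq₂ hT hX
  propagation_unfold _ _ hT hX := D.propagation_unfold_lt_top hc hq₁ hq₂ hT hX
  isLocallyCompact_fold _ _ hT hX h := D.isLocallyCompact_fold hc.cover₁ hc.cover₂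
    hc.toIsCoverProjection (D.domSupported_P hc hq₁ hq₂) (D.ranSupported_P hc hq₁ hq₂) hT hX h
  isLocallyCompact_unfold _ _ hT hX h := D.isLocallyCompact_unfold hc.cover₁
    (D.domSupported_P hc hq₁ hq₂) (D.ranSupported_P hc hq₁ hq₂) hT hX h

/-- This matches the terms of the statement, built from chosen representatives of classes, with
those of the abstract system. -/
theorem foldTerm_eq (T : L2 F E p₁ μ₁ →L[ℂ] L2 F E p₁ μ₁) (u : L2 F E p₂ μ₂) :
    D.foldTerm hc.toIsCoverProjection T u = (D.system F E hc hq₁ hq₂).foldTerm D.S T u := by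
  funext ⟨g, s, i, j⟩
  change D.push hc.toIsCoverProjection i g (T (D.pull hc.toIsCoverProjection j s u)) =
    L2.map (D.pushSection hc i g) (T ((L2.map (D.pushSection hc j s)).adjoint u))
  rw [D.push_eq_map, D.pull_eq_map, D.adjoint_map_pushSection]

theorem preimageTerm_eq (T : L2 F E p₂ μ₂ →L[ℂ] L2 F E p₂ μ₂) (v : L2 F E p₁ μ₁) :
    D.preimageTerm hc.toIsCoverProjection T v = (D.system F E hc hq₁ hq₂).unfoldTerm D.S T v := by
  funext ⟨g, s, i, j⟩
  change D.pull hc.toIsCoverProjection j (g * s) (T (D.push hc.toIsCoverProjection i g v)) =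
    (L2.map (D.pushSection hc j (g * s))).adjoint (T (L2.map (D.pushSection hc i g) v))
  rw [D.push_eq_map, D.pull_eq_map, D.adjoint_map_pushSection]

end FoldingData

end

/-! ### Local isometry of the coverings and the main theorem -/

/-- A Riemannian Galois covering is locally isometric. -/
theorem IsRiemannianGaloisCover.exists_nhds_edist_eq {n : ℕ} {Γ M N : Type*} [Group Γ]
    [MetricSpace M] [ChartedSpace (EuclideanSpace ℝ (Fin n)) M] [IsManifold (𝓡 n) ∞ M]
    [RiemannianBundle fun x : M => TangentSpace (𝓡 n) x]
    [IsContMDiffRiemannianBundle (𝓡 n) ∞ (EuclideanSpace ℝ (Fin n))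
      fun x : M => TangentSpace (𝓡 n) x]
    [IsRiemannianManifold (𝓡 n) M] [MulAction Γ M]
    [MetricSpace N] [ChartedSpace (EuclideanSpace ℝ (Fin n)) N] [IsManifold (𝓡 n) ∞ N]
    [RiemannianBundle fun x : N => TangentSpace (𝓡 n) x]
    [IsContMDiffRiemannianBundle (𝓡 n) ∞ (EuclideanSpace ℝ (Fin n))
      fun x : N => TangentSpace (𝓡 n) x]
    [IsRiemannianManifold (𝓡 n) N] {p : C(M, N)} (hp : IsRiemannianGaloisCover n Γ p) (x : M) :
    ∃ V ∈ 𝓝 x, ∀ a ∈ V, ∀ b ∈ V, edist (p a) (p b) = edist a b := by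
  refine Folding.exists_nhds_edist_eq hp.contMDiff hp.norm_mfderiv (fun y => ?_) x
  obtain ⟨e, hy, he⟩ := hp.isQuotientCoveringMap.isCoveringMap.isLocalHomeomorph y
  refine ⟨e.source, e.open_source.mem_nhds hy, ?_⟩
  rw [he]
  exact e.injOn

/-- Near `y` both `p₁ = p₂ ∘ pr` and `p₂` preserve distances, so `pr` does. -/
theorem IsCoverProjection.exists_nhds_edist_eq {Γ₁ Γ₂ M₁ M₂ N : Type*} [Group Γ₁] [Group Γ₂]
    [MetricSpace M₁] [MetricSpace M₂] [MetricSpace N] [MulAction Γ₁ M₁] [MulAction Γ₂ M₂]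
    {quot : Γ₁ →* Γ₂} {p₁ : C(M₁, N)} {p₂ : C(M₂, N)} {pr : C(M₁, M₂)}
    (hpr : IsCoverProjection quot p₁ p₂ pr)
    (h₁ : ∀ x, ∃ V ∈ 𝓝 x, ∀ a ∈ V, ∀ b ∈ V, edist (p₁ a) (p₁ b) = edist a b)
    (h₂ : ∀ x, ∃ V ∈ 𝓝 x, ∀ a ∈ V, ∀ b ∈ V, edist (p₂ a) (p₂ b) = edist a b) (y : M₁) :
    ∃ V ∈ 𝓝 y, ∀ a ∈ V, ∀ b ∈ V, edist (pr a) (pr b) = edist a b := by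
  obtain ⟨V₁, hV₁, e₁⟩ := h₁ y
  obtain ⟨V₂, hV₂, e₂⟩ := h₂ (pr y)
  refine ⟨V₁ ∩ pr ⁻¹' V₂, Filter.inter_mem hV₁ (pr.continuous.continuousAt hV₂), ?_⟩
  rintro a ⟨ha₁, ha₂⟩ b ⟨hb₁, hb₂⟩
  rw [← e₂ _ ha₂ _ hb₂, hpr.map_proj, hpr.map_proj, e₁ a ha₁ b hb₁]

end Folding

end

open Folding in
theorem proposition3p5 {n : ℕ}
    -- the closed Riemannian manifold `N`
    {N : Type*} [MetricSpace N] [CompactSpace N]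
    [ChartedSpace (EuclideanSpace ℝ (Fin n)) N] [IsManifold (𝓡 n) ∞ N]
    [RiemannianBundle fun x : N => TangentSpace (𝓡 n) x]
    [IsContMDiffRiemannianBundle (𝓡 n) ∞ (EuclideanSpace ℝ (Fin n))
      fun x : N => TangentSpace (𝓡 n) x]
    [IsRiemannianManifold (𝓡 n) N]
    -- the Hermitian bundle `E` on `N`
    {F : Type*} [NormedAddCommGroup F] [NormedSpace ℂ F] [FiniteDimensional ℂ F]
    {E : N → Type*} [∀ x, NormedAddCommGroup (E x)] [∀ x, InnerProductSpace ℂ (E x)]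
    [TopologicalSpace (TotalSpace F E)] [FiberBundle F E] [VectorBundle ℂ F E]
    [IsHermitianBundle F E]
    -- the cover `M₁`
    {Γ₁ M₁ : Type*} [Group Γ₁] [MetricSpace M₁] [ConnectedSpace M₁] [SecondCountableTopology M₁]
    [ChartedSpace (EuclideanSpace ℝ (Fin n)) M₁] [IsManifold (𝓡 n) ∞ M₁]
    [RiemannianBundle fun x : M₁ => TangentSpace (𝓡 n) x]
    [IsContMDiffRiemannianBundle (𝓡 n) ∞ (EuclideanSpace ℝ (Fin n))
      fun x : M₁ => TangentSpace (𝓡 n) x]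
    [IsRiemannianManifold (𝓡 n) M₁] [MeasurableSpace M₁] [BorelSpace M₁]
    [MulAction Γ₁ M₁] [IsIsometricSMul Γ₁ M₁]
    -- the cover `M₂`
    {Γ₂ M₂ : Type*} [Group Γ₂] [MetricSpace M₂] [SecondCountableTopology M₂]
    [ChartedSpace (EuclideanSpace ℝ (Fin n)) M₂] [IsManifold (𝓡 n) ∞ M₂]
    [RiemannianBundle fun x : M₂ => TangentSpace (𝓡 n) x]
    [IsContMDiffRiemannianBundle (𝓡 n) ∞ (EuclideanSpace ℝ (Fin n))
      fun x : M₂ => TangentSpace (𝓡 n) x]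
    [IsRiemannianManifold (𝓡 n) M₂] [MeasurableSpace M₂] [BorelSpace M₂]
    [MulAction Γ₂ M₂] [IsIsometricSMul Γ₂ M₂]
    -- the covering maps, and the choices that define the folding map
    (p₁ : C(M₁, N)) (hp₁ : IsRiemannianGaloisCover n Γ₁ p₁)
    (p₂ : C(M₂, N)) (hp₂ : IsRiemannianGaloisCover n Γ₂ p₂)
    (quot : Γ₁ →* Γ₂) (pr : C(M₁, M₂)) (hpr : IsCoverProjection quot p₁ p₂ pr)
    {ι : Type*} (D : FoldingData ι quot p₁) :
    ∃ Ψ : fpAlgebra F E n hp₁.map_smul →⋆ₐ[ℂ] fpAlgebra F E n hp₂.map_smul,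
      (∀ T u, HasSum (D.foldTerm hpr T.1 u) ((Ψ T).1 u)) ∧
      Function.Surjective Ψ ∧
      (∀ T, (bundleModule F E n hp₁.map_smul).IsLocallyCompact T.1 →
        (bundleModule F E n hp₂.map_smul).IsLocallyCompact (Ψ T).1) ∧
      (∃ ΨRoe : algebraicRoeAlgebra F E n hp₁.map_smul →⋆ₙₐ[ℂ]
          algebraicRoeAlgebra F E n hp₂.map_smul,
        (∀ T, (ΨRoe T).1 = (Ψ ⟨T.1, algebraicRoeAlgebra_le T⟩).1) ∧
        Function.Surjective ΨRoe) ∧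
      ∀ T₂ : fpAlgebra F E n hp₂.map_smul, ∃ T₁ : fpAlgebra F E n hp₁.map_smul,
        (∀ v, HasSum (D.preimageTerm hpr T₂.1 v) (T₁.1 v)) ∧ Ψ T₁ = T₂ ∧
        ((bundleModule F E n hp₂.map_smul).IsLocallyCompact T₂.1 →
          (bundleModule F E n hp₁.map_smul).IsLocallyCompact T₁.1) := by
  have : LocallyCompactSpace M₁ := ChartedSpace.locallyCompactSpace (EuclideanSpace ℝ (Fin n)) M₁
  have hcov₁ := hp₁.isQuotientCoveringMap
  have hcov₂ := hp₂.isQuotientCoveringMap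
  -- The only analytic input from the Riemannian structure: the projection is a local isometry, so
  -- it preserves the volume on each sheet.
  have hc : IsMeasuredCoverProjection quot p₁ p₂ pr (riemannianVolume n M₁)
      (riemannianVolume n M₂) :=
    { toIsCoverProjection := hpr
      cover₁ := hcov₁
      cover₂ := hcov₂
      measurePreserving := fun U hU hinj => measurePreserving_of_locally_isometric n
        pr.continuous (hpr.isLocalHomeomorph hcov₁ hcov₂).isOpenMap
        (hpr.exists_nhds_edist_eq hp₁.exists_nhds_edist_eq hp₂.exists_nhds_edist_eq) hU hinj }
  -- The supports of the lifted partition of unity form a compact set that meets every orbit; its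
  -- image does the same in `M₂`.
  have : ProperSpace M₁ := properSpace_of_cocompact (n := n) (D.isCompact_fundamentalSet hcov₁)
    (D.exists_smul_mem_fundamentalSet hcov₁)
  have : ProperSpace M₂ := by
    refine properSpace_of_cocompact (n := n) (G := Γ₂)
      ((D.isCompact_fundamentalSet hcov₁).image pr.continuous) fun x => ?_
    obtain ⟨y, rfl⟩ := hpr.proj_surjective hcov₁ hcov₂ x
    obtain ⟨g, hg⟩ := D.exists_smul_mem_fundamentalSet hcov₁ y
    exact ⟨quot g, g • y, hg, hpr.map_smul g y⟩
  have := D.finite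
  have hA := D.system_isCompatible (F := F) (E := E) hc hp₁.map_smul hp₂.map_smul
  refine ⟨hA.foldHom, fun T u => ?_, fun T₂ => ?_, hA.isLocallyCompact_foldHom,
    ⟨hA.foldRoeHom, fun T => rfl, hA.foldRoeHom_surjective⟩, fun T₂ => ?_⟩
  · have h := hA.hasSum_fold T u
    rwa [← D.foldTerm_eq hc] at h
  · obtain ⟨T₁, -, h, -⟩ := hA.exists_preimage T₂
    exact ⟨T₁, h⟩
  · obtain ⟨T₁, h, hT⟩ := hA.exists_preimage T₂
    refine ⟨T₁, fun v => ?_, hT⟩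
    have h' := h v
    rwa [← D.preimageTerm_eq hc] at h'
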